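/- **Proposition (Diagonalisation of $H_b$).** *Notation.* Radial functions on $\{x\in\mathbb R^3:|x|\ge\sqrt b\}$ are identified with functions of $z=|x|\ge\sqrt b$. Let $\rho(z)=e^{-z^2/2}$, $\langle f,g\rangle_b=\int_{\sqrt b}^{\infty}fg\,\rho z^2dz$ for $b\ge 0$, $\|u\|_{L^2_{\rho,b}}^2=\langle u,u\rangle_b$ and $\|u\|_{H^1_{\rho,b}}^2=\|\partial_zu\|_{L^2_{\rho,b}}^2+\|u\|_{L^2_{\rho,b}}^2$. Let $H^1_{\rho,b}$ be the space of radial $u$ with $\|u\|_{H^1_{\rho,b}}<\infty$ and $u(\sqrt b)=0$. Let $\Lambda=z\partial_z$, $\Delta=\partial_z^2+\frac2z\partial_z$ and $H_b=-\Delta+\Lambda$. For $k\in\mathbb N$ put $$A_k=2^{1/4}\sqrt{\tfrac{\Gamma(k+\frac32)}{k!}},\quad B_k=\frac{\Gamma(k+\frac32)}{k!\,\Gamma(\frac32)},\quad C_k=\frac{B_k}{A_k},\quad P_k(z)=\frac{L_k^{1/2}(z^2/2)}{A_k},\quad Q_k=-\frac1zP_k+\frac2{z^2}\partial_zP_k,$$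 where $L_k^{1/2}(x)=\sum_{i=0}^k(-1)^i\frac{\Gamma(k+\frac32)}{i!(k-i)!\,\Gamma(i+\frac32)}x^i$ is the Laguerre polynomial. *Statement.* Let $K\in\mathbb N$. There are $b^*=b^*(K)>0$ and a constant depending only on $K$, which is the constant implied in every $O(\cdot)$ and $\lesssim$ below, such that for all $0<b<b^*$ and $0\le k\le K$ there are $\lambda_{b,k}\in\mathbb R$, $\mu_{b,jk}\in\mathbb R$ ($0\le j<k$), and functions $\psi_{b,k},\tilde\psi_{b,k}$ on $[\sqrt b,\infty)$, regular in $z$ and differentiable in $b$ so that all the derivatives below exist in the classical sense (one-sided at $z=\sqrt b$), with the following properties for all $0<b<b^*$ and $0\le k\le K$. * *Eigenfunctions:* $\psi_{b,k}\in H^1_{\rho,b}$, $\psi_{b,k}\neq0$ and $H_b\psi_{b,k}=\lambda_{b,k}\psi_{b,k}$. * *Eigenvalues:* $\lambda_{b,k}=2k+C_k^2\sqrt b+O(b)$ and $|\partial_b\lambda_{b,k}|\lesssim b^{-1/2}$. * *Expansion of the eigenfunctions:* $\psi_{b,k}=T_{b,k}+\tilde\psi_{b,k}$ with $$T_{b,k}(z)=P_k(z)\Big(\frac1z-\frac1{\sqrt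 b}\Big)+\sum_{j=0}^{k-1}\mu_{b,jk}P_j(z)\Big(\frac1z-\frac1{\sqrt b}\Big),$$ $$\mu_{b,jk}=\frac{\langle Q_k,P_j\rangle_0}{2(j-k)}\sqrt b+O(b),\qquad|\partial_b\mu_{b,jk}|\lesssim\frac1{\sqrt b}\qquad(0\le j<k),$$ $$\|\tilde\psi_{b,k}\|_{H^1_{\rho,b}}+\|\Delta\tilde\psi_{b,k}\|_{L^2_{\rho,b}}+\|\Lambda\tilde\psi_{b,k}\|_{L^2_{\rho,b}}+\|z\tilde\psi_{b,k}\|_{L^2_{\rho,b}}+\|z^2\tilde\psi_{b,k}\|_{L^2_{\rho,b}}+\sqrt b\,|\partial_z\tilde\psi_{b,k}(\sqrt b)|\lesssim1,$$ $$\|\partial_z\partial_b\tilde\psi_{b,k}\|_{L^2_{\rho,b}}+\|\partial_b\tilde\psi_{b,k}\|_{L^2_{\rho,b}}+\sqrt b\,|\partial_z\partial_b\tilde\psi_{b,k}(\sqrt b)|\lesssim\frac1b.$$ * *Spectral gap:* if $u\in H^1_{\rho,b}$ and $\langle u,\psi_{b,j}\rangle_b=0$ for all $0\le j\le k$, then $\|\partial_zu\|^2_{L^2_{\rho,b}}\ge(2k+2+O(\sqrt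 b))\|u\|^2_{L^2_{\rho,b}}$, with the $O(\sqrt b)$ uniform in $u$. * *Inner products:* for all $0\le i\le k$, $$\langle\psi_{b,k},\psi_{b,i}\rangle_b=\frac1b\big(\delta_{ik}+O(\sqrt b)\big),\qquad\langle b\,\partial_b\psi_{b,k},\psi_{b,i}\rangle_b=-\frac1{2b}\big(\delta_{ik}+O(\sqrt b)\big).$$ * *Further estimates:* $$\|2b\,\partial_b\psi_{b,k}+\psi_{b,k}\|_{L^2_{\rho,b}}+\|H_b(2b\,\partial_b\psi_{b,k}+\psi_{b,k})\|_{L^2_{\rho,b}}\lesssim1,$$ $$\|\Lambda\psi_{b,0}\|_{L^2_{\rho,b}}\lesssim1,\qquad\|\Lambda\psi_{b,k}\|_{L^2_{\rho,b}}\lesssim\frac1{\sqrt b}\ \ (k\ge1),\qquad\|z\psi_{b,k}\|_{L^2_{\rho,b}}\lesssim\frac1{\sqrt b},\qquad\|z^2\psi_{b,k}\|_{L^2_{\rho,b}}\lesssim\frac1{\sqrt b},$$ and, with $R_{b,k}=\Lambda\psi_{b,k}-2k\Big(\psi_{b,k}-\frac{2k+1}{2k}\frac{A_{k-1}}{A_k}\psi_{b,k-1}\Big)$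 for $k\ge1$ and $R_{b,0}=\Lambda\psi_{b,0}$, $$\|R_{b,k}\|_{L^2_{\rho,b}}+\|H_bR_{b,k}\|_{L^2_{\rho,b}}\lesssim1.$$ -/

import Mathlib

open Set MeasureTheory

namespace RadialStefan

noncomputable section

/-! A radial function on `{x ∈ ℝ³ : |x| ≥ √b}` is represented by its profile `f : ℝ → ℝ`, of which
only the values on `[√b, ∞)` are ever used. -/

/-- The measure `ρ(z) z² dz` on `(√b, ∞)`, with the Gaussian weight `ρ(z) = exp (-z²/2)`. -/
def wMeasure (b : ℝ) : Measure ℝ :=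
  (volume.restrict (Ioi (√b))).withDensity
    (fun z => ENNReal.ofReal (Real.exp (-z ^ 2 / 2) * z ^ 2))

/-- The inner product `⟨f, g⟩_b = ∫_{√b}^∞ f g ρ z² dz`. -/
def wInner (b : ℝ) (f g : ℝ → ℝ) : ℝ := ∫ z, f z * g z ∂(wMeasure b)

/-- The norm of `L²_{ρ,b}`, equal to `∞` when `f` is not square integrable. -/
def wNorm (b : ℝ) (f : ℝ → ℝ) : ENNReal := eLpNorm f 2 (wMeasure b)

/-- The radial derivative `∂_z` on `[√b, ∞)` (one-sided at the endpoint `√b`). -/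
def dz (b : ℝ) (f : ℝ → ℝ) (z : ℝ) : ℝ := derivWithin f (Ici (√b)) z

/-- The derivative in the parameter `b` of a family `f b z`, which lives on `{(b, z) : z ≥ √b}`:
for fixed `z`, the parameter ranges over `0 < b ≤ z²`. For `z > √b` this is the usual two-sided
derivative, at the boundary point `z = √b` it is the one-sided one. -/
def dB (f : ℝ → ℝ → ℝ) (b z : ℝ) : ℝ := derivWithin (fun b' => f b' z) (Ioc 0 (z ^ 2)) b

/-- The radial Laplacian in dimension three, `Δ f = ∂_z² f + (2/z) ∂_z f`. -/
def lap (b : ℝ) (f : ℝ → ℝ) (z : ℝ) : ℝ := dz b (dz b f) z + 2 / z * dz b f z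

/-- `Λ f = z ∂_z f`. -/
def Lam (b : ℝ) (f : ℝ → ℝ) (z : ℝ) : ℝ := z * dz b f z

/-- `H_b f = -Δ f + Λ f`. -/
def Hop (b : ℝ) (f : ℝ → ℝ) (z : ℝ) : ℝ := -lap b f z + Lam b f z

/-- The norm of `H¹_{ρ,b}`. -/
def wNormH1 (b : ℝ) (f : ℝ → ℝ) : ENNReal :=
  (wNorm b (dz b f) ^ 2 + wNorm b f ^ 2) ^ (1 / 2 : ℝ)

/-- `u ∈ H¹_{ρ,b}`: `u` vanishes at `√b`, and `u` and its weak derivative are in `L²_{ρ,b}`.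
In one variable a function with a locally integrable weak derivative is (after choice of its
continuous representative) a locally absolutely continuous one, and then its weak derivative is its
almost everywhere defined classical derivative. -/
structure MemH1 (b : ℝ) (u : ℝ → ℝ) : Prop where
  boundary : u (√b) = 0
  locallyAC : ∀ R, √b ≤ R → AbsolutelyContinuousOnInterval u (√b) R
  memLp : MemLp u 2 (wMeasure b)
  memLp_deriv : MemLp (dz b u) 2 (wMeasure b)

/-- The generalised Laguerre polynomial `L_k^μ` with `μ = 1/2`. -/
def laguerreHalf (k : ℕ) (x : ℝ) : ℝ :=
  ∑ i ∈ Finset.range (k + 1), (-1 : ℝ) ^ i * Real.Gamma (1 / 2 + k + 1) /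
    ((i.factorial : ℝ) * ((k - i).factorial : ℝ) * Real.Gamma (1 / 2 + i + 1)) * x ^ i

/-- `A_k = 2^{1/4} √(Γ(1/2+k+1)/k!)`. -/
def coefA (k : ℕ) : ℝ :=
  (2 : ℝ) ^ (1 / 4 : ℝ) * √(Real.Gamma (1 / 2 + k + 1) / (k.factorial : ℝ))

/-- `B_k = Γ(1/2+k+1)/(k! Γ(1/2+1))`. -/
def coefB (k : ℕ) : ℝ :=
  Real.Gamma (1 / 2 + k + 1) / ((k.factorial : ℝ) * Real.Gamma (1 / 2 + 1))

/-- `C_k = B_k/A_k`. -/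
def coefC (k : ℕ) : ℝ := coefB k / coefA k

/-- The normalised Laguerre modes `P_k(z) = L_k^{1/2}(z²/2)/A_k`. -/
def P (k : ℕ) (z : ℝ) : ℝ := laguerreHalf k (z ^ 2 / 2) / coefA k

/-- `Q_k = -P_k/z + (2/z²) ∂_z P_k`. -/
def Q (k : ℕ) (z : ℝ) : ℝ := -(1 / z) * P k z + 2 / z ^ 2 * deriv (P k) z

/-- `T_{b,k}(z) = P_k(z)(1/z - 1/√b) + ∑_{j<k} μ_{b,jk} P_j(z)(1/z - 1/√b)`, where `mu j k b` stands
for `μ_{b,jk}`. -/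
def Tprofile (mu : ℕ → ℕ → ℝ → ℝ) (k : ℕ) (b z : ℝ) : ℝ :=
  P k z * (1 / z - 1 / √b) + ∑ j ∈ Finset.range k, mu j k b * P j z * (1 / z - 1 / √b)

/-- The commutator remainder `Λψ_k - 2k (ψ_k - (2k+1)/(2k) · (A_{k-1}/A_k) ψ_{k-1})` at the
parameter `b`. For `k = 0` the prefactor `2k` vanishes and it is `Λψ_0`. -/
def LamRem (psi : ℕ → ℝ → ℝ → ℝ) (k : ℕ) (b z : ℝ) : ℝ :=
  Lam b (psi k b) z - 2 * k *
    (psi k b z - (2 * k + 1) / (2 * k) * (coefA (k - 1) / coefA k) * psi (k - 1) b z)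

end

end RadialStefan

open RadialStefan

/-! Writing ψ = v/z makes the problem one-dimensional: H_b(v/z) = (-v'' + z v' - v)/z. Thus H_b ψ =
λψ is Hermite's equation v'' - z v' + (λ+1) v = 0, solved with polynomial growth at +∞ by the
Hermite function of degree λ+1, and the boundary condition is v(√b) = 0. With λ = 2k + e and a = √b,
an eigenvalue near 2k is a zero in e of G_k(a, e), where G_k is `oddHerm k`. At the origin G_k
vanishes, because G_k(·, 0) is the odd polynomial He_{2k+1}, while ∂_e G_k ≠ 0 (`De_oddHerm`). The
implicit function theorem gives a C² branch e = `root k a`, and `Dz_add_De_oddHerm` identifies its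
slope at 0 as C_k². Hence λ_{b,k} = 2k + root k (√b), and ψ_{b,k} is an explicit multiple of G_k(z,
root k (√b))/(√b z).

The Hermite functions come from ∫₀^∞ t^(-e) exp(-t²/2 - zt) dt, of degree e - 1, by repeated use of
the raising operator z - ∂_z. They lie in `HClass`, which is closed under ∂_z and ∂_e and whose
members are O((1+z)^N) for z ≥ 0, uniformly in |e| < 1/2. At e = 0 the normalised profile is z P_k
(`mul_P_eq`), so the deviations from P_k are difference quotients or Taylor remainders in e, with e
= O(a). Each norm estimate then says that some function is v(a, z)/z, times a power of a, with v
polynomially bounded (`PolyBdd`): the weight z² ρ absorbs 1/z² and the Gaussian absorbs the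
polynomial. For first derivatives of the remainder one more 1/z is gained from its vanishing at z =
a. The coefficients μ_{b,jk} are taken equal to their leading terms; being O(√b), they perturb the
remainder only by O(1).

For the spectral gap, the P_j form an orthonormal basis of L² on (0, ∞), and the P_j' are orthogonal
with squared norms 2j. For u vanishing at √b, integration by parts gives ⟨u', P_j'⟩ = 2j ⟨u, P_j⟩,
so Parseval for u and Bessel for u' yield the gap 2k+2 up to the components of u along P_0, …, P_k
(`spectral_gap_zero`). If u is orthogonal to ψ_{b,j}, its component along P_j is small, because P_j
+ √b ψ_{b,j} = O(√b) in L² (`integral_mul_polyP_le`). -/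

section

open Filter Topology

/-! ### The integrals behind the Hermite functions -/

/-- The integrand of `hermInt`. -/
noncomputable def hermKer (m l : ℕ) (z e t : ℝ) : ℝ :=
  t ^ m * Real.log t ^ l * Real.exp (-(e * Real.log t + t ^ 2 / 2 + z * t))

/-- The integrals `∫₀^∞ t^(m-e) (log t)^l exp (-t²/2 - z t) dt`, from which the Hermite functions of
non-integer degree are built. -/
noncomputable def hermInt (m l : ℕ) (z e : ℝ) : ℝ := ∫ t in Ioi (0 : ℝ), hermKer m l z e t

/-- A majorant of `hermKer`, uniform for `|e| ≤ 1/2` and `-R ≤ z`. -/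
noncomputable def hermDom (m l : ℕ) (R t : ℝ) : ℝ :=
  (l.factorial * 4 ^ l * Real.exp (R ^ 2)) *
    (t ^ ((m : ℝ) - 3 / 4) * Real.exp (-(1 / 4) * t ^ 2)
      + t ^ ((m : ℝ) + 1) * Real.exp (-(1 / 4) * t ^ 2))

theorem integrableOn_hermDom (m l : ℕ) (R : ℝ) : IntegrableOn (hermDom m l R) (Ioi 0) := by
  refine Integrable.const_mul (Integrable.add ?_ ?_) _
  · exact integrableOn_rpow_mul_exp_neg_mul_sq (by norm_num)
      (by have : (0 : ℝ) ≤ m := m.cast_nonneg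
          linarith)
  · exact integrableOn_rpow_mul_exp_neg_mul_sq (by norm_num)
      (by have : (0 : ℝ) ≤ m := m.cast_nonneg
          linarith)

/-- With x = |log t|, the power of the logarithm costs exp(x/4) and t^(-e) costs exp(x/2). The
product exp(3x/4) is t^(-3/4) for t ≤ 1, still integrable at 0, and at most t for t ≥ 1. -/
theorem abs_log_pow_mul_exp_le (l : ℕ) {e t : ℝ} (ht : 0 < t) (he : |e| ≤ 1 / 2) :
    |Real.log t| ^ l * Real.exp (-(e * Real.log t)) ≤
      l.factorial * 4 ^ l * (t ^ (-(3 / 4) : ℝ) + t) := by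
  set x := |Real.log t| with hx
  have hx0 : 0 ≤ x := abs_nonneg _
  have h1 : x ^ l ≤ l.factorial * 4 ^ l * Real.exp (x / 4) := by
    have := Real.pow_div_factorial_le_exp (x / 4) (by positivity) l
    rw [div_le_iff₀ (by positivity), div_pow, div_le_iff₀ (by positivity)] at this
    linarith
  have h2 : Real.exp (-(e * Real.log t)) ≤ Real.exp (x / 2) := by
    apply Real.exp_le_exp.2
    calc -(e * Real.log t) ≤ |e * Real.log t| := neg_le_abs _
      _ = |e| * x := abs_mul _ _
      _ ≤ 1 / 2 * x := by gcongr
      _ = x / 2 := by ring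
  have h3 : Real.exp (x / 4) * Real.exp (x / 2) ≤ t ^ (-(3 / 4) : ℝ) + t := by
    rw [← Real.exp_add, Real.rpow_def_of_pos ht]
    rcases le_total 0 (Real.log t) with h | h
    · have : Real.exp (x / 4 + x / 2) ≤ t := by
        conv_rhs => rw [← Real.exp_log ht]
        apply Real.exp_le_exp.2
        rw [hx, abs_of_nonneg h]
        linarith
      have := Real.exp_pos (Real.log t * -(3 / 4))
      linarith
    · have : Real.exp (x / 4 + x / 2) = Real.exp (Real.log t * -(3 / 4)) := by
        rw [hx, abs_of_nonpos h]
        ring_nf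
      linarith
  calc x ^ l * Real.exp (-(e * Real.log t))
      ≤ (l.factorial * 4 ^ l * Real.exp (x / 4)) * Real.exp (x / 2) := by gcongr
    _ = l.factorial * 4 ^ l * (Real.exp (x / 4) * Real.exp (x / 2)) := by ring
    _ ≤ _ := by gcongr

theorem abs_hermKer_le (m l : ℕ) {R z e t : ℝ} (ht : 0 < t) (he : |e| ≤ 1 / 2) (hz : -R ≤ z) :
    |hermKer m l z e t| ≤ hermDom m l R t := by
  have h1 := abs_log_pow_mul_exp_le l ht he
  have h2 : Real.exp (-(t ^ 2 / 2 + z * t)) ≤ Real.exp (R ^ 2) * Real.exp (-(1 / 4) * t ^ 2) := by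
    rw [← Real.exp_add]
    apply Real.exp_le_exp.2
    -- Here -zt ≤ Rt ≤ R² + t²/4.
    nlinarith [sq_nonneg (R - t / 2), mul_le_mul_of_nonneg_right hz ht.le]
  have h3 : t ^ ((m : ℝ) - 3 / 4) = t ^ m * t ^ (-(3 / 4) : ℝ) := by
    rw [sub_eq_add_neg, Real.rpow_add ht, Real.rpow_natCast]
  have h4 : t ^ ((m : ℝ) + 1) = t ^ m * t := by
    rw [Real.rpow_add ht, Real.rpow_natCast, Real.rpow_one]
  have h5 : |hermKer m l z e t| = t ^ m * (|Real.log t| ^ l * Real.exp (-(e * Real.log t))) *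
      Real.exp (-(t ^ 2 / 2 + z * t)) := by
    rw [hermKer, abs_mul, abs_mul, abs_pow, abs_pow, abs_of_pos ht, Real.abs_exp,
      show -(e * Real.log t + t ^ 2 / 2 + z * t) = -(e * Real.log t) + -(t ^ 2 / 2 + z * t) by ring,
      Real.exp_add]
    ring
  rw [h5, hermDom, h3, h4]
  calc t ^ m * (|Real.log t| ^ l * Real.exp (-(e * Real.log t))) *
      Real.exp (-(t ^ 2 / 2 + z * t))
      ≤ t ^ m * (l.factorial * 4 ^ l * (t ^ (-(3 / 4) : ℝ) + t)) *
        (Real.exp (R ^ 2) * Real.exp (-(1 / 4) * t ^ 2)) := by gcongr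
    _ = _ := by ring

theorem measurable_hermKer (m l : ℕ) (z e : ℝ) : Measurable (hermKer m l z e) := by
  unfold hermKer
  fun_prop

theorem integrableOn_hermKer (m l : ℕ) (z : ℝ) {e : ℝ} (he : |e| ≤ 1 / 2) :
    IntegrableOn (hermKer m l z e) (Ioi 0) := by
  refine Integrable.mono' (integrableOn_hermDom m l (-z))
    (measurable_hermKer m l z e).aestronglyMeasurable ?_
  filter_upwards [ae_restrict_mem measurableSet_Ioi] with t ht
  exact abs_hermKer_le m l ht he (by simp)

/-- A derivative in z brings down -t and one in e brings down -log t. This is why powers of both are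
carried: the family is closed under differentiation. -/
theorem hasFDerivAt_hermKer (m l : ℕ) (t : ℝ) (p : ℝ × ℝ) :
    HasFDerivAt (fun p : ℝ × ℝ => hermKer m l p.1 p.2 t)
      ((-hermKer (m + 1) l p.1 p.2 t) • ContinuousLinearMap.fst ℝ ℝ ℝ
        + (-hermKer m (l + 1) p.1 p.2 t) • ContinuousLinearMap.snd ℝ ℝ ℝ) p := by
  have h1 : HasFDerivAt (fun p : ℝ × ℝ => p.1) (ContinuousLinearMap.fst ℝ ℝ ℝ) p := hasFDerivAt_fst
  have h2 : HasFDerivAt (fun p : ℝ × ℝ => p.2) (ContinuousLinearMap.snd ℝ ℝ ℝ) p := hasFDerivAt_snd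
  have := ((((h2.mul_const (Real.log t)).add_const (t ^ 2 / 2)).add (h1.mul_const t)).neg.exp).const_mul
    (t ^ m * Real.log t ^ l)
  refine this.congr_fderiv ?_
  ext <;> simp [hermKer] <;> ring

theorem hasFDerivAt_hermInt (m l : ℕ) (z : ℝ) {e : ℝ} (he : |e| < 1 / 2) :
    HasFDerivAt (fun p : ℝ × ℝ => hermInt m l p.1 p.2)
      ((-hermInt (m + 1) l z e) • ContinuousLinearMap.fst ℝ ℝ ℝ
        + (-hermInt m (l + 1) z e) • ContinuousLinearMap.snd ℝ ℝ ℝ) (z, e) := by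
  set s : Set (ℝ × ℝ) := {p | -(|z| + 1) < p.1 ∧ |p.2| < 1 / 2} with hs
  have hopen : IsOpen s := by
    refine IsOpen.inter ?_ ?_
    · exact isOpen_lt continuous_const continuous_fst
    · exact isOpen_lt (continuous_abs.comp continuous_snd) continuous_const
  have hmem : s ∈ 𝓝 ((z, e) : ℝ × ℝ) := hopen.mem_nhds ⟨by simp; linarith [neg_abs_le z], he⟩
  have key := hasFDerivAt_integral_of_dominated_of_fderiv_le (𝕜 := ℝ)
    (μ := volume.restrict (Ioi (0 : ℝ)))
    (F := fun (p : ℝ × ℝ) t => hermKer m l p.1 p.2 t)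
    (F' := fun (p : ℝ × ℝ) t => (-hermKer (m + 1) l p.1 p.2 t) • ContinuousLinearMap.fst ℝ ℝ ℝ
        + (-hermKer m (l + 1) p.1 p.2 t) • ContinuousLinearMap.snd ℝ ℝ ℝ)
    (bound := fun t => hermDom (m + 1) l (|z| + 1) t + hermDom m (l + 1) (|z| + 1) t)
    (x₀ := (z, e)) hmem
    (Eventually.of_forall fun p => (measurable_hermKer m l _ _).aestronglyMeasurable)
    (integrableOn_hermKer m l z he.le) ?_ ?_ ?_ ?_
  · refine key.congr_fderiv ?_
    rw [integral_add, integral_smul_const, integral_smul_const, integral_neg, integral_neg]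
    · rfl
    · exact ((integrableOn_hermKer _ _ _ he.le).neg).smul_const _
    · exact ((integrableOn_hermKer _ _ _ he.le).neg).smul_const _
  · refine Measurable.aestronglyMeasurable ?_
    exact ((measurable_hermKer _ _ _ _).neg.smul_const _).add
      ((measurable_hermKer _ _ _ _).neg.smul_const _)
  · filter_upwards [ae_restrict_mem measurableSet_Ioi] with t ht p hp
    refine (norm_add_le _ _).trans ?_
    rw [norm_smul, norm_smul, norm_neg, norm_neg]
    have h1 := abs_hermKer_le (m + 1) l ht hp.2.le hp.1.le
    have h2 := abs_hermKer_le m (l + 1) ht hp.2.le hp.1.le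
    have h3 := ContinuousLinearMap.norm_fst_le ℝ ℝ ℝ
    have h4 := ContinuousLinearMap.norm_snd_le ℝ ℝ ℝ
    refine add_le_add ?_ ?_
    · exact (mul_le_of_le_one_right (norm_nonneg _) h3).trans h1
    · exact (mul_le_of_le_one_right (norm_nonneg _) h4).trans h2
  · exact (integrableOn_hermDom _ _ _).add (integrableOn_hermDom _ _ _)
  · exact Eventually.of_forall fun t p _ => hasFDerivAt_hermKer m l t p

/-- The functions `(z, e) ↦ g z e` which for `|e| < 1/2` are combinations of the `hermInt m l` with
coefficients polynomial in `z`. -/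
inductive HClass : (ℝ → ℝ → ℝ) → Prop
  | base (m l : ℕ) : HClass (hermInt m l)
  | mulz {g : ℝ → ℝ → ℝ} : HClass g → HClass (fun z e => z * g z e)
  | add {g h : ℝ → ℝ → ℝ} : HClass g → HClass h → HClass (fun z e => g z e + h z e)
  | smul {g : ℝ → ℝ → ℝ} (c : ℝ) : HClass g → HClass (fun z e => c * g z e)
  | congr {g h : ℝ → ℝ → ℝ} : HClass g → (∀ z e, |e| < 1 / 2 → h z e = g z e) → HClass h

/-- The partial derivative in the first variable. -/
noncomputable def Dz (g : ℝ → ℝ → ℝ) (z e : ℝ) : ℝ := deriv (fun z => g z e) z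

/-- The partial derivative in the second variable. -/
noncomputable def De (g : ℝ → ℝ → ℝ) (z e : ℝ) : ℝ := deriv (fun e => g z e) e

/-! ### Joint smoothness and uniform polynomial growth in (z, e) -/

namespace HClass

variable {g h : ℝ → ℝ → ℝ}

/-- Structural induction produces gradient components that are again in the class. Closure under
`Dz` and `De` follows by uniqueness of derivatives, and smoothness of every order by iteration. -/
theorem exists_hasFDerivAt (hg : HClass g) : ∃ gz ge, HClass gz ∧ HClass ge ∧
    ∀ z e, |e| < 1 / 2 → HasFDerivAt (fun p : ℝ × ℝ => g p.1 p.2)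
      (gz z e • ContinuousLinearMap.fst ℝ ℝ ℝ + ge z e • ContinuousLinearMap.snd ℝ ℝ ℝ) (z, e) := by
  induction hg with
  | base m l =>
    refine ⟨_, _, (base (m + 1) l).smul (-1), (base m (l + 1)).smul (-1), fun z e he => ?_⟩
    simpa using hasFDerivAt_hermInt m l z he
  | @mulz g hg ih =>
    obtain ⟨gz, ge, hz, he, H⟩ := ih
    refine ⟨_, _, hg.add hz.mulz, he.mulz, fun z e h => ?_⟩
    have h1 : HasFDerivAt (fun p : ℝ × ℝ => p.1) (ContinuousLinearMap.fst ℝ ℝ ℝ) (z, e) :=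
      hasFDerivAt_fst
    refine (h1.mul (H z e h)).congr_fderiv ?_
    ext
    · simp; ring
    · simp
  | add _ _ ih1 ih2 =>
    obtain ⟨gz, ge, hz, he, H⟩ := ih1
    obtain ⟨gz', ge', hz', he', H'⟩ := ih2
    refine ⟨_, _, hz.add hz', he.add he', fun z e h => ?_⟩
    refine ((H z e h).add (H' z e h)).congr_fderiv ?_
    ext <;> simp
  | smul c _ ih =>
    obtain ⟨gz, ge, hz, he, H⟩ := ih
    refine ⟨_, _, hz.smul c, he.smul c, fun z e h => ?_⟩
    refine ((H z e h).const_mul c).congr_fderiv ?_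
    ext <;> simp
  | @congr g h _ hgh ih =>
    obtain ⟨gz, ge, hz, he, H⟩ := ih
    refine ⟨_, _, hz, he, fun z e he => ?_⟩
    refine (H z e he).congr_of_eventuallyEq ?_
    have : {p : ℝ × ℝ | |p.2| < 1 / 2} ∈ 𝓝 ((z, e) : ℝ × ℝ) :=
      (isOpen_lt (continuous_abs.comp continuous_snd) continuous_const).mem_nhds he
    filter_upwards [this] with p hp
    exact hgh _ _ hp

theorem hasDerivAt_of_hasFDerivAt {gz ge z e : ℝ}
    (H : HasFDerivAt (fun p : ℝ × ℝ => g p.1 p.2)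
      (gz • ContinuousLinearMap.fst ℝ ℝ ℝ + ge • ContinuousLinearMap.snd ℝ ℝ ℝ) (z, e)) :
    HasDerivAt (fun z => g z e) gz z ∧ HasDerivAt (fun e => g z e) ge e := by
  constructor
  · have := H.comp_hasDerivAt z ((hasDerivAt_id z).prodMk (hasDerivAt_const z e))
    exact this.congr_deriv (by simp)
  · have := H.comp_hasDerivAt e ((hasDerivAt_const e z).prodMk (hasDerivAt_id e))
    exact this.congr_deriv (by simp)

theorem dz (hg : HClass g) : HClass (Dz g) := by
  obtain ⟨gz, ge, hz, he, H⟩ := hg.exists_hasFDerivAt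
  exact hz.congr fun z e he => (hasDerivAt_of_hasFDerivAt (H z e he)).1.deriv

theorem de (hg : HClass g) : HClass (De g) := by
  obtain ⟨gz, ge, hz, he, H⟩ := hg.exists_hasFDerivAt
  exact he.congr fun z e he => (hasDerivAt_of_hasFDerivAt (H z e he)).2.deriv

theorem hasFDerivAt (hg : HClass g) (z : ℝ) {e : ℝ} (he : |e| < 1 / 2) :
    HasFDerivAt (fun p : ℝ × ℝ => g p.1 p.2)
      (Dz g z e • ContinuousLinearMap.fst ℝ ℝ ℝ + De g z e • ContinuousLinearMap.snd ℝ ℝ ℝ)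
      (z, e) := by
  obtain ⟨gz, ge, -, -, H⟩ := hg.exists_hasFDerivAt
  obtain ⟨h1, h2⟩ := hasDerivAt_of_hasFDerivAt (H z e he)
  rw [Dz, De, h1.deriv, h2.deriv]
  exact H z e he

theorem hasDerivAt_dz (hg : HClass g) (z : ℝ) {e : ℝ} (he : |e| < 1 / 2) :
    HasDerivAt (fun z => g z e) (Dz g z e) z :=
  (hasDerivAt_of_hasFDerivAt (hg.hasFDerivAt z he)).1

theorem hasDerivAt_de (hg : HClass g) (z : ℝ) {e : ℝ} (he : |e| < 1 / 2) :
    HasDerivAt (fun e => g z e) (De g z e) e :=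
  (hasDerivAt_of_hasFDerivAt (hg.hasFDerivAt z he)).2

theorem contDiffOn (n : ℕ) : ∀ {g : ℝ → ℝ → ℝ}, HClass g →
    ContDiffOn ℝ n (fun p : ℝ × ℝ => g p.1 p.2) {p | |p.2| < 1 / 2} := by
  have hopen : IsOpen {p : ℝ × ℝ | |p.2| < 1 / 2} :=
    isOpen_lt (continuous_abs.comp continuous_snd) continuous_const
  induction n with
  | zero =>
    intro g hg
    refine contDiffOn_zero.2 fun p hp => ?_
    exact (hg.hasFDerivAt p.1 hp).continuousAt.continuousWithinAt
  | succ n ih =>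
    intro g hg
    push_cast
    rw [contDiffOn_succ_iff_fderiv_of_isOpen hopen]
    refine ⟨fun p hp => (hg.hasFDerivAt p.1 hp).differentiableAt.differentiableWithinAt,
      by simp, ?_⟩
    have h2 : ContDiffOn ℝ n (fun p : ℝ × ℝ => Dz g p.1 p.2 • ContinuousLinearMap.fst ℝ ℝ ℝ
        + De g p.1 p.2 • ContinuousLinearMap.snd ℝ ℝ ℝ) {p | |p.2| < 1 / 2} :=
      ((ih hg.dz).smul contDiffOn_const).add ((ih hg.de).smul contDiffOn_const)
    exact h2.congr fun p hp => (hg.hasFDerivAt p.1 hp).fderiv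

theorem contDiffAt (hg : HClass g) (n : ℕ) (z : ℝ) {e : ℝ} (he : |e| < 1 / 2) :
    ContDiffAt ℝ n (fun p : ℝ × ℝ => g p.1 p.2) (z, e) :=
  (hg.contDiffOn n).contDiffAt
    ((isOpen_lt (continuous_abs.comp continuous_snd) continuous_const).mem_nhds he)

theorem contDiff_left (hg : HClass g) (n : ℕ) {e : ℝ} (he : |e| < 1 / 2) :
    ContDiff ℝ n (fun z => g z e) := by
  rw [contDiff_iff_contDiffAt]
  intro z
  exact (hg.contDiffAt n z he).comp z (contDiffAt_id.prodMk contDiffAt_const)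

/-- For z ≥ 0 the factor exp(-zt) is at most 1, so the basic integrals are bounded uniformly in z
and e; growth comes only from multiplications by z. -/
theorem exists_bound (hg : HClass g) : ∃ C : ℝ, 0 ≤ C ∧ ∃ N : ℕ, ∀ z e, 0 ≤ z → |e| < 1 / 2 →
    |g z e| ≤ C * (1 + z) ^ N := by
  induction hg with
  | base m l =>
    refine ⟨∫ t in Ioi (0 : ℝ), hermDom m l 0 t, ?_, 0, fun z e hz he => ?_⟩
    · refine setIntegral_nonneg measurableSet_Ioi fun t ht => ?_
      exact (abs_nonneg _).trans
        (abs_hermKer_le m l (z := 0) (e := 0) (R := 0) ht (by norm_num) (by norm_num))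
    · rw [pow_zero, mul_one, hermInt]
      rw [← Real.norm_eq_abs]
      refine norm_integral_le_of_norm_le (integrableOn_hermDom m l 0) ?_
      filter_upwards [ae_restrict_mem measurableSet_Ioi] with t ht
      exact abs_hermKer_le m l ht he.le (by simpa using hz)
  | mulz _ ih =>
    obtain ⟨C, hC, N, H⟩ := ih
    refine ⟨C, hC, N + 1, fun z e hz he => ?_⟩
    rw [abs_mul, abs_of_nonneg hz, pow_succ]
    nlinarith [mul_le_mul_of_nonneg_left (H z e hz he) hz,
      show 0 ≤ C * (1 + z) ^ N by positivity]
  | add _ _ ih1 ih2 =>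
    obtain ⟨C, hC, N, H⟩ := ih1
    obtain ⟨C', hC', N', H'⟩ := ih2
    refine ⟨C + C', by positivity, N + N', fun z e hz he => (abs_add_le _ _).trans ?_⟩
    have h1 : (1 + z) ^ N ≤ (1 + z) ^ (N + N') := pow_le_pow_right₀ (by linarith) (by omega)
    have h2 : (1 + z) ^ N' ≤ (1 + z) ^ (N + N') := pow_le_pow_right₀ (by linarith) (by omega)
    have := H z e hz he
    have := H' z e hz he
    nlinarith [mul_le_mul_of_nonneg_left h1 hC, mul_le_mul_of_nonneg_left h2 hC']
  | smul c _ ih =>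
    obtain ⟨C, hC, N, H⟩ := ih
    refine ⟨|c| * C, by positivity, N, fun z e hz he => ?_⟩
    rw [abs_mul, mul_assoc]
    exact mul_le_mul_of_nonneg_left (H z e hz he) (abs_nonneg c)
  | congr _ hgh ih =>
    obtain ⟨C, hC, N, H⟩ := ih
    exact ⟨C, hC, N, fun z e hz he => by rw [hgh z e he]; exact H z e hz he⟩

theorem exists_sub_bound (hg : HClass g) : ∃ C : ℝ, 0 ≤ C ∧ ∃ N : ℕ, ∀ z e, 0 ≤ z → |e| < 1 / 2 →
    |g z e - g z 0| ≤ C * |e| * (1 + z) ^ N := by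
  obtain ⟨C, hC, N, H⟩ := hg.de.exists_bound
  refine ⟨C, hC, N, fun z e hz he => ?_⟩
  have hs : ∀ x ∈ uIcc 0 e, |x| < 1 / 2 := fun x hx => by
    have := abs_sub_left_of_mem_uIcc hx
    simp only [sub_zero] at this
    linarith
  have := (convex_uIcc (0 : ℝ) e).norm_image_sub_le_of_norm_hasDerivWithin_le
    (f := fun e => g z e) (f' := fun e => De g z e) (C := C * (1 + z) ^ N)
    (fun x hx => (hg.hasDerivAt_de z (hs x hx)).hasDerivWithinAt)
    (fun x hx => H z x hz (hs x hx)) left_mem_uIcc right_mem_uIcc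
  simp only [sub_zero, Real.norm_eq_abs] at this
  linarith

/-- The expansion is centred at e, not at 0: the e-derivative of g - e ∂_e g is -e ∂_e² g, to which
the mean value inequality applies. The derivative in a of a quotient (g(z, r(a)) - g(z, 0))/a has
this shape. -/
theorem exists_taylor_bound (hg : HClass g) : ∃ C : ℝ, 0 ≤ C ∧ ∃ N : ℕ, ∀ z e, 0 ≤ z → |e| < 1 / 2 →
    |g z e - g z 0 - e * De g z e| ≤ C * |e| ^ 2 * (1 + z) ^ N := by
  obtain ⟨C, hC, N, H⟩ := hg.de.de.exists_bound
  refine ⟨C, hC, N, fun z e hz he => ?_⟩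
  have hs : ∀ x ∈ uIcc 0 e, |x| ≤ |e| := fun x hx => by
    have := abs_sub_left_of_mem_uIcc hx
    simpa using this
  have := (convex_uIcc (0 : ℝ) e).norm_image_sub_le_of_norm_hasDerivWithin_le
    (f := fun e => g z e - e * De g z e) (f' := fun e => -(e * De (De g) z e))
    (C := |e| * (C * (1 + z) ^ N))
    (fun x hx => by
      have hx' : |x| < 1 / 2 := (hs x hx).trans_lt he
      have := (hg.hasDerivAt_de z hx').sub ((hasDerivAt_id x).mul (hg.de.hasDerivAt_de z hx'))
      refine HasDerivAt.hasDerivWithinAt (this.congr_deriv ?_)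
      simp)
    (fun x hx => by
      rw [norm_neg, norm_mul, Real.norm_eq_abs, Real.norm_eq_abs]
      exact mul_le_mul (hs x hx) (H z x hz ((hs x hx).trans_lt he)) (abs_nonneg _) (abs_nonneg _))
    left_mem_uIcc right_mem_uIcc
  simp only [sub_zero, Real.norm_eq_abs, zero_mul] at this
  rw [show g z e - g z 0 - e * De g z e = g z e - e * De g z e - g z 0 by ring]
  calc _ ≤ _ := this
    _ = _ := by ring

end HClass

/-! ### Hermite functions of non-integer degree -/

theorem Dz_hermInt (m l : ℕ) (z : ℝ) {e : ℝ} (he : |e| < 1 / 2) :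
    Dz (hermInt m l) z e = -hermInt (m + 1) l z e :=
  (HClass.hasDerivAt_of_hasFDerivAt (hasFDerivAt_hermInt m l z he)).1.deriv

/-- `t^(1-e) exp (-t²/2 - z t)` vanishes at both ends of `(0, ∞)`. -/
theorem hermInt_two_add (z : ℝ) {e : ℝ} (he : |e| < 1 / 2) :
    hermInt 2 0 z e + z * hermInt 1 0 z e + (-1 + e) * hermInt 0 0 z e = 0 := by
  have i0 := integrableOn_hermKer 0 0 z he.le
  have i1 := integrableOn_hermKer 1 0 z he.le
  have i2 := integrableOn_hermKer 2 0 z he.le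
  have hd : ∀ t ∈ Ioi (0 : ℝ), HasDerivAt (hermKer 1 0 z e)
      (-(hermKer 2 0 z e t + z * hermKer 1 0 z e t + (-1 + e) * hermKer 0 0 z e t)) t := by
    intro t ht
    have ht' : t ≠ 0 := (show 0 < t from ht).ne'
    have h1 := (((Real.hasDerivAt_log ht').const_mul e).add
      (((hasDerivAt_pow 2 t).div_const 2))).add ((hasDerivAt_id t).const_mul z)
    have h2 := (hasDerivAt_id t).mul h1.neg.exp
    have h3 : hermKer 1 0 z e =
        fun t => t * Real.exp (-(e * Real.log t + t ^ 2 / 2 + z * t)) := by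
      funext t
      simp [hermKer]
    rw [h3]
    refine h2.congr_deriv ?_
    simp only [hermKer, Pi.neg_apply, Pi.add_apply, id]
    field_simp
    ring
  have hint : IntegrableOn (fun t => -(hermKer 2 0 z e t + z * hermKer 1 0 z e t
      + (-1 + e) * hermKer 0 0 z e t)) (Ioi 0) :=
    ((i2.add (i1.const_mul z)).add (i0.const_mul (-1 + e))).neg
  -- At t = 0 only continuity is used, because of the logarithm in the exponent. It follows by
  -- squeezing: the majorant with m = 1 has the positive exponents 1/4 and 2.
  have hcont : ContinuousWithinAt (hermKer 1 0 z e) (Ici 0) 0 := by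
    have h0 : hermKer 1 0 z e 0 = 0 := by simp [hermKer]
    have hdom : ContinuousAt (hermDom 1 0 |z|) 0 := by
      unfold hermDom
      refine ContinuousAt.mul continuousAt_const (ContinuousAt.add ?_ ?_)
      · refine ContinuousAt.mul ?_ (by fun_prop)
        exact Real.continuousAt_rpow_const _ _ (Or.inr (by norm_num))
      · refine ContinuousAt.mul ?_ (by fun_prop)
        exact Real.continuousAt_rpow_const _ _ (Or.inr (by norm_num))
    have hdom0 : hermDom 1 0 |z| 0 = 0 := by
      rw [hermDom, Real.zero_rpow (by norm_num), Real.zero_rpow (by norm_num)]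
      simp
    rw [ContinuousWithinAt, h0]
    refine squeeze_zero_norm' (a := hermDom 1 0 |z|) ?_ ?_
    · filter_upwards [self_mem_nhdsWithin] with t ht
      rcases (show (0 : ℝ) ≤ t from ht).eq_or_lt with rfl | ht
      · rw [h0, hdom0, norm_zero]
      · exact abs_hermKer_le 1 0 ht he.le (neg_abs_le z)
    · have := hdom.continuousWithinAt (s := Ici 0)
      rwa [ContinuousWithinAt, hdom0] at this
  have hlim := tendsto_zero_of_hasDerivAt_of_integrableOn_Ioi hd hint i1
  have key := integral_Ioi_of_hasDerivAt_of_tendsto hcont hd hint hlim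
  rw [integral_neg] at key
  have hsum := integral_add (i2.add (i1.const_mul z)) (i0.const_mul (-1 + e))
  simp only [Pi.add_apply] at hsum
  rw [hsum, integral_add i2 (i1.const_mul z), integral_const_mul, integral_const_mul] at key
  have h0 : hermKer 1 0 z e 0 = 0 := by simp [hermKer]
  rw [h0] at key
  simp only [hermInt]
  linarith

/-- At e = 0 the integrand (z + t) exp(-t²/2 - zt) is minus the derivative of an exponential falling
from 1 to 0. The identity says that the function of degree 0 is He_0 = 1, which starts the
identification with Hermite polynomials. -/
theorem hermInt_one_add (z : ℝ) : z * hermInt 0 0 z 0 + hermInt 1 0 z 0 = 1 := by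
  have i0 := integrableOn_hermKer 0 0 z (e := 0) (by norm_num)
  have i1 := integrableOn_hermKer 1 0 z (e := 0) (by norm_num)
  have hd : ∀ t ∈ Ici (0 : ℝ), HasDerivAt (hermKer 0 0 z 0)
      (-(z * hermKer 0 0 z 0 t + hermKer 1 0 z 0 t)) t := by
    intro t _
    have h2 := (((hasDerivAt_pow 2 t).div_const 2).add ((hasDerivAt_id t).const_mul z)).neg.exp
    have h3 : hermKer 0 0 z 0 = fun t => Real.exp (-(t ^ 2 / 2 + z * t)) := by
      funext t
      simp [hermKer]
    rw [h3]
    refine h2.congr_deriv ?_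
    simp [hermKer]
    ring
  have hint : IntegrableOn (fun t => -(z * hermKer 0 0 z 0 t + hermKer 1 0 z 0 t)) (Ioi 0) :=
    ((i0.const_mul z).add i1).neg
  have hlim := tendsto_zero_of_hasDerivAt_of_integrableOn_Ioi
    (fun t ht => hd t (le_of_lt (show 0 < t from ht))) hint i0
  have key := integral_Ioi_of_hasDerivAt_of_tendsto' hd hint hlim
  rw [integral_neg, integral_add (i0.const_mul z) i1, integral_const_mul] at key
  have h0 : hermKer 0 0 z 0 0 = 1 := by simp [hermKer]
  rw [h0] at key
  simp only [hermInt]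
  linarith

theorem hermInt_zero_zero : hermInt 0 0 0 0 = √(Real.pi * 2) / 2 := by
  have := integral_gaussian_Ioi (1 / 2)
  rw [hermInt]
  convert! this using 3
  · simp [hermKer]
    ring_nf
  · simp

/-- The Hermite function of degree `n - 1 + e`, suitably normalised. -/
noncomputable def hermFun : ℕ → ℝ → ℝ → ℝ
  | 0 => hermInt 0 0
  | n + 1 => fun z e => z * hermFun n z e - Dz (hermFun n) z e

theorem hermFun_succ (n : ℕ) (z e : ℝ) :
    hermFun (n + 1) z e = z * hermFun n z e - Dz (hermFun n) z e := rfl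

theorem hClass_hermFun : ∀ n, HClass (hermFun n)
  | 0 => HClass.base 0 0
  | n + 1 => ((hClass_hermFun n).mulz.add ((hClass_hermFun n).dz.smul (-1))).congr fun z e _ => by
      rw [hermFun_succ]
      ring

theorem Dz_hermFun_succ_aux (n : ℕ) (z : ℝ) {e : ℝ} (he : |e| < 1 / 2) :
    Dz (hermFun (n + 1)) z e =
      hermFun n z e + z * Dz (hermFun n) z e - Dz (Dz (hermFun n)) z e := by
  have h := hClass_hermFun n
  have := ((hasDerivAt_id z).mul (h.hasDerivAt_dz z he)).sub (h.dz.hasDerivAt_dz z he)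
  refine Eq.trans (HasDerivAt.deriv this) ?_
  simp

/-- Hermite's equation. -/
theorem hermFun_ode : ∀ (n : ℕ) (z : ℝ) {e : ℝ}, |e| < 1 / 2 →
    Dz (Dz (hermFun n)) z e - z * Dz (hermFun n) z e + (n - 1 + e) * hermFun n z e = 0
  | 0, z, e, he => by
    have h1 : Dz (hermFun 0) z e = -hermInt 1 0 z e := Dz_hermInt 0 0 z he
    have h2 : Dz (Dz (hermFun 0)) z e = hermInt 2 0 z e := by
      have h3 : (fun z => Dz (hermFun 0) z e) = fun z => -hermInt 1 0 z e :=
        funext fun z => Dz_hermInt 0 0 z he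
      rw [Dz, h3]
      have h4 := ((HClass.base 1 0).hasDerivAt_dz z he).neg
      rw [Dz_hermInt 1 0 z he, neg_neg] at h4
      exact h4.deriv
    have := hermInt_two_add z he
    rw [h1, h2, hermFun]
    push_cast
    linarith
  | n + 1, z, e, he => by
    -- The equation in degree n - 1 + e says exactly that ∂_z undoes the raising step up to the
    -- factor n + e. Inserting this lowering rule twice gives the equation one degree higher.
    have key : ∀ z, Dz (hermFun (n + 1)) z e = (n + e) * hermFun n z e := fun z => by
      rw [Dz_hermFun_succ_aux n z he]
      linarith [hermFun_ode n z he]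
    have h2 : Dz (Dz (hermFun (n + 1))) z e = (n + e) * Dz (hermFun n) z e := by
      have h3 : (fun z => Dz (hermFun (n + 1)) z e) = fun z => (n + e) * hermFun n z e :=
        funext key
      rw [Dz, h3]
      exact (((hClass_hermFun n).hasDerivAt_dz z he).const_mul _).deriv
    rw [h2, key, hermFun_succ]
    push_cast
    ring

theorem Dz_hermFun_succ (n : ℕ) (z : ℝ) {e : ℝ} (he : |e| < 1 / 2) :
    Dz (hermFun (n + 1)) z e = (n + e) * hermFun n z e := by
  rw [Dz_hermFun_succ_aux n z he]
  linarith [hermFun_ode n z he]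

/-- At z = 0 raising is -∂_z, and ∂_z lowers. This two-step recursion gives access to the
e-derivative at the origin without evaluating any logarithmic integral. -/
theorem hermFun_add_two_zero_left (n : ℕ) {e : ℝ} (he : |e| < 1 / 2) :
    hermFun (n + 2) 0 e = -((n + e) * hermFun n 0 e) := by
  rw [hermFun_succ, Dz_hermFun_succ n 0 he]
  ring

theorem hermFun_succ_zero_right (n : ℕ) (z : ℝ) :
    hermFun (n + 1) z 0 = Polynomial.aeval z (Polynomial.hermite n) := by
  induction n generalizing z with
  | zero =>
    have := Dz_hermInt 0 0 z (e := 0) (by norm_num)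
    have h2 := hermInt_one_add z
    simp only [hermFun, this]
    simp
    linarith
  | succ n ih =>
    rw [hermFun_succ, Polynomial.hermite_succ, ih, Dz, funext ih]
    simp

/-- The Hermite function of degree `2 k + 1 + e`. -/
noncomputable def oddHerm (k : ℕ) : ℝ → ℝ → ℝ := hermFun (2 * k + 2)

theorem hClass_oddHerm (k : ℕ) : HClass (oddHerm k) := hClass_hermFun _

theorem oddHerm_ode (k : ℕ) (z : ℝ) {e : ℝ} (he : |e| < 1 / 2) :
    Dz (Dz (oddHerm k)) z e - z * Dz (oddHerm k) z e + (2 * k + 1 + e) * oddHerm k z e = 0 := by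
  have := hermFun_ode (2 * k + 2) z he
  rw [← this, oddHerm]
  push_cast
  ring

theorem oddHerm_zero_right (k : ℕ) (z : ℝ) :
    oddHerm k z 0 = Polynomial.aeval z (Polynomial.hermite (2 * k + 1)) :=
  hermFun_succ_zero_right _ z

theorem oddHerm_zero_zero (k : ℕ) : oddHerm k 0 0 = 0 := by
  rw [oddHerm_zero_right, ← Polynomial.coeff_zero_eq_aeval_zero',
    Polynomial.coeff_hermite_of_odd_add (by simp), map_zero]

/-- Differentiating the two-step recursion in e produces h_n(0, 0) + n ∂_e h_n(0, 0). For n = 2k+2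
the first term vanishes, being He_{2k+1}(0), so a product of the factors -(2k+2) builds up from half
the Gaussian integral. -/
theorem De_oddHerm (k : ℕ) : De (oddHerm k) 0 0 =
    (-1) ^ (k + 1) * 2 ^ k * k.factorial * (√(Real.pi * 2) / 2) := by
  have key : ∀ n : ℕ, De (hermFun (n + 2)) 0 0 = -(hermFun n 0 0 + n * De (hermFun n) 0 0) := by
    intro n
    have h1 : (fun e => hermFun (n + 2) 0 e) =ᶠ[𝓝 0] fun e => -((n + e) * hermFun n 0 e) := by
      have : {e : ℝ | |e| < 1 / 2} ∈ 𝓝 (0 : ℝ) :=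
        (isOpen_lt continuous_abs continuous_const).mem_nhds (by simp)
      filter_upwards [this] with e he
      exact hermFun_add_two_zero_left n he
    rw [De, h1.deriv_eq]
    have h2 := (((hasDerivAt_id (0 : ℝ)).const_add (n : ℝ)).mul
      ((hClass_hermFun n).hasDerivAt_de 0 (e := 0) (by norm_num))).neg
    refine Eq.trans h2.deriv ?_
    simp
  induction k with
  | zero =>
    have h1 := key 0
    have h2 : hermFun 0 0 0 = _ := hermInt_zero_zero
    rw [h2] at h1
    rw [oddHerm, mul_zero, h1]
    simp
  | succ k ih =>
    have h2 := key (2 * k + 2)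
    have h3 := oddHerm_zero_zero k
    rw [oddHerm] at ih h3 ⊢
    rw [show 2 * (k + 1) + 2 = 2 * k + 2 + 2 by ring, h2, h3, ih, Nat.factorial_succ]
    push_cast
    ring

theorem Dz_oddHerm_succ (k : ℕ) :
    Dz (oddHerm (k + 1)) 0 0 = -(2 * k + 3) * Dz (oddHerm k) 0 0 := by
  have h0 : |(0 : ℝ)| < 1 / 2 := by norm_num
  have h1 := Dz_hermFun_succ (2 * k + 3) 0 h0
  have h2 := Dz_hermFun_succ (2 * k + 1) 0 h0
  have h3 := hermFun_add_two_zero_left (2 * k + 1) h0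
  rw [oddHerm, oddHerm, show 2 * (k + 1) + 2 = 2 * k + 3 + 1 by ring, h1,
    show 2 * k + 2 = 2 * k + 1 + 1 by ring, h2, show 2 * k + 3 = 2 * k + 1 + 2 by ring, h3]
  push_cast
  ring

theorem Dz_oddHerm_zero : Dz (oddHerm 0) 0 0 = 1 := by
  rw [oddHerm, Dz_hermFun_succ 1 0 (by norm_num), hermFun_succ_zero_right]
  simp

/-! ### The constants A_k, C_k and the slope of the zero curve -/

theorem coefA_sq (k : ℕ) :
    coefA k ^ 2 = √2 * (Real.Gamma (1 / 2 + k + 1) / k.factorial) := by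
  have hG : 0 < Real.Gamma (1 / 2 + k + 1) := Real.Gamma_pos_of_pos (by positivity)
  rw [coefA, mul_pow, Real.sq_sqrt (by positivity), Real.sqrt_eq_rpow, ← Real.rpow_natCast,
    ← Real.rpow_mul (by norm_num)]
  norm_num

theorem coefA_pos (k : ℕ) : 0 < coefA k := by
  have hG : 0 < Real.Gamma (1 / 2 + k + 1) := Real.Gamma_pos_of_pos (by positivity)
  rw [coefA]
  positivity

theorem Gamma_half_succ (k : ℕ) : Real.Gamma (1 / 2 + (k + 1 : ℕ) + 1) =
    (k + 3 / 2) * Real.Gamma (1 / 2 + k + 1) := by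
  rw [Real.Gamma_add_one (by positivity)]
  push_cast
  ring_nf

theorem Gamma_three_half : Real.Gamma (1 / 2 + 1) = √Real.pi / 2 := by
  rw [Real.Gamma_add_one (by norm_num), Real.Gamma_one_half_eq]
  ring

theorem coefC_sq (k : ℕ) : coefC k ^ 2 =
    Real.Gamma (1 / 2 + k + 1) / (k.factorial * Real.Gamma (1 / 2 + 1) ^ 2 * √2) := by
  have hG : 0 < Real.Gamma (1 / 2 + k + 1) := Real.Gamma_pos_of_pos (by positivity)
  have hG' : 0 < Real.Gamma (1 / 2 + 1) := Real.Gamma_pos_of_pos (by positivity)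
  rw [coefC, div_pow, coefA_sq, coefB]
  have : (k.factorial : ℝ) ≠ 0 := by positivity
  field_simp

/-- The slope of the zero set of `oddHerm k` at the origin is `coefC k ^ 2`. -/
theorem Dz_add_De_oddHerm (k : ℕ) :
    Dz (oddHerm k) 0 0 + De (oddHerm k) 0 0 * coefC k ^ 2 = 0 := by
  -- Passing from k to k+1 multiplies ∂_e by -2(k+1) and C_k² by (k+3/2)/(k+1). The product of these
  -- factors, -(2k+3), is also the factor gained by ∂_z.
  induction k with
  | zero =>
    rw [Dz_oddHerm_zero, De_oddHerm, coefC_sq, Nat.cast_zero, add_zero, Gamma_three_half,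
      Real.sqrt_mul Real.pi_pos.le]
    have h1 : √Real.pi ≠ 0 := by positivity
    simp
    field_simp
    ring
  | succ k ih =>
    rw [Dz_oddHerm_succ]
    rw [De_oddHerm, coefC_sq] at ih ⊢
    rw [Gamma_half_succ, Nat.factorial_succ]
    have h1 : Real.Gamma (1 / 2 + 1) ≠ 0 := by rw [Gamma_three_half]; positivity
    have h2 : (k.factorial : ℝ) ≠ 0 := by positivity
    have h3 : (k : ℝ) + 1 ≠ 0 := by positivity
    rw [← eq_neg_iff_add_eq_zero] at ih
    rw [ih]
    push_cast
    field_simp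
    ring

theorem De_oddHerm_ne_zero (k : ℕ) : De (oddHerm k) 0 0 ≠ 0 := by
  rw [De_oddHerm]
  have : (-1 : ℝ) ^ (k + 1) ≠ 0 := by simp
  positivity

/-- First and second order bounds for a `C²` function near a zero. -/
theorem ContDiffAt.exists_bounds_of_zero {r : ℝ → ℝ} (hr : ContDiffAt ℝ 2 r 0) (h0 : r 0 = 0) :
    ∃ C, 0 ≤ C ∧ ∀ᶠ a in 𝓝 (0 : ℝ), DifferentiableAt ℝ r a ∧ |r a| ≤ C * |a| ∧ |deriv r a| ≤ C ∧
      |deriv r a - deriv r 0| ≤ C * |a| ∧ |r a - deriv r 0 * a| ≤ C * a ^ 2 := by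
  -- Since r is C², its derivative is Lipschitz near 0. All four estimates follow from this, with
  -- |a| ≤ 1 used to absorb higher powers.
  have hd : ContDiffAt ℝ 1 (deriv r) 0 := by
    have := hr.derivWithin (m := 1) (by norm_num)
    simpa using this
  obtain ⟨K, t, ht, hK⟩ := hd.exists_lipschitzOnWith
  have hdiff : ∀ᶠ a in 𝓝 (0 : ℝ), DifferentiableAt ℝ r a := by
    have := hr.eventually (by simp)
    filter_upwards [this] with a ha using ha.differentiableAt (by norm_num)
  obtain ⟨δ, hδ, hball⟩ := Metric.eventually_nhds_iff.1 (hdiff.and ht)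
  set δ' := min δ 1 with hδ'
  have hδ0 : 0 < δ' := by positivity
  have hL : ∀ a, |a| < δ' → |deriv r a - deriv r 0| ≤ K * |a| := fun a ha => by
    have h1 : a ∈ t := (hball (by simpa using ha.trans_le (min_le_left _ _))).2
    have h2 := hK.dist_le_mul a h1 0 (mem_of_mem_nhds ht)
    simpa [Real.dist_eq] using h2
  have hT : ∀ a, |a| < δ' → |r a - deriv r 0 * a| ≤ K * a ^ 2 := fun a ha => by
    have hs : ∀ x ∈ uIcc 0 a, |x| ≤ |a| := fun x hx => by
      simpa using abs_sub_left_of_mem_uIcc hx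
    have := (convex_uIcc (0 : ℝ) a).norm_image_sub_le_of_norm_hasDerivWithin_le
      (f := fun a => r a - deriv r 0 * a) (f' := fun a => deriv r a - deriv r 0) (C := K * |a|)
      (fun x hx => by
        have h1 := (hball (y := x)
          (by simpa using (hs x hx).trans_lt (ha.trans_le (min_le_left _ _)))).1.hasDerivAt
        have h2 := h1.sub ((hasDerivAt_id x).const_mul (deriv r 0))
        exact HasDerivAt.hasDerivWithinAt (h2.congr_deriv (by simp)))
      (fun x hx => (hL x ((hs x hx).trans_lt ha)).trans
        (mul_le_mul_of_nonneg_left (hs x hx) K.2))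
      left_mem_uIcc right_mem_uIcc
    simp only [h0, mul_zero, sub_zero, Real.norm_eq_abs] at this
    rw [← sq_abs]
    linarith
  refine ⟨K + |deriv r 0|, by positivity, ?_⟩
  have hev : ∀ᶠ a in 𝓝 (0 : ℝ), |a| < δ' := by
    have := Metric.ball_mem_nhds (0 : ℝ) hδ0
    filter_upwards [this] with a ha
    simpa using ha
  filter_upwards [hev] with a ha
  have ha1 : |a| ≤ 1 := (ha.le.trans (min_le_right _ _))
  have hK0 : (0 : ℝ) ≤ K := K.2
  have e1 := hL a ha
  have e2 := hT a ha
  have e3 := abs_nonneg (deriv r 0)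
  have e4 := abs_nonneg a
  refine ⟨(hball (by simpa using ha.trans_le (min_le_left _ _))).1, ?_, ?_, ?_, ?_⟩
  · have h1 : |r a| ≤ |r a - deriv r 0 * a| + |deriv r 0 * a| := by
      simpa using abs_add_le (r a - deriv r 0 * a) (deriv r 0 * a)
    rw [abs_mul, ← sq_abs] at *
    nlinarith [mul_le_mul_of_nonneg_left ha1 (mul_nonneg hK0 e4)]
  · have h1 : |deriv r a| ≤ |deriv r a - deriv r 0| + |deriv r 0| := by
      simpa using abs_add_le (deriv r a - deriv r 0) (deriv r 0)
    nlinarith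
  · nlinarith
  · nlinarith [sq_nonneg a]

/-- The branch of zeros of `oddHerm k` through the origin. -/
theorem exists_root (k : ℕ) : ∃ r : ℝ → ℝ, r 0 = 0 ∧ deriv r 0 = coefC k ^ 2 ∧
    ContDiffAt ℝ 2 r 0 ∧ ∀ᶠ a in 𝓝 (0 : ℝ), oddHerm k a (r a) = 0 := by
  have hH := hClass_oddHerm k
  have h0 : |(0 : ℝ)| < 1 / 2 := by norm_num
  have cdf : ContDiffAt ℝ (2 : ℕ) (fun p : ℝ × ℝ => oddHerm k p.1 p.2) (0, 0) := hH.contDiffAt 2 0 h0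
  have hf := (hH.hasFDerivAt 0 h0)
  have hinv : (fderiv ℝ (fun p : ℝ × ℝ => oddHerm k p.1 p.2) (0, 0) ∘L
      .inr ℝ ℝ ℝ).IsInvertible := by
    refine ⟨ContinuousLinearEquiv.unitsEquivAut ℝ (Units.mk0 _ (De_oddHerm_ne_zero k)), ?_⟩
    rw [hf.fderiv]
    ext
    simp
  have pn : ((2 : ℕ) : WithTop ℕ∞) ≠ 0 := by norm_num
  set r := cdf.implicitFunction pn hinv with hr
  have hr0 : r 0 = 0 := cdf.implicitFunction_apply_self pn hinv
  have hrd : ContDiffAt ℝ 2 r 0 := by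
    simpa using cdf.contDiffAt_implicitFunction pn hinv
  have hev : ∀ᶠ a in 𝓝 (0 : ℝ), oddHerm k a (r a) = 0 := by
    have := cdf.eventually_apply_implicitFunction pn hinv
    simpa [oddHerm_zero_zero] using this
  refine ⟨r, hr0, ?_, hrd, hev⟩
  -- Differentiating G(a, r(a)) = 0 at a = 0 gives ∂_z G + ∂_e G · r'(0) = 0, which determines
  -- r'(0).
  have hd : HasDerivAt r (deriv r 0) 0 := (hrd.differentiableAt (by norm_num)).hasDerivAt
  have hf' := hf
  rw [show ((0 : ℝ), (0 : ℝ)) = (id 0, r 0) by simp [hr0]] at hf'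
  have hc := hf'.comp_hasDerivAt (0 : ℝ) ((hasDerivAt_id (0 : ℝ)).prodMk hd)
  have hz : HasDerivAt (fun _ : ℝ => (0 : ℝ)) 0 0 := hasDerivAt_const _ _
  have huniq := hc.unique (hz.congr_of_eventuallyEq hev)
  simp at huniq
  have key := Dz_add_De_oddHerm k
  have : De (oddHerm k) 0 0 * (deriv r 0 - coefC k ^ 2) = 0 := by linarith
  rcases mul_eq_zero.1 this with h | h
  · exact absurd h (De_oddHerm_ne_zero k)
  · linarith

/-! ### The weighted measure -/

theorem measurable_wDensity :
    Measurable (fun z : ℝ => ENNReal.ofReal (Real.exp (-z ^ 2 / 2) * z ^ 2)) := by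
  fun_prop

theorem integral_wMeasure (b : ℝ) (f : ℝ → ℝ) :
    ∫ z, f z ∂(wMeasure b) = ∫ z in Ioi (√b), f z * (Real.exp (-z ^ 2 / 2) * z ^ 2) := by
  rw [wMeasure, integral_withDensity_eq_integral_toReal_smul measurable_wDensity (by simp)]
  refine integral_congr_ae (Eventually.of_forall fun z => ?_)
  simp only [smul_eq_mul]
  rw [ENNReal.toReal_ofReal (by positivity), mul_comm]

theorem integrable_wMeasure_iff (b : ℝ) (f : ℝ → ℝ) : Integrable f (wMeasure b) ↔
    IntegrableOn (fun z => f z * (Real.exp (-z ^ 2 / 2) * z ^ 2)) (Ioi (√b)) := by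
  rw [wMeasure, integrable_withDensity_iff measurable_wDensity (by simp)]
  refine integrable_congr (Eventually.of_forall fun z => ?_)
  simp only
  rw [ENNReal.toReal_ofReal (by positivity)]

/-- This monotonicity is the source of uniformity in b: a nonnegative integral over (√b, ∞) is at
most the one over (0, ∞). -/
theorem wMeasure_le_zero (b : ℝ) : wMeasure b ≤ wMeasure 0 := by
  rw [wMeasure, wMeasure, ← restrict_withDensity measurableSet_Ioi,
    ← restrict_withDensity measurableSet_Ioi]
  exact Measure.restrict_mono_set _ (Ioi_subset_Ioi (by simp))

theorem ae_wMeasure (b : ℝ) : ∀ᵐ z ∂(wMeasure b), √b < z :=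
  (withDensity_absolutelyContinuous _ _).ae_le (ae_restrict_mem measurableSet_Ioi)

theorem aestronglyMeasurable_wMeasure {b : ℝ} {f : ℝ → ℝ} (hf : ContinuousOn f (Ioi (√b))) :
    AEStronglyMeasurable f (wMeasure b) :=
  (hf.aestronglyMeasurable measurableSet_Ioi).mono_ac (withDensity_absolutelyContinuous _ _)

/-- The functions which dominate everything below. -/
noncomputable def envelope (N : ℕ) (t z : ℝ) : ℝ := (1 + z) ^ N * Real.exp (t * z) / z

/-- The weight z² cancels the square of 1/z, and the Gaussian beats the exponential after completing
a square. The factor exp(tz) serves only for the hyperbolic cosine in the completeness proof. -/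
theorem memLp_envelope (N : ℕ) (t : ℝ) : MemLp (envelope N t) 2 (wMeasure 0) := by
  have hmeas : AEStronglyMeasurable (envelope N t) (wMeasure 0) := by
    refine Measurable.aestronglyMeasurable ?_
    unfold envelope
    fun_prop
  rw [memLp_two_iff_integrable_sq hmeas, integrable_wMeasure_iff, Real.sqrt_zero]
  set M := 2 * t + 1
  have hdom : IntegrableOn (fun z : ℝ => ((2 * N).factorial * Real.exp (1 + M ^ 2)) *
      Real.exp (-(1 / 4) * z ^ 2)) (Ioi 0) :=
    ((integrable_exp_neg_mul_sq (by norm_num)).const_mul _).integrableOn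
  refine Integrable.mono' hdom ?_ ?_
  · refine Measurable.aestronglyMeasurable ?_
    unfold envelope
    fun_prop
  · filter_upwards [ae_restrict_mem measurableSet_Ioi] with z hz
    have hz : 0 < z := hz
    have h1 : (1 + z) ^ (2 * N) ≤ (2 * N).factorial * Real.exp (1 + z) := by
      have := Real.pow_div_factorial_le_exp (1 + z) (by positivity) (2 * N)
      rwa [div_le_iff₀' (by positivity)] at this
    have h2 : envelope N t z ^ 2 * (Real.exp (-z ^ 2 / 2) * z ^ 2) =
        (1 + z) ^ (2 * N) * Real.exp (2 * t * z - z ^ 2 / 2) := by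
      rw [envelope, div_pow, mul_pow, ← pow_mul, ← Real.exp_nat_mul, mul_comm N 2,
        show 2 * t * z - z ^ 2 / 2 = (2 : ℕ) * (t * z) + -z ^ 2 / 2 by push_cast; ring, Real.exp_add]
      field_simp
    rw [h2, Real.norm_of_nonneg (by positivity)]
    calc (1 + z) ^ (2 * N) * Real.exp (2 * t * z - z ^ 2 / 2)
        ≤ ((2 * N).factorial * Real.exp (1 + z)) * Real.exp (2 * t * z - z ^ 2 / 2) := by gcongr
      _ = (2 * N).factorial * Real.exp (1 + z + (2 * t * z - z ^ 2 / 2)) := by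
        rw [Real.exp_add (1 + z)]
        ring
      _ ≤ (2 * N).factorial * Real.exp (1 + M ^ 2 + -(1 / 4) * z ^ 2) := by
        refine mul_le_mul_of_nonneg_left (Real.exp_le_exp.2 ?_) (by positivity)
        have hM : z + 2 * t * z = M * z := by ring
        nlinarith [sq_nonneg (M - z / 2)]
      _ = _ := by
        rw [Real.exp_add]
        ring

/-- The norm of the envelope. -/
noncomputable def envNorm (N : ℕ) : ℝ := (eLpNorm (envelope N 0) 2 (wMeasure 0)).toReal

theorem envNorm_nonneg (N : ℕ) : 0 ≤ envNorm N := ENNReal.toReal_nonneg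

theorem wNorm_le_of_bound {b C : ℝ} {N : ℕ} {f : ℝ → ℝ} (hC : 0 ≤ C)
    (hf : ∀ z, √b < z → |f z| ≤ C * ((1 + z) ^ N / z)) :
    wNorm b f ≤ ENNReal.ofReal (C * envNorm N) := by
  have h1 : eLpNorm f 2 (wMeasure b) ≤ eLpNorm (fun z => C * envelope N 0 z) 2 (wMeasure b) := by
    refine eLpNorm_mono_ae ?_
    filter_upwards [ae_wMeasure b] with z hz
    have hz0 : 0 < z := (Real.sqrt_nonneg b).trans_lt hz
    rw [Real.norm_eq_abs, Real.norm_of_nonneg (by unfold envelope; positivity)]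
    simpa [envelope] using hf z hz
  refine h1.trans ((eLpNorm_mono_measure _ (wMeasure_le_zero b)).trans ?_)
  have h2 : eLpNorm (fun z => C * envelope N 0 z) 2 (wMeasure 0) =
      ENNReal.ofReal C * eLpNorm (envelope N 0) 2 (wMeasure 0) := by
    have := eLpNorm_const_smul C (envelope N 0) 2 (wMeasure 0)
    rw [Real.enorm_of_nonneg hC] at this
    exact this
  rw [h2, envNorm, ENNReal.ofReal_mul hC, ENNReal.ofReal_toReal (memLp_envelope N 0).2.ne]

theorem memLp_of_bound {b C t : ℝ} {N : ℕ} {f : ℝ → ℝ} (hm : AEStronglyMeasurable f (wMeasure b))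
    (hf : ∀ z, √b < z → |f z| ≤ C * envelope N t z) : MemLp f 2 (wMeasure b) := by
  refine (((memLp_envelope N t).mono_measure (wMeasure_le_zero b)).const_mul C).mono' hm ?_
  filter_upwards [ae_wMeasure b] with z hz using hf z hz

theorem Polynomial.exists_abs_eval_le (p : Polynomial ℝ) :
    ∃ C : ℝ, 0 ≤ C ∧ ∃ N : ℕ, ∀ z, 0 ≤ z → |p.eval z| ≤ C * (1 + z) ^ N := by
  induction p using Polynomial.induction_on' with
  | add p q hp hq =>
    obtain ⟨C, hC, N, H⟩ := hp
    obtain ⟨C', hC', N', H'⟩ := hq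
    refine ⟨C + C', by positivity, N + N', fun z hz => ?_⟩
    rw [Polynomial.eval_add]
    refine (abs_add_le _ _).trans ?_
    have h1 : (1 + z) ^ N ≤ (1 + z) ^ (N + N') := pow_le_pow_right₀ (by linarith) (by omega)
    have h2 : (1 + z) ^ N' ≤ (1 + z) ^ (N + N') := pow_le_pow_right₀ (by linarith) (by omega)
    nlinarith [mul_le_mul_of_nonneg_left h1 hC, mul_le_mul_of_nonneg_left h2 hC', H z hz, H' z hz]
  | monomial n a =>
    refine ⟨|a|, abs_nonneg a, n, fun z hz => ?_⟩
    rw [Polynomial.eval_monomial, abs_mul, abs_pow, abs_of_nonneg hz]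
    gcongr
    linarith

theorem memLp_of_pow_bound {b C : ℝ} {N : ℕ} {f : ℝ → ℝ} (hC : 0 ≤ C)
    (hm : AEStronglyMeasurable f (wMeasure b))
    (hf : ∀ z, √b < z → |f z| ≤ C * (1 + z) ^ N) : MemLp f 2 (wMeasure b) := by
  refine memLp_of_bound (C := C) (t := 0) (N := N + 1) hm fun z hz => (hf z hz).trans ?_
  have hz0 : 0 < z := (Real.sqrt_nonneg b).trans_lt hz
  rw [envelope, zero_mul, Real.exp_zero, mul_one]
  gcongr
  rw [le_div_iff₀ hz0, pow_succ]
  gcongr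
  linarith

theorem memLp_polynomial (b : ℝ) (p : Polynomial ℝ) : MemLp (fun z => p.eval z) 2 (wMeasure b) := by
  obtain ⟨C, hC, N, H⟩ := p.exists_abs_eval_le
  exact memLp_of_pow_bound hC p.continuous.aestronglyMeasurable
    fun z hz => H z ((Real.sqrt_nonneg b).trans hz.le)

theorem isFiniteMeasure_wMeasure (b : ℝ) : IsFiniteMeasure (wMeasure b) := by
  have h := memLp_polynomial b 1
  simp only [Polynomial.eval_one] at h
  have := (memLp_const_iff (by norm_num) (by norm_num)).1 h
  simp only [one_ne_zero, false_or] at this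
  exact ⟨this⟩

/-! ### Hermite polynomials -/

open Polynomial in
/-- The Hermite polynomials over `ℝ`. -/
noncomputable def hermR (n : ℕ) : ℝ[X] := (hermite n).map (Int.castRingHom ℝ)

open Polynomial in
theorem eval_hermR (n : ℕ) (z : ℝ) : (hermR n).eval z = aeval z (hermite n) := by
  rw [hermR, aeval_def, eval₂_eq_eval_map]
  rfl

open Polynomial in
theorem hermR_succ (n : ℕ) : hermR (n + 1) = X * hermR n - derivative (hermR n) := by
  simp [hermR, hermite_succ]

open Polynomial in
theorem hermR_zero : hermR 0 = 1 := by simp [hermR]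

open Polynomial in
theorem derivative_hermR_succ (n : ℕ) :
    derivative (hermR (n + 1)) = C ((n : ℝ) + 1) * hermR n := by
  induction n with
  | zero => simp [hermR_succ, hermR_zero]
  | succ n ih =>
    rw [hermR_succ (n + 1), ih]
    have h2 := hermR_succ n
    simp only [derivative_sub, derivative_mul, derivative_X, derivative_C, ih]
    have h3 : derivative (hermR n) = X * hermR n - hermR (n + 1) := by rw [h2]; ring
    rw [h3]
    simp only [Nat.cast_add, Nat.cast_one, C_add, C_1]
    ring

open Polynomial in
theorem X_mul_hermR_succ (n : ℕ) :
    X * hermR (n + 1) = hermR (n + 2) + C ((n : ℝ) + 1) * hermR n := by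
  rw [hermR_succ (n + 1), derivative_hermR_succ]
  ring

theorem hermR_eval_zero_of_odd (n : ℕ) (hn : Odd n) : (hermR n).eval 0 = 0 := by
  rw [eval_hermR, ← Polynomial.coeff_zero_eq_aeval_zero',
    Polynomial.coeff_hermite_of_odd_add (by simpa using hn), map_zero]

theorem integrable_polynomial_mul_exp (p : Polynomial ℝ) :
    Integrable (fun z : ℝ => p.eval z * Real.exp (-z ^ 2 / 2)) := by
  induction p using Polynomial.induction_on' with
  | add p q hp hq =>
    simp only [Polynomial.eval_add, add_mul]
    exact hp.add hq
  | monomial n a =>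
    have := integrable_rpow_mul_exp_neg_mul_sq (b := 1 / 2) (by norm_num) (s := n)
      (by have : (0 : ℝ) ≤ n := n.cast_nonneg
          linarith)
    refine (this.const_mul a).congr (Eventually.of_forall fun z => ?_)
    simp only [Real.rpow_natCast, Polynomial.eval_monomial]
    rw [show -(1 / 2) * z ^ 2 = -z ^ 2 / 2 by ring]
    ring

open Polynomial in
theorem integral_derivative_mul_exp (p : ℝ[X]) :
    ∫ z in Ioi (0 : ℝ), (derivative p - X * p).eval z * Real.exp (-z ^ 2 / 2) = -p.eval 0 := by
  have hd : ∀ z ∈ Ici (0 : ℝ), HasDerivAt (fun z => p.eval z * Real.exp (-z ^ 2 / 2))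
      ((derivative p - X * p).eval z * Real.exp (-z ^ 2 / 2)) z := by
    intro z _
    have h2 := ((hasDerivAt_pow 2 z).neg.div_const 2).exp
    refine ((p.hasDerivAt z).mul h2).congr_deriv ?_
    simp
    ring
  have i1 := (integrable_polynomial_mul_exp p).integrableOn (s := Ioi 0)
  have i2 := (integrable_polynomial_mul_exp (derivative p - X * p)).integrableOn (s := Ioi 0)
  have hlim := tendsto_zero_of_hasDerivAt_of_integrableOn_Ioi
    (fun t ht => hd t (le_of_lt (show 0 < t from ht))) i2 i1
  rw [integral_Ioi_of_hasDerivAt_of_tendsto' hd i2 hlim]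
  simp

/-- The inner products of the Hermite polynomials on the half line. -/
noncomputable def hermInner (m n : ℕ) : ℝ :=
  ∫ z in Ioi (0 : ℝ), (hermR m * hermR n).eval z * Real.exp (-z ^ 2 / 2)

theorem hermInner_comm (m n : ℕ) : hermInner m n = hermInner n m := by
  rw [hermInner, hermInner, mul_comm]

open Polynomial in
-- Integration by parts using He_{n+1} = z He_n - He_n'. On the half line the boundary term at 0
-- survives.
theorem hermInner_succ (m n : ℕ) : hermInner (m + 1) (n + 1) =
    (hermR (m + 1)).eval 0 * (hermR n).eval 0 + (m + 1) * hermInner m n := by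
  have key := integral_derivative_mul_exp (hermR (m + 1) * hermR n)
  have h : derivative (hermR (m + 1) * hermR n) - X * (hermR (m + 1) * hermR n) =
      C ((m : ℝ) + 1) * (hermR m * hermR n) - hermR (m + 1) * hermR (n + 1) := by
    rw [derivative_mul, derivative_hermR_succ, hermR_succ n]
    ring
  rw [h] at key
  simp only [eval_sub, sub_mul, eval_C_mul, mul_assoc] at key
  rw [integral_sub, integral_const_mul] at key
  · rw [hermInner, hermInner]
    rw [eval_mul] at key
    linarith
  · exact ((integrable_polynomial_mul_exp (hermR m * hermR n)).const_mul _).integrableOn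
  · exact (integrable_polynomial_mul_exp (hermR (m + 1) * hermR (n + 1))).integrableOn

open Polynomial in
theorem hermInner_zero_succ (n : ℕ) : hermInner 0 (n + 1) = (hermR n).eval 0 := by
  have key := integral_derivative_mul_exp (hermR n)
  have h : derivative (hermR n) - X * hermR n = -(hermR 0 * hermR (n + 1)) := by
    rw [hermR_succ n, hermR_zero]
    ring
  rw [h] at key
  simp only [eval_neg, neg_mul, integral_neg] at key
  rw [hermInner]
  linarith

/-- When the degrees have equal parity, one factor in each boundary term has odd degree and vanishes
at 0, so the full-line orthogonality relations persist with half the norm. -/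
theorem hermInner_of_even_add (m n : ℕ) (h : Even (m + n)) :
    hermInner m n = if m = n then m.factorial * (√(Real.pi * 2) / 2) else 0 := by
  induction m generalizing n with
  | zero =>
    rcases n with _ | n
    · rw [if_pos rfl, hermInner, hermR_zero]
      have := integral_gaussian_Ioi (1 / 2)
      rw [show Real.pi / (1 / 2) = Real.pi * 2 by ring] at this
      simp only [mul_one, Polynomial.eval_one, one_mul, Nat.factorial_zero, Nat.cast_one]
      rw [← this]
      congr 1
      funext z
      ring_nf
    · rw [hermInner_zero_succ, if_neg (by omega)]
      exact hermR_eval_zero_of_odd n (by grind)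
  | succ m ih =>
    rcases n with _ | n
    · rw [hermInner_comm, hermInner_zero_succ, if_neg (by omega)]
      exact hermR_eval_zero_of_odd m (by grind)
    · rw [hermInner_succ, ih n (by grind)]
      have h0 : (hermR (m + 1)).eval 0 * (hermR n).eval 0 = 0 := by
        rcases Nat.even_or_odd n with hn | hn
        · rw [hermR_eval_zero_of_odd (m + 1) (by grind), zero_mul]
        · rw [hermR_eval_zero_of_odd n hn, mul_zero]
      rw [h0, zero_add]
      by_cases hmn : m = n
      · rw [if_pos hmn, if_pos (by omega), Nat.factorial_succ]
        push_cast
        ring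
      · rw [if_neg hmn, if_neg (by omega), mul_zero]

/-! ### The Laguerre modes in terms of Hermite polynomials -/

/-- This compares, up to sign, the coefficient of degree i in L_k^{1/2}(x/2), where k = i + d, with
that of z^(2i+1) in He_{2k+1}. The induction on d uses only the functional equation of Γ and
factorials. -/
theorem laguerre_coeff_eq (i d : ℕ) :
    Real.Gamma (1 / 2 + (i + d : ℕ) + 1) / (i.factorial * d.factorial *
      Real.Gamma (1 / 2 + i + 1)) / 2 ^ i =
    (Nat.doubleFactorial (2 * d - 1) : ℝ) * ((2 * d + (2 * i + 1)).choose (2 * i + 1) : ℝ) /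
      (2 ^ (i + d) * (i + d).factorial) := by
  have hG : Real.Gamma (1 / 2 + i + 1) ≠ 0 := (Real.Gamma_pos_of_pos (by positivity)).ne'
  induction d with
  | zero =>
    simp
    field_simp
  | succ d ih =>
    have hch : ((2 * (d + 1) + (2 * i + 1)).choose (2 * i + 1) : ℝ) =
        ((2 * d + (2 * i + 1)).choose (2 * i + 1) : ℝ) *
          ((2 * d + 2 * i + 3) * (2 * d + 2 * i + 2) / ((2 * d + 2) * (2 * d + 1))) := by
      rw [Nat.choose_symm_add.symm, Nat.choose_symm_add.symm, Nat.cast_add_choose,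
        Nat.cast_add_choose,
        show 2 * (d + 1) + (2 * i + 1) = 2 * d + (2 * i + 1) + 1 + 1 by ring,
        show 2 * (d + 1) = 2 * d + 1 + 1 by ring]
      simp only [Nat.factorial_succ]
      have h1 : ((2 * d).factorial : ℝ) ≠ 0 := by positivity
      have h2 : ((2 * i).factorial : ℝ) ≠ 0 := by positivity
      push_cast
      field_simp
      ring
    have hdf : (Nat.doubleFactorial (2 * (d + 1) - 1) : ℝ) =
        (2 * d + 1) * (Nat.doubleFactorial (2 * d - 1) : ℝ) := by
      -- For d = 0 the truncated subtraction gives 0‼ = 1, the value wanted for (-1)‼.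
      rcases d with _ | d
      · simp
      · rw [show 2 * (d + 1 + 1) - 1 = 2 * (d + 1) - 1 + 2 by omega, Nat.doubleFactorial_add_two]
        push_cast [show 2 * (d + 1) - 1 + 2 = 2 * d + 3 by omega]
        ring
    have hL : Real.Gamma (1 / 2 + (i + (d + 1) : ℕ) + 1) / (i.factorial * (d + 1).factorial *
      Real.Gamma (1 / 2 + i + 1)) / 2 ^ i = Real.Gamma (1 / 2 + (i + d : ℕ) + 1) /
        (i.factorial * d.factorial * Real.Gamma (1 / 2 + i + 1)) / 2 ^ i *
        ((i + d + 3 / 2) / (d + 1)) := by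
      rw [← add_assoc, Gamma_half_succ, Nat.factorial_succ]
      push_cast
      have h3 : (d : ℝ) + 1 ≠ 0 := by positivity
      field_simp
    rw [hL, ih, hch, hdf, show i + (d + 1) = i + d + 1 by ring, Nat.factorial_succ]
    push_cast
    have h4 : (i : ℝ) + d + 1 ≠ 0 := by positivity
    field_simp
    ring

/-- The factor which turns the Hermite polynomial `hermR (2 k + 1)` into `z P_k(z)`. -/
noncomputable def modeCoef (k : ℕ) : ℝ := (-1) ^ k / (2 ^ k * k.factorial * coefA k)

theorem Finset.sum_range_two_mul {f : ℕ → ℝ} (n : ℕ) :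
    ∑ m ∈ Finset.range (2 * n), f m = ∑ i ∈ Finset.range n, (f (2 * i) + f (2 * i + 1)) := by
  induction n with
  | zero => simp
  | succ n ih =>
    rw [show 2 * (n + 1) = 2 * n + 1 + 1 by ring, Finset.sum_range_succ, Finset.sum_range_succ,
      Finset.sum_range_succ, ih]
    ring

theorem eval_hermR_odd (k : ℕ) (z : ℝ) : (hermR (2 * k + 1)).eval z =
    ∑ i ∈ Finset.range (k + 1), (-1) ^ (k - i) * (Nat.doubleFactorial (2 * (k - i) - 1) : ℝ) *
      ((2 * k + 1).choose (2 * i + 1) : ℝ) * z ^ (2 * i + 1) := by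
  have hdeg : (hermR (2 * k + 1)).natDegree < 2 * (k + 1) := by
    refine lt_of_le_of_lt (Polynomial.natDegree_map_le) ?_
    rw [Polynomial.natDegree_hermite]
    omega
  rw [Polynomial.eval_eq_sum_range' hdeg, Finset.sum_range_two_mul]
  refine Finset.sum_congr rfl fun i hi => ?_
  have hi : i ≤ k := Nat.lt_succ_iff.1 (Finset.mem_range.1 hi)
  have h1 : (hermR (2 * k + 1)).coeff (2 * i) = 0 := by
    rw [hermR, Polynomial.coeff_map, Polynomial.coeff_hermite_of_odd_add (by grind), map_zero]
  have h2 : (hermR (2 * k + 1)).coeff (2 * i + 1) =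
      (-1) ^ (k - i) * (Nat.doubleFactorial (2 * (k - i) - 1) : ℝ) *
      ((2 * k + 1).choose (2 * i + 1) : ℝ) := by
    have h3 : 2 * k + 1 = 2 * (k - i) + (2 * i + 1) := by omega
    rw [hermR, Polynomial.coeff_map]
    conv_lhs => rw [h3]
    rw [Polynomial.coeff_hermite_explicit, ← h3]
    simp
  rw [h1, h2]
  ring

/-- The link between the two families: z L_k^{1/2}(z²/2) is proportional to He_{2k+1}(z),
coefficient by coefficient. Through it the radial modes become the profiles at e = 0. -/
theorem mul_P_eq (k : ℕ) (z : ℝ) : z * P k z = modeCoef k * (hermR (2 * k + 1)).eval z := by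
  have hA := (coefA_pos k).ne'
  rw [eval_hermR_odd, P, laguerreHalf, modeCoef, mul_div_assoc', div_eq_iff hA, Finset.mul_sum,
    Finset.mul_sum, Finset.sum_mul]
  refine Finset.sum_congr rfl fun i hi => ?_
  have hi : i ≤ k := Nat.lt_succ_iff.1 (Finset.mem_range.1 hi)
  obtain ⟨d, rfl⟩ := Nat.exists_eq_add_of_le hi
  rw [Nat.add_sub_cancel_left]
  have key := laguerre_coeff_eq i d
  rw [show 2 * (i + d) + 1 = 2 * d + (2 * i + 1) by ring]
  have hsign : (-1 : ℝ) ^ (i + d) * (-1) ^ d = (-1) ^ i := by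
    rw [pow_add, mul_assoc, ← pow_add, ← two_mul, pow_mul]
    simp
  calc _ = (-1) ^ i * (Real.Gamma (1 / 2 + (i + d : ℕ) + 1) / (i.factorial * d.factorial *
      Real.Gamma (1 / 2 + i + 1)) / 2 ^ i) * z ^ (2 * i + 1) := by
        rw [div_pow, ← pow_mul]
        ring
    _ = _ := by
        rw [key, ← hsign]
        field_simp

/-- `P_k` as a polynomial in `z`. -/
noncomputable def polyP (k : ℕ) : Polynomial ℝ :=
  Polynomial.C (modeCoef k) * (hermR (2 * k + 1)).divX

theorem X_mul_polyP (k : ℕ) :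
    Polynomial.X * polyP k = Polynomial.C (modeCoef k) * hermR (2 * k + 1) := by
  have h0 := hermR_eval_zero_of_odd (2 * k + 1) (by simp)
  rw [← Polynomial.coeff_zero_eq_eval_zero] at h0
  conv_rhs => rw [← Polynomial.divX_mul_X_add (hermR (2 * k + 1)), h0]
  rw [polyP, map_zero]
  ring

theorem mul_eval_polyP (k : ℕ) (z : ℝ) :
    z * (polyP k).eval z = modeCoef k * (hermR (2 * k + 1)).eval z := by
  simpa using congrArg (Polynomial.eval z) (X_mul_polyP k)

theorem P_eq_eval (k : ℕ) : P k = fun z => (polyP k).eval z := by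
  have h : ∀ z, z ≠ 0 → P k z = (polyP k).eval z := fun z hz => by
    apply mul_left_cancel₀ hz
    rw [mul_P_eq, mul_eval_polyP]
  have hc : Continuous (P k) := by
    unfold P laguerreHalf
    fun_prop
  exact hc.ext_on (s := {0}ᶜ) (dense_compl_singleton 0) (polyP k).continuous h

/-- The squared norm of He_{2k+1} on the half line is (2k+1)! √(2π)/2. The duplication formula for Γ
at half-integers, proved in `hf` by induction, shows that A_k normalises it. -/
theorem modeCoef_sq (k : ℕ) :
    modeCoef k ^ 2 * ((2 * k + 1).factorial * (√(Real.pi * 2) / 2)) = 1 := by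
  rw [modeCoef, div_pow, mul_pow, coefA_sq, ← pow_mul, mul_comm k 2, pow_mul]
  have hf : ∀ k : ℕ, ((2 * k + 1).factorial : ℝ) * (√Real.pi / 2) =
      4 ^ k * k.factorial * Real.Gamma (1 / 2 + k + 1) := by
    intro k
    induction k with
    | zero =>
      rw [Nat.cast_zero, add_zero, Gamma_three_half]
      simp
    | succ k ih =>
      rw [Gamma_half_succ, show 2 * (k + 1) + 1 = 2 * k + 1 + 1 + 1 by ring, Nat.factorial_succ,
        Nat.factorial_succ, Nat.factorial_succ k]
      push_cast
      calc _ = (2 * (k : ℝ) + 1 + 1 + 1) * (2 * k + 1 + 1) *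
          (((2 * k + 1).factorial : ℝ) * (√Real.pi / 2)) := by ring
        _ = _ := by
          rw [ih]
          ring
  have hG : 0 < Real.Gamma (1 / 2 + k + 1) := Real.Gamma_pos_of_pos (by positivity)
  have h1 : ((2 * k + 1).factorial : ℝ) * (√(Real.pi * 2) / 2) =
      √2 * (4 ^ k * k.factorial * Real.Gamma (1 / 2 + k + 1)) := by
    rw [← hf k, Real.sqrt_mul Real.pi_pos.le]
    ring
  rw [h1]
  have h2 : (k.factorial : ℝ) ≠ 0 := by positivity
  have h4 : ((2 : ℝ) ^ k) ^ 2 = 4 ^ k := by rw [← pow_mul, mul_comm, pow_mul]; norm_num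
  rw [mul_pow, h4]
  norm_num
  field_simp

theorem integral_polyP_mul (i j : ℕ) :
    ∫ z in Ioi (0 : ℝ), (polyP i).eval z * (polyP j).eval z * (Real.exp (-z ^ 2 / 2) * z ^ 2) =
      if i = j then 1 else 0 := by
  have h : (fun z : ℝ => (polyP i).eval z * (polyP j).eval z * (Real.exp (-z ^ 2 / 2) * z ^ 2)) =
      fun z => modeCoef i * modeCoef j *
        ((hermR (2 * i + 1) * hermR (2 * j + 1)).eval z * Real.exp (-z ^ 2 / 2)) := by
    funext z
    calc _ = (z * (polyP i).eval z) * (z * (polyP j).eval z) * Real.exp (-z ^ 2 / 2) := by ring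
      _ = _ := by
        rw [mul_eval_polyP, mul_eval_polyP, Polynomial.eval_mul]
        ring
  have h2 := hermInner_of_even_add (2 * i + 1) (2 * j + 1) (by grind)
  rw [hermInner] at h2
  rw [h, integral_const_mul, h2]
  by_cases hij : i = j
  · subst hij
    rw [if_pos rfl, if_pos rfl, ← modeCoef_sq i]
    ring
  · rw [if_neg hij, if_neg (by omega), mul_zero]

/-- Hermite's equation in the divergence form of the radial problem:
`-(z² ρ P_k')' = 2 k z² ρ P_k`. -/
theorem hasDerivAt_polyP_flux (k : ℕ) (z : ℝ) :
    HasDerivAt (fun z => (Polynomial.derivative (polyP k)).eval z * (Real.exp (-z ^ 2 / 2) * z ^ 2))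
      (-(2 * k * (polyP k).eval z * (Real.exp (-z ^ 2 / 2) * z ^ 2))) z := by
  have hX := X_mul_polyP k
  have hd : Polynomial.X * Polynomial.derivative (polyP k) = Polynomial.C (modeCoef k) *
      (Polynomial.C (2 * (k : ℝ) + 1) * hermR (2 * k)) - polyP k := by
    have := congrArg Polynomial.derivative hX
    simp only [Polynomial.derivative_mul, Polynomial.derivative_X, Polynomial.derivative_C,
      derivative_hermR_succ] at this
    push_cast at this
    linear_combination this
  have hdd : Polynomial.X * Polynomial.derivative (Polynomial.derivative (polyP k)) =
      Polynomial.C (modeCoef k) * (Polynomial.C (2 * (k : ℝ) + 1) *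
        (Polynomial.X * hermR (2 * k) - hermR (2 * k + 1))) -
        2 * Polynomial.derivative (polyP k) := by
    have := congrArg Polynomial.derivative hd
    simp only [Polynomial.derivative_mul, Polynomial.derivative_X, Polynomial.derivative_C,
      Polynomial.derivative_sub] at this
    have h2 : Polynomial.derivative (hermR (2 * k)) =
      Polynomial.X * hermR (2 * k) - hermR (2 * k + 1) := by
      rw [hermR_succ]
      ring
    rw [h2] at this
    linear_combination this
  have h1 := ((hasDerivAt_pow 2 z).neg.div_const 2).exp.mul (hasDerivAt_pow 2 z)
  refine (((Polynomial.derivative (polyP k)).hasDerivAt z).mul h1).congr_deriv ?_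
  have e1 := congrArg (Polynomial.eval z) hX
  have e2 := congrArg (Polynomial.eval z) hd
  have e3 := congrArg (Polynomial.eval z) hdd
  simp only [Polynomial.eval_mul, Polynomial.eval_X, Polynomial.eval_C, Polynomial.eval_sub,
    Polynomial.eval_ofNat] at e1 e2 e3
  simp
  linear_combination Real.exp (-z ^ 2 / 2) * (z * e3 - z ^ 2 * e2 + (2 * k + 1) * z * e1)

/-! ### Completeness of the even polynomials -/

theorem integrable_mul_of_memLp {μ : Measure ℝ} {f g : ℝ → ℝ} (hf : MemLp f 2 μ)
    (hg : MemLp g 2 μ) : Integrable (fun z => f z * g z) μ :=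
  hf.integrable_mul hg

/-- Expand the cosine in its power series. The series of absolute values sums to |x| cosh(tz),
integrable because cosh is square integrable against the Gaussian weight, so the vanishing even
moments can be summed. -/
theorem integral_mul_cos_eq_zero {x : ℝ → ℝ} (hx : MemLp x 2 (wMeasure 0))
    (h : ∀ n : ℕ, ∫ z, x z * z ^ (2 * n) ∂(wMeasure 0) = 0) (t : ℝ) :
    ∫ z, x z * Real.cos (t * z) ∂(wMeasure 0) = 0 := by
  have hcosh : MemLp (fun z => Real.cosh (t * z)) 2 (wMeasure 0) := by
    refine memLp_of_bound (C := 1) (N := 1) (t := |t|)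
      (by fun_prop : Continuous fun z => Real.cosh (t * z)).aestronglyMeasurable fun z hz => ?_
    rw [Real.sqrt_zero] at hz
    have h1 : Real.cosh (t * z) ≤ Real.exp (|t| * z) := by
      rw [← Real.cosh_abs, abs_mul, abs_of_pos hz]
      rw [Real.cosh_eq]
      have : Real.exp (-(|t| * z)) ≤ Real.exp (|t| * z) := Real.exp_le_exp.2 (by
        have : 0 ≤ |t| * z := by positivity
        linarith)
      linarith
    rw [abs_of_pos (Real.cosh_pos _), envelope, pow_one, one_mul, le_div_iff₀ hz]
    have h2 := Real.exp_pos (|t| * z)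
    nlinarith [Real.cosh_pos (t * z)]
  have key := hasSum_integral_of_dominated_convergence (μ := wMeasure 0)
    (F := fun (n : ℕ) z => x z * ((-1) ^ n * (t * z) ^ (2 * n) / (2 * n).factorial))
    (f := fun z => x z * Real.cos (t * z))
    (fun n z => |x z| * ((t * z) ^ (2 * n) / (2 * n).factorial)) ?_ ?_ ?_ ?_ ?_
  · have hz : ∀ n : ℕ, ∫ z, x z * ((-1) ^ n * (t * z) ^ (2 * n) / (2 * n).factorial)
        ∂(wMeasure 0) = 0 := by
      intro n
      have : (fun z => x z * ((-1) ^ n * (t * z) ^ (2 * n) / (2 * n).factorial)) =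
          fun z => ((-1) ^ n * t ^ (2 * n) / (2 * n).factorial) * (x z * z ^ (2 * n)) := by
        funext z
        rw [mul_pow]
        ring
      rw [this, integral_const_mul, h n, mul_zero]
    simp only [hz] at key
    exact key.unique hasSum_zero
  · intro n
    exact hx.1.mul (by fun_prop : Continuous fun z : ℝ =>
      (-1) ^ n * (t * z) ^ (2 * n) / (2 * n).factorial).aestronglyMeasurable
  · intro n
    refine Eventually.of_forall fun z => ?_
    rw [norm_mul, Real.norm_eq_abs, Real.norm_eq_abs, abs_div, abs_mul, abs_pow, abs_neg, abs_one,
      one_pow, one_mul, Nat.abs_cast, abs_of_nonneg (by rw [pow_mul]; positivity : 0 ≤ (t * z) ^ (2 * n))]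
  · exact Eventually.of_forall fun z => (Real.hasSum_cosh _).summable.mul_left _
  · have : (fun z => ∑' n : ℕ, |x z| * ((t * z) ^ (2 * n) / (2 * n).factorial)) =
        fun z => |x z| * Real.cosh (t * z) := by
      funext z
      rw [tsum_mul_left, ← Real.cosh_eq_tsum]
    rw [this]
    exact integrable_mul_of_memLp hx.abs hcosh
  · exact Eventually.of_forall fun z => (Real.hasSum_cos _).mul_left _

/-- Symmetrising a measure leaves only the cosine part of its characteristic function, so uniqueness
for characteristic functions becomes uniqueness for cosine transforms. -/
theorem charFun_add_map_neg (ν : Measure ℝ) [IsFiniteMeasure ν] (t : ℝ) :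
    charFun (ν + ν.map (fun z => -z)) t = ((2 * ∫ z, Real.cos (t * z) ∂ν : ℝ) : ℂ) := by
  have hb : ∀ s : ℝ, Integrable (fun z : ℝ => Complex.exp (s * z * Complex.I)) ν := fun s => by
    refine Integrable.of_bound (C := 1)
      (by fun_prop : Continuous fun z : ℝ => Complex.exp (s * z * Complex.I)).aestronglyMeasurable
      (Eventually.of_forall fun z => ?_)
    rw [← Complex.ofReal_mul, Complex.norm_exp_ofReal_mul_I]
  have hneg : ∫ z, Complex.exp (t * z * Complex.I) ∂(ν.map (fun z => -z)) =
      ∫ z : ℝ, Complex.exp ((-t : ℝ) * z * Complex.I) ∂ν := by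
    rw [integral_map (by fun_prop) (by fun_prop)]
    congr 1
    funext z
    push_cast
    ring_nf
  rw [charFun_apply_real, integral_add_measure (hb t), hneg, ← integral_add (hb t) (hb (-t)),
    ← integral_const_mul, ← integral_complex_ofReal]
  · congr 1
    funext z
    push_cast
    rw [Complex.two_cos]
    ring_nf
  · rw [integrable_map_measure (by fun_prop) (by fun_prop)]
    refine (hb (-t)).congr (Eventually.of_forall fun z => ?_)
    simp

/-- A finite measure on `(0, ∞)` is determined by its cosine transform. -/
theorem Measure.ext_of_integral_cos {ν ν' : Measure ℝ} [IsFiniteMeasure ν] [IsFiniteMeasure ν']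
    (h0 : ν (Iic 0) = 0) (h0' : ν' (Iic 0) = 0)
    (h : ∀ t, ∫ z, Real.cos (t * z) ∂ν = ∫ z, Real.cos (t * z) ∂ν') : ν = ν' := by
  have hm : ∀ σ : Measure ℝ, IsFiniteMeasure σ → IsFiniteMeasure (σ.map (fun z => -z)) :=
    fun σ _ => inferInstance
  have hext : ν + ν.map (fun z => -z) = ν' + ν'.map (fun z => -z) := by
    refine Measure.ext_of_charFun (funext fun t => ?_)
    rw [charFun_add_map_neg, charFun_add_map_neg, h]
  -- A measure carried by (0, ∞) is recovered from its symmetrisation by intersecting with (0, ∞).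
  have hS : ∀ (σ : Measure ℝ), σ (Iic 0) = 0 → ∀ S, MeasurableSet S →
      (σ + σ.map (fun z => -z)) (S ∩ Ioi 0) = σ S := by
    intro σ hσ S hS
    have hSm : MeasurableSet (S ∩ Ioi 0) := hS.inter measurableSet_Ioi
    rw [Measure.add_apply, Measure.map_apply (by fun_prop) hSm]
    have e1 : σ ((fun z : ℝ => -z) ⁻¹' (S ∩ Ioi 0)) = 0 := by
      refine measure_mono_null ?_ hσ
      rintro z ⟨-, hz⟩
      simp only [mem_Ioi] at hz
      simp only [mem_Iic]
      linarith
    have e2 : σ (S \ Ioi 0) = 0 := by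
      refine measure_mono_null ?_ hσ
      rintro z ⟨-, hz⟩
      simpa using hz
    rw [e1, add_zero, ← measure_inter_add_sdiff S measurableSet_Ioi, e2, add_zero]
  ext S hSm
  rw [← hS ν h0 S hSm, ← hS ν' h0' S hSm, hext]

theorem wMeasure_zero_Iic : wMeasure 0 (Iic 0) = 0 := by
  have := ae_wMeasure 0
  rw [ae_iff] at this
  simpa [Iic, not_lt] using this

/-- The positive and negative parts of x are densities of two finite measures with the same cosine
transform. The measures agree, so x⁺ = x⁻ almost everywhere, and both vanish. -/
theorem ae_eq_zero_of_moments {x : ℝ → ℝ} (hx : MemLp x 2 (wMeasure 0))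
    (h : ∀ n : ℕ, ∫ z, x z * z ^ (2 * n) ∂(wMeasure 0) = 0) : x =ᵐ[wMeasure 0] 0 := by
  have := isFiniteMeasure_wMeasure 0
  have hxi : Integrable x (wMeasure 0) := hx.integrable (by norm_num)
  have hm : ∀ y : ℝ → ℝ, Integrable y (wMeasure 0) →
      AEMeasurable (fun z => ENNReal.ofReal (y z)) (wMeasure 0) :=
    fun y hy => hy.1.aemeasurable.ennreal_ofReal
  have hfin : ∀ y : ℝ → ℝ, Integrable y (wMeasure 0) →
      IsFiniteMeasure ((wMeasure 0).withDensity fun z => ENNReal.ofReal (y z)) :=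
    fun y hy => isFiniteMeasure_withDensity_ofReal hy.2
  have hint : ∀ y : ℝ → ℝ, Integrable y (wMeasure 0) → ∀ t,
      ∫ z, Real.cos (t * z) ∂((wMeasure 0).withDensity fun z => ENNReal.ofReal (y z)) =
      ∫ z, max (y z) 0 * Real.cos (t * z) ∂(wMeasure 0) := by
    intro y hy t
    rw [integral_withDensity_eq_integral_toReal_smul₀ (hm y hy) (by simp)]
    rfl
  have i1 := hfin x hxi
  have i2 := hfin _ hxi.neg
  have key : ((wMeasure 0).withDensity fun z => ENNReal.ofReal (x z)) =
      ((wMeasure 0).withDensity fun z => ENNReal.ofReal ((-x) z)) := by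
    refine Measure.ext_of_integral_cos
      ((withDensity_absolutelyContinuous _ _) wMeasure_zero_Iic)
      ((withDensity_absolutelyContinuous _ _) wMeasure_zero_Iic) fun t => ?_
    have hc : ∀ y : ℝ → ℝ, Integrable y (wMeasure 0) →
        Integrable (fun z => max (y z) 0 * Real.cos (t * z)) (wMeasure 0) := fun y hy => by
      refine hy.pos_part.mul_bdd (c := 1)
        (by fun_prop : Continuous fun z => Real.cos (t * z)).aestronglyMeasurable ?_
      exact Eventually.of_forall fun z => Real.abs_cos_le_one _
    rw [hint x hxi, hint _ hxi.neg, ← sub_eq_zero, ← integral_sub (hc x hxi) (hc _ hxi.neg)]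
    refine Eq.trans ?_ (integral_mul_cos_eq_zero hx h t)
    congr 1
    funext z
    rw [← sub_mul]
    congr 1
    simp only [Pi.neg_apply]
    rcases le_total 0 (x z) with h | h
    · rw [max_eq_left h, max_eq_right (by linarith), sub_zero]
    · rw [max_eq_right h, max_eq_left (by linarith)]
      ring
  rw [withDensity_eq_iff_of_sigmaFinite (hm x hxi) (hm _ hxi.neg)] at key
  filter_upwards [key] with z hz
  simp only [Pi.neg_apply] at hz
  rcases lt_trichotomy (x z) 0 with h | h | h
  · rw [ENNReal.ofReal_of_nonpos h.le, eq_comm, ENNReal.ofReal_eq_zero] at hz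
    simp only [Pi.zero_apply]
    linarith
  · exact h
  · rw [ENNReal.ofReal_of_nonpos (p := -x z) (by linarith), ENNReal.ofReal_eq_zero] at hz
    simp only [Pi.zero_apply]
    linarith

open Polynomial in
theorem polyP_eq_sum (k : ℕ) : polyP k =
    ∑ i ∈ Finset.range (k + 1), C ((polyP k).coeff (2 * i)) * X ^ (2 * i) := by
  have hodd : ∀ i, (polyP k).coeff (2 * i + 1) = 0 := fun i => by
    rw [polyP, coeff_C_mul, coeff_divX, hermR, coeff_map, coeff_hermite_of_odd_add (by grind),
      map_zero, mul_zero]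
  have hdeg : (polyP k).natDegree < 2 * (k + 1) := by
    refine lt_of_le_of_lt (natDegree_C_mul_le _ _) ?_
    rw [natDegree_divX_eq_natDegree_tsub_one]
    have : (hermR (2 * k + 1)).natDegree ≤ 2 * k + 1 :=
      natDegree_map_le.trans (by rw [natDegree_hermite])
    omega
  refine Polynomial.funext fun z => ?_
  rw [eval_eq_sum_range' hdeg, Finset.sum_range_two_mul, eval_finsetSum]
  refine Finset.sum_congr rfl fun i _ => ?_
  rw [hodd]
  simp

theorem polyP_coeff_ne_zero (k : ℕ) : (polyP k).coeff (2 * k) ≠ 0 := by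
  rw [polyP, Polynomial.coeff_C_mul, Polynomial.coeff_divX, hermR, Polynomial.coeff_map,
    Polynomial.coeff_hermite_self]
  have h1 := coefA_pos k
  have h2 : (-1 : ℝ) ^ k ≠ 0 := by simp
  simp only [modeCoef, map_one, mul_one]
  positivity

/-- The passage from even monomials to the P_n is triangular with nonzero diagonal, so orthogonality
to all P_n kills the even moments one after another. -/
theorem ae_eq_zero_of_integral_polyP {x : ℝ → ℝ} (hx : MemLp x 2 (wMeasure 0))
    (h : ∀ n : ℕ, ∫ z, x z * (polyP n).eval z ∂(wMeasure 0) = 0) : x =ᵐ[wMeasure 0] 0 := by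
  refine ae_eq_zero_of_moments hx fun n => ?_
  have hint : ∀ i : ℕ, Integrable (fun z => x z * z ^ (2 * i)) (wMeasure 0) := fun i => by
    have := integrable_mul_of_memLp hx (memLp_polynomial 0 (Polynomial.X ^ (2 * i)))
    simpa using this
  induction n using Nat.strong_induction_on with
  | _ n ih =>
    have h1 := h n
    have h2 : (fun z => x z * (polyP n).eval z) = fun z => ∑ i ∈ Finset.range (n + 1),
        (polyP n).coeff (2 * i) * (x z * z ^ (2 * i)) := by
      funext z
      conv_lhs => rw [polyP_eq_sum n]
      rw [Polynomial.eval_finsetSum, Finset.mul_sum]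
      refine Finset.sum_congr rfl fun i _ => ?_
      simp
      ring
    rw [h2, integral_finsetSum _ (fun i _ => (hint i).const_mul _), Finset.sum_range_succ,
      Finset.sum_eq_zero, zero_add, integral_const_mul] at h1
    · exact (mul_eq_zero.1 h1).resolve_left (polyP_coeff_ne_zero n)
    · intro i hi
      rw [integral_const_mul, ih i (Finset.mem_range.1 hi), mul_zero]

theorem integral_polyP_mul_wMeasure (i j : ℕ) :
    ∫ z, (polyP i).eval z * (polyP j).eval z ∂(wMeasure 0) = if i = j then 1 else 0 := by
  rw [integral_wMeasure, Real.sqrt_zero, integral_polyP_mul]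

/-- Parseval's identity for the modes `P_j`. -/
theorem hasSum_sq_integral_polyP {x : ℝ → ℝ} (hx : MemLp x 2 (wMeasure 0)) :
    HasSum (fun j : ℕ => (∫ z, x z * (polyP j).eval z ∂(wMeasure 0)) ^ 2)
      (∫ z, x z ^ 2 ∂(wMeasure 0)) := by
  set e : ℕ → Lp ℝ 2 (wMeasure 0) := fun j => (memLp_polynomial 0 (polyP j)).toLp _ with he
  have hinner : ∀ (f g : ℝ → ℝ) (hf : MemLp f 2 (wMeasure 0)) (hg : MemLp g 2 (wMeasure 0)),
      inner ℝ (hf.toLp f) (hg.toLp g) = ∫ z, g z * f z ∂(wMeasure 0) := by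
    intro f g hf hg
    rw [L2.inner_def]
    refine integral_congr_ae ?_
    filter_upwards [hf.coeFn_toLp, hg.coeFn_toLp] with z h1 h2
    rw [h1, h2]
    simp
  have horth : Orthonormal ℝ e := by
    rw [orthonormal_iff_ite]
    intro i j
    rw [he]
    simp only
    rw [hinner, integral_polyP_mul_wMeasure]
    simp only [eq_comm]
  have hbot : (Submodule.span ℝ (Set.range e))ᗮ = ⊥ := by
    rw [Submodule.eq_bot_iff]
    intro y hy
    rw [Submodule.mem_orthogonal] at hy
    have hy' : MemLp y 2 (wMeasure 0) := Lp.memLp y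
    have h0 : ∀ n : ℕ, ∫ z, y z * (polyP n).eval z ∂(wMeasure 0) = 0 := fun n => by
      have h1 := hy (e n) (Submodule.subset_span ⟨n, rfl⟩)
      rw [← Lp.toLp_coeFn y hy', he] at h1
      simp only at h1
      rwa [hinner] at h1
    exact (Lp.eq_zero_iff_ae_eq_zero).2 (ae_eq_zero_of_integral_polyP hy' h0)
  have key := (HilbertBasis.mkOfOrthogonalEqBot horth hbot).hasSum_inner_mul_inner
    (hx.toLp x) (hx.toLp x)
  simp only [HilbertBasis.coe_mkOfOrthogonalEqBot, he, hinner] at key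
  convert! key using 1
  · funext j
    rw [sq]
    congr 1
    congr 1
    funext z
    ring
  · congr 1
    funext z
    ring

/-! ### The spectral gap for functions supported in `[√b, ∞)` -/

theorem wMeasure_eq_restrict (b : ℝ) : wMeasure b = (wMeasure 0).restrict (Ioi (√b)) := by
  rw [wMeasure, wMeasure, restrict_withDensity measurableSet_Ioi,
    Measure.restrict_restrict measurableSet_Ioi, Ioi_inter_Ioi]
  simp

open Polynomial in
-- Integration by parts against the divergence form of the mode equation. The boundary term at 0
-- vanishes because of the factor z² in the flux.
theorem integral_derivative_polyP_mul (i j : ℕ) :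
    ∫ z, (derivative (polyP i)).eval z * (derivative (polyP j)).eval z ∂(wMeasure 0) =
      if i = j then 2 * (j : ℝ) else 0 := by
  set g : ℝ → ℝ := fun z => (derivative (polyP j)).eval z * (Real.exp (-z ^ 2 / 2) * z ^ 2) with hg
  have hint : ∀ p q : ℝ[X], IntegrableOn
      (fun z => p.eval z * (q.eval z * (Real.exp (-z ^ 2 / 2) * z ^ 2))) (Ioi 0) := fun p q => by
    refine ((integrable_polynomial_mul_exp (p * q * X ^ 2)).integrableOn).congr_fun
      (fun z _ => ?_) measurableSet_Ioi
    simp only [eval_mul, eval_pow, eval_X]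
    ring
  have hd : ∀ z ∈ Ici (0 : ℝ), HasDerivAt (fun z => (polyP i).eval z * g z)
      ((derivative (polyP i)).eval z * g z + (polyP i).eval z *
        (-(2 * j * (polyP j).eval z * (Real.exp (-z ^ 2 / 2) * z ^ 2)))) z := fun z _ =>
    ((polyP i).hasDerivAt z).mul (hasDerivAt_polyP_flux j z)
  have i1 := hint (derivative (polyP i)) (derivative (polyP j))
  have i2 : IntegrableOn (fun z => (polyP i).eval z *
      (-(2 * j * (polyP j).eval z * (Real.exp (-z ^ 2 / 2) * z ^ 2)))) (Ioi 0) := by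
    refine ((hint (polyP i) (polyP j)).const_mul (-(2 * j))).congr
      (Eventually.of_forall fun z => ?_)
    simp only
    ring
  have i3 := hint (polyP i) (derivative (polyP j))
  have hlim := tendsto_zero_of_hasDerivAt_of_integrableOn_Ioi
    (fun t ht => hd t (le_of_lt (show 0 < t from ht))) (i1.add i2) i3
  have key := integral_Ioi_of_hasDerivAt_of_tendsto' hd (i1.add i2) hlim
  rw [integral_add i1 i2] at key
  have h2 : ∫ z in Ioi (0 : ℝ), (polyP i).eval z *
      (-(2 * j * (polyP j).eval z * (Real.exp (-z ^ 2 / 2) * z ^ 2))) =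
      -(2 * (j : ℝ)) * (if i = j then 1 else 0) := by
    rw [← integral_polyP_mul i j, ← integral_const_mul]
    congr 1
    funext z
    ring
  rw [integral_wMeasure, Real.sqrt_zero]
  have h0 : g 0 = 0 := by simp [hg]
  rw [h2, h0, mul_zero, sub_zero] at key
  simp only [← mul_assoc] at key ⊢
  split_ifs at key ⊢ <;> linarith

/-- The weak form of the mode equation tested with u. The condition u(√b) = 0 removes the boundary
term at √b, where the flux of P_j need not vanish. -/
theorem integral_dz_mul_derivative_polyP {b : ℝ} {u : ℝ → ℝ} (hu : MemH1 b u) (j : ℕ) :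
    ∫ z, RadialStefan.dz b u z * (Polynomial.derivative (polyP j)).eval z ∂(wMeasure b) =
      2 * j * ∫ z, u z * (polyP j).eval z ∂(wMeasure b) := by
  set a := √b with ha
  set g : ℝ → ℝ := fun z => (Polynomial.derivative (polyP j)).eval z *
    (Real.exp (-z ^ 2 / 2) * z ^ 2) with hg
  set g' : ℝ → ℝ := fun z => -(2 * j * (polyP j).eval z * (Real.exp (-z ^ 2 / 2) * z ^ 2)) with hg'
  have hgd : ∀ z, HasDerivAt g (g' z) z := hasDerivAt_polyP_flux j
  have hgc : ContDiff ℝ 1 g := by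
    have h1 : ContDiff ℝ 1 (fun z => (Polynomial.derivative (polyP j)).eval z) :=
      by
      simpa using (Polynomial.derivative (polyP j)).contDiff_aeval (𝕜 := ℝ) 1
    simp only [hg]
    fun_prop
  have hprod : ∀ (f : ℝ → ℝ) (p : Polynomial ℝ), MemLp f 2 (wMeasure b) → IntegrableOn
      (fun z => f z * (p.eval z * (Real.exp (-z ^ 2 / 2) * z ^ 2))) (Ioi a) := fun f p hf => by
    have := (integrable_wMeasure_iff b _).1 (integrable_mul_of_memLp hf (memLp_polynomial b p))
    simpa only [mul_assoc] using this
  have i1 := hprod _ (Polynomial.derivative (polyP j)) hu.memLp_deriv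
  have i2 : IntegrableOn (fun z => u z * g' z) (Ioi a) := by
    refine ((hprod _ (polyP j) hu.memLp).const_mul (-(2 * j))).congr
      (Eventually.of_forall fun z => ?_)
    simp only [hg']
    ring
  have i3 := hprod _ (Polynomial.derivative (polyP j)) hu.memLp
  have hpart : ∀ R, a ≤ R → ∫ z in a..R, (RadialStefan.dz b u z * g z + u z * g' z) = u R * g R := by
    intro R hR
    have hgAC : AbsolutelyContinuousOnInterval g a R := hgc.contDiffOn.absolutelyContinuousOnInterval
    have h1 := (hu.locallyAC R hR).integral_deriv_mul_eq_sub hgAC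
    rw [hu.boundary, zero_mul, sub_zero] at h1
    rw [← h1, intervalIntegral.integral_of_le hR, intervalIntegral.integral_of_le hR]
    refine setIntegral_congr_fun measurableSet_Ioc fun z hz => ?_
    rw [(hgd z).deriv, RadialStefan.dz, derivWithin_of_mem_nhds (Ici_mem_nhds hz.1)]
  have hlim := intervalIntegral_tendsto_integral_Ioi a (i1.add i2) tendsto_id
  have hlim2 : Tendsto (fun R => u R * g R) atTop
      (𝓝 (∫ z in Ioi a, (RadialStefan.dz b u z * g z + u z * g' z))) := by
    refine hlim.congr' ?_
    filter_upwards [eventually_ge_atTop a] with R hR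
    exact hpart R hR
  -- The boundary term at infinity has a limit, since the integrals over [a, R] converge. It is also
  -- integrable in R, so the limit must be 0.
  have hzero : (∫ z in Ioi a, (RadialStefan.dz b u z * g z + u z * g' z)) = 0 := by
    refine IntegrableAtFilter.eq_zero_of_tendsto (μ := volume) (f := fun R => u R * g R) (l := atTop)
      ⟨Ioi a, Ioi_mem_atTop a, i3⟩ ?_ hlim2
    intro s hs
    obtain ⟨c, hc⟩ := mem_atTop_sets.1 hs
    rw [← top_le_iff, ← Real.volume_Ici (a := c)]
    exact measure_mono hc
  rw [integral_add i1 i2] at hzero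
  rw [integral_wMeasure, integral_wMeasure, ← integral_const_mul]
  have h2 : ∫ z in Ioi a, u z * g' z = -∫ z in Ioi a, 2 * j * (u z * (polyP j).eval z *
      (Real.exp (-z ^ 2 / 2) * z ^ 2)) := by
    rw [← integral_neg]
    congr 1
    funext z
    simp only [hg']
    ring
  rw [h2] at hzero
  simp only [← mul_assoc] at hzero ⊢
  linarith

/-- Apply Parseval on (0, ∞) to the extension of u by zero. -/
theorem hasSum_sq_integral_polyP_wMeasure {b : ℝ} {u : ℝ → ℝ} (hu : MemLp u 2 (wMeasure b)) :
    HasSum (fun j : ℕ => (∫ z, u z * (polyP j).eval z ∂(wMeasure b)) ^ 2)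
      (∫ z, u z ^ 2 ∂(wMeasure b)) := by
  have hx : MemLp ((Ioi (√b)).indicator u) 2 (wMeasure 0) := by
    rw [memLp_indicator_iff_restrict measurableSet_Ioi, ← wMeasure_eq_restrict]
    exact hu
  have key := hasSum_sq_integral_polyP hx
  have h : ∀ F : ℝ → ℝ → ℝ, (∀ z, F 0 z = 0) →
      ∫ z, F ((Ioi (√b)).indicator u z) z ∂(wMeasure 0) = ∫ z, F (u z) z ∂(wMeasure b) := by
    intro F hF
    rw [wMeasure_eq_restrict b, ← integral_indicator measurableSet_Ioi]
    congr 1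
    funext z
    by_cases hz : z ∈ Ioi (√b)
    · rw [indicator_of_mem hz, indicator_of_mem hz]
    · rw [indicator_of_notMem hz, indicator_of_notMem hz, hF]
  have e1 := h (fun x _ => x ^ 2) (by simp)
  have e2 := fun j => h (fun x z => x * (polyP j).eval z) (by simp)
  simpa only [e1, e2] using key

/-- Bessel's inequality for u' and the system P_j': expand the square of u' - Σ c_j P_j'. The P_j'
are orthogonal only on (0, ∞), but restricting to (√b, ∞) can only decrease the norm of the sum,
which is the favourable direction. -/
theorem sum_mul_sq_le_integral_dz_sq {b : ℝ} {u : ℝ → ℝ} (hu : MemH1 b u) (N : ℕ) :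
    ∑ j ∈ Finset.range N, 2 * (j : ℝ) * (∫ z, u z * (polyP j).eval z ∂(wMeasure b)) ^ 2 ≤
      ∫ z, RadialStefan.dz b u z ^ 2 ∂(wMeasure b) := by
  set c : ℕ → ℝ := fun j => ∫ z, u z * (polyP j).eval z ∂(wMeasure b) with hc
  set p : ℕ → Polynomial ℝ := fun j => Polynomial.derivative (polyP j) with hp
  set s : Polynomial ℝ := ∑ j ∈ Finset.range N, Polynomial.C (c j) * p j with hs
  have hse : ∀ z, s.eval z = ∑ j ∈ Finset.range N, c j * (p j).eval z := fun z => by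
    simp [hs, Polynomial.eval_finsetSum]
  have hpp : ∀ (b : ℝ) (q r : Polynomial ℝ), Integrable (fun z => q.eval z * r.eval z) (wMeasure b) :=
    fun b q r => integrable_mul_of_memLp (memLp_polynomial b q) (memLp_polynomial b r)
  have hup : ∀ q : Polynomial ℝ, Integrable (fun z => RadialStefan.dz b u z * q.eval z) (wMeasure b) :=
    fun q => integrable_mul_of_memLp hu.memLp_deriv (memLp_polynomial b q)
  have h1 : ∫ z, RadialStefan.dz b u z * s.eval z ∂(wMeasure b) =
      ∑ j ∈ Finset.range N, 2 * (j : ℝ) * c j ^ 2 := by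
    have : (fun z => RadialStefan.dz b u z * s.eval z) = fun z => ∑ j ∈ Finset.range N,
        c j * (RadialStefan.dz b u z * (p j).eval z) := by
      funext z
      rw [hse, Finset.mul_sum]
      exact Finset.sum_congr rfl fun j _ => by ring
    rw [this, integral_finsetSum _ (fun j _ => (hup (p j)).const_mul _)]
    refine Finset.sum_congr rfl fun j _ => ?_
    rw [integral_const_mul, integral_dz_mul_derivative_polyP hu]
    ring
  have h2 : ∫ z, s.eval z * s.eval z ∂(wMeasure 0) = ∑ j ∈ Finset.range N, 2 * (j : ℝ) * c j ^ 2 := by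
    have : (fun z => s.eval z * s.eval z) = fun z => ∑ i ∈ Finset.range N, ∑ j ∈ Finset.range N,
        c i * c j * ((p i).eval z * (p j).eval z) := by
      funext z
      rw [hse, Finset.sum_mul_sum]
      exact Finset.sum_congr rfl fun i _ => Finset.sum_congr rfl fun j _ => by ring
    rw [this, integral_finsetSum _ (fun i _ => integrable_finsetSum _
      fun j _ => (hpp 0 (p i) (p j)).const_mul _)]
    refine Finset.sum_congr rfl fun i hi => ?_
    rw [integral_finsetSum _ (fun j _ => (hpp 0 (p i) (p j)).const_mul _),
      Finset.sum_eq_single i]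
    · rw [integral_const_mul, hp, integral_derivative_polyP_mul, if_pos rfl]
      ring
    · intro j _ hji
      rw [integral_const_mul, hp, integral_derivative_polyP_mul, if_neg hji.symm, mul_zero]
    · exact fun h => absurd hi h
  have h3 : ∫ z, s.eval z * s.eval z ∂(wMeasure b) ≤ ∫ z, s.eval z * s.eval z ∂(wMeasure 0) :=
    integral_mono_measure (wMeasure_le_zero b) (Eventually.of_forall fun z => mul_self_nonneg _)
      (hpp 0 s s)
  have h4 : 0 ≤ ∫ z, (RadialStefan.dz b u z - s.eval z) ^ 2 ∂(wMeasure b) :=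
    integral_nonneg fun z => sq_nonneg _
  have h5 : ∫ z, (RadialStefan.dz b u z - s.eval z) ^ 2 ∂(wMeasure b) =
      ∫ z, RadialStefan.dz b u z ^ 2 ∂(wMeasure b)
        - 2 * ∫ z, RadialStefan.dz b u z * s.eval z ∂(wMeasure b)
        + ∫ z, s.eval z * s.eval z ∂(wMeasure b) := by
    have h6 := integral_add (hu.memLp_deriv.integrable_sq.sub ((hup s).const_mul 2)) (hpp b s s)
    simp only [Pi.sub_apply] at h6
    rw [← integral_const_mul, ← integral_sub hu.memLp_deriv.integrable_sq ((hup s).const_mul 2), ← h6]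
    congr 1
    funext z
    ring
  rw [h1] at h5
  linarith

/-- The spectral gap on `[0, ∞)`, tested on functions supported in `[√b, ∞)`. -/
theorem spectral_gap_zero {b : ℝ} {u : ℝ → ℝ} (hu : MemH1 b u) (k : ℕ) :
    (2 * k + 2) * (∫ z, u z ^ 2 ∂(wMeasure b) - ∑ j ∈ Finset.range (k + 1),
      (∫ z, u z * (polyP j).eval z ∂(wMeasure b)) ^ 2) ≤
      ∫ z, RadialStefan.dz b u z ^ 2 ∂(wMeasure b) := by
  set c : ℕ → ℝ := fun j => ∫ z, u z * (polyP j).eval z ∂(wMeasure b) with hc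
  have hsum := (hasSum_sq_integral_polyP_wMeasure hu.memLp).tendsto_sum_nat
  have hlim := (hsum.sub_const (∑ j ∈ Finset.range (k + 1), c j ^ 2)).const_mul (2 * (k : ℝ) + 2)
  -- Modes with j ≥ k+1 carry a weight 2j ≥ 2k+2, so the bound holds for partial sums and passes to
  -- the limit.
  refine le_of_tendsto hlim ?_
  filter_upwards [eventually_ge_atTop (k + 1)] with N hN
  refine le_trans ?_ (sum_mul_sq_le_integral_dz_sq hu N)
  rw [← Finset.sum_range_add_sum_Ico _ hN, ← Finset.sum_range_add_sum_Ico _ hN, add_sub_cancel_left,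
    Finset.mul_sum]
  have h1 : 0 ≤ ∑ j ∈ Finset.range (k + 1), 2 * (j : ℝ) * c j ^ 2 :=
    Finset.sum_nonneg fun j _ => by positivity
  have h2 : ∑ j ∈ Finset.Ico (k + 1) N, (2 * (k : ℝ) + 2) * c j ^ 2 ≤
      ∑ j ∈ Finset.Ico (k + 1) N, 2 * (j : ℝ) * c j ^ 2 := by
    refine Finset.sum_le_sum fun j hj => ?_
    have : ((k + 1 : ℕ) : ℝ) ≤ j := Nat.cast_le.2 (Finset.mem_Ico.1 hj).1
    push_cast at this
    gcongr
    linarith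
  simp only [hc] at h1 h2 ⊢
  linarith

/-! ### Families of polynomially bounded functions -/

/-- `v a` is bounded by a polynomial on `[a, ∞)`, uniformly in small `a > 0`. -/
def PolyBdd (v : ℝ → ℝ → ℝ) : Prop :=
  ∃ C : ℝ, 0 ≤ C ∧ ∃ N : ℕ, ∀ᶠ a in 𝓝[>] (0 : ℝ), ∀ z, a ≤ z → |v a z| ≤ C * (1 + z) ^ N

theorem eventually_pos_lt_one : ∀ᶠ a in 𝓝[>] (0 : ℝ), 0 < a ∧ a < 1 :=
  Ioo_mem_nhdsGT one_pos

namespace PolyBdd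

variable {v w : ℝ → ℝ → ℝ}

theorem mono (hv : PolyBdd v) (h : ∀ᶠ a in 𝓝[>] (0 : ℝ), ∀ z, a ≤ z → |w a z| ≤ |v a z|) :
    PolyBdd w := by
  obtain ⟨C, hC, N, H⟩ := hv
  refine ⟨C, hC, N, ?_⟩
  filter_upwards [H, h] with a h1 h2 z hz using (h2 z hz).trans (h1 z hz)

theorem congr (hv : PolyBdd v) (h : ∀ᶠ a in 𝓝[>] (0 : ℝ), ∀ z, a ≤ z → w a z = v a z) :
    PolyBdd w :=
  hv.mono (h.mono fun a ha z hz => by rw [ha z hz])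

theorem add (hv : PolyBdd v) (hw : PolyBdd w) : PolyBdd (fun a z => v a z + w a z) := by
  obtain ⟨C, hC, N, H⟩ := hv
  obtain ⟨C', hC', N', H'⟩ := hw
  refine ⟨C + C', by positivity, N + N', ?_⟩
  filter_upwards [H, H', eventually_pos_lt_one] with a h h' ha z hz
  have hz0 : 0 < z := ha.1.trans_le hz
  have h1 : (1 + z) ^ N ≤ (1 + z) ^ (N + N') := pow_le_pow_right₀ (by linarith) (by omega)
  have h2 : (1 + z) ^ N' ≤ (1 + z) ^ (N + N') := pow_le_pow_right₀ (by linarith) (by omega)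
  have := abs_add_le (v a z) (w a z)
  nlinarith [mul_le_mul_of_nonneg_left h1 hC, mul_le_mul_of_nonneg_left h2 hC', h z hz, h' z hz]

theorem mul (hv : PolyBdd v) (hw : PolyBdd w) : PolyBdd (fun a z => v a z * w a z) := by
  obtain ⟨C, hC, N, H⟩ := hv
  obtain ⟨C', hC', N', H'⟩ := hw
  refine ⟨C * C', by positivity, N + N', ?_⟩
  filter_upwards [H, H', eventually_pos_lt_one] with a h h' ha z hz
  have hz0 : 0 < z := ha.1.trans_le hz
  rw [abs_mul, pow_add, mul_mul_mul_comm]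
  exact mul_le_mul (h z hz) (h' z hz) (abs_nonneg _) (by positivity)

theorem of_eventually_le {f : ℝ → ℝ} {C : ℝ} (h : ∀ᶠ a in 𝓝[>] (0 : ℝ), |f a| ≤ C) :
    PolyBdd (fun a _ => f a) := by
  refine ⟨max C 0, le_max_right _ _, 0, ?_⟩
  filter_upwards [h] with a ha z _
  simpa using Or.inl ha

theorem const (c : ℝ) : PolyBdd (fun _ _ => c) :=
  of_eventually_le (C := |c|) (Eventually.of_forall fun _ => le_rfl)

theorem fst : PolyBdd (fun a _ => a) :=
  of_eventually_le (C := 1) (by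
    filter_upwards [eventually_pos_lt_one] with a ha
    rw [abs_of_pos ha.1]
    exact ha.2.le)

theorem snd : PolyBdd (fun _ z => z) := by
  refine ⟨1, zero_le_one, 1, ?_⟩
  filter_upwards [eventually_pos_lt_one] with a ha z hz
  rw [abs_of_pos (ha.1.trans_le hz)]
  linarith

theorem const_mul (c : ℝ) (hv : PolyBdd v) : PolyBdd (fun a z => c * v a z) := (const c).mul hv

theorem neg (hv : PolyBdd v) : PolyBdd (fun a z => -v a z) :=
  (hv.const_mul (-1)).congr (Eventually.of_forall fun a z _ => by ring)

theorem sub (hv : PolyBdd v) (hw : PolyBdd w) : PolyBdd (fun a z => v a z - w a z) :=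
  (hv.add hw.neg).congr (Eventually.of_forall fun a z _ => by ring)

theorem polynomial (p : Polynomial ℝ) : PolyBdd (fun _ z => p.eval z) := by
  obtain ⟨C, hC, N, H⟩ := p.exists_abs_eval_le
  refine ⟨C, hC, N, ?_⟩
  filter_upwards [eventually_pos_lt_one] with a ha z hz using H z (ha.1.le.trans hz)

/-- Division by `z` costs at most the factor `1 / a`. -/
theorem mul_div (hv : PolyBdd v) : PolyBdd (fun a z => a * v a z / z) := by
  refine hv.mono ?_
  filter_upwards [eventually_pos_lt_one] with a ha z hz
  have hz0 : 0 < z := ha.1.trans_le hz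
  rw [abs_div, abs_mul, abs_of_pos ha.1, abs_of_pos hz0, div_le_iff₀ hz0, mul_comm]
  gcongr

/-- A family which vanishes at `z = a` and has polynomially bounded derivative is `O(z)`. -/
theorem div_of_zero {v₁ : ℝ → ℝ → ℝ} (hv : PolyBdd v₁)
    (hd : ∀ᶠ a in 𝓝[>] (0 : ℝ), ∀ z, HasDerivAt (v a) (v₁ a z) z)
    (h0 : ∀ᶠ a in 𝓝[>] (0 : ℝ), v a a = 0) : PolyBdd (fun a z => v a z / z) := by
  obtain ⟨C, hC, N, H⟩ := hv
  refine ⟨C, hC, N, ?_⟩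
  filter_upwards [H, hd, h0, eventually_pos_lt_one] with a h hd h0 ha z hz
  have hz0 : 0 < z := ha.1.trans_le hz
  have := (convex_Icc a z).norm_image_sub_le_of_norm_hasDerivWithin_le
    (f := v a) (f' := v₁ a) (C := C * (1 + z) ^ N) (fun x _ => (hd x).hasDerivWithinAt)
    (fun x hx => (h x hx.1).trans (by
      have : 0 ≤ 1 + x := by linarith [hx.1, ha.1]
      gcongr
      exact hx.2))
    (left_mem_Icc.2 hz) (right_mem_Icc.2 hz)
  rw [h0, sub_zero, Real.norm_eq_abs, Real.norm_of_nonneg (by linarith)] at this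
  rw [abs_div, abs_of_pos hz0, div_le_iff₀ hz0]
  refine this.trans ?_
  gcongr
  linarith [ha.1]

end PolyBdd

/-! ### Uniform bounds in the limit `b → 0` -/

theorem tendsto_sqrt_nhdsGT_zero : Tendsto Real.sqrt (𝓝[>] 0) (𝓝[>] 0) := by
  refine tendsto_nhdsWithin_iff.2 ⟨?_, ?_⟩
  · have : Tendsto Real.sqrt (𝓝 0) (𝓝 (√0)) := Real.continuous_sqrt.tendsto 0
    rw [Real.sqrt_zero] at this
    exact this.mono_left nhdsWithin_le_nhds
  · filter_upwards [self_mem_nhdsWithin] with b hb using Real.sqrt_pos.2 hb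

/-- `A b = O(s b)` as `b → 0⁺`. -/
def EBdd (s : ℝ → ℝ) (A : ℝ → ENNReal) : Prop :=
  ∃ C : ℝ, 0 ≤ C ∧ ∀ᶠ b in 𝓝[>] (0 : ℝ), A b ≤ ENNReal.ofReal (C * s b)

theorem EBdd.mono {s : ℝ → ℝ} {A B : ℝ → ENNReal} (hA : EBdd s A)
    (h : ∀ᶠ b in 𝓝[>] (0 : ℝ), B b ≤ A b) : EBdd s B := by
  obtain ⟨C, hC, H⟩ := hA
  exact ⟨C, hC, by filter_upwards [h, H] with b h1 h2 using h1.trans h2⟩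

theorem EBdd.add {s : ℝ → ℝ} (hs : ∀ b, 0 ≤ s b) {A B : ℝ → ENNReal} (hA : EBdd s A)
    (hB : EBdd s B) : EBdd s (fun b => A b + B b) := by
  obtain ⟨C, hC, H⟩ := hA
  obtain ⟨C', hC', H'⟩ := hB
  refine ⟨C + C', by positivity, ?_⟩
  filter_upwards [H, H'] with b h h'
  rw [add_mul, ENNReal.ofReal_add (mul_nonneg hC (hs b)) (mul_nonneg hC' (hs b))]
  exact add_le_add h h'

/-- A statement holds for all large constants and then for all small `b`. -/
def Ultimately (p : ℝ → ℝ → Prop) : Prop := ∀ᶠ C in atTop, ∀ᶠ b in 𝓝[>] (0 : ℝ), p C b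

theorem Ultimately.and {p q : ℝ → ℝ → Prop} (hp : Ultimately p) (hq : Ultimately q) :
    Ultimately (fun C b => p C b ∧ q C b) := by
  filter_upwards [hp, hq] with C h1 h2 using h1.and h2

theorem Ultimately.of_eventually {p : ℝ → Prop} (hp : ∀ᶠ b in 𝓝[>] (0 : ℝ), p b) :
    Ultimately (fun _ b => p b) := Eventually.of_forall fun _ => hp

theorem Ultimately.mono {p q : ℝ → ℝ → Prop} (hp : Ultimately p)
    (h : ∀ C b, 0 < b → p C b → q C b) : Ultimately q := by
  filter_upwards [hp] with C h1
  filter_upwards [h1, self_mem_nhdsWithin] with b h2 hb using h C b hb h2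

theorem EBdd.ultimately {s : ℝ → ℝ} (hs : ∀ b, 0 ≤ s b) {A : ℝ → ENNReal} (hA : EBdd s A) :
    Ultimately (fun C b => A b ≤ ENNReal.ofReal (C * s b)) := by
  obtain ⟨C, hC, H⟩ := hA
  filter_upwards [eventually_ge_atTop C] with C' hC'
  filter_upwards [H] with b hb
  exact hb.trans (ENNReal.ofReal_le_ofReal (mul_le_mul_of_nonneg_right hC' (hs b)))

/-- The bridge from pointwise bounds to norms: once a function is s(b) v/z with polynomially bounded
v, its norm is O(s(b)), with the constant given by one envelope on (0, ∞). -/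
theorem PolyBdd.eBdd_wNorm {v : ℝ → ℝ → ℝ} (hv : PolyBdd v) {s : ℝ → ℝ} (hs : ∀ b, 0 ≤ s b)
    {f : ℝ → ℝ → ℝ}
    (hf : ∀ᶠ b in 𝓝[>] (0 : ℝ), ∀ z, √b ≤ z → |f b z| ≤ s b * (|v (√b) z| / z)) :
    EBdd s (fun b => wNorm b (f b)) := by
  obtain ⟨C, hC, N, H⟩ := hv
  refine ⟨C * envNorm N, mul_nonneg hC (envNorm_nonneg N), ?_⟩
  filter_upwards [hf, tendsto_sqrt_nhdsGT_zero.eventually H, self_mem_nhdsWithin] with b h1 h2 hb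
  have hb' : 0 < √b := Real.sqrt_pos.2 hb
  refine (wNorm_le_of_bound (C := C * s b) (N := N) (mul_nonneg hC (hs b)) fun z hz => ?_).trans
    (le_of_eq (by ring_nf))
  have hz0 : 0 < z := hb'.trans hz
  calc |f b z| ≤ s b * (|v (√b) z| / z) := h1 z hz.le
    _ ≤ s b * ((C * (1 + z) ^ N) / z) := by
        have := h2 z hz.le
        have := hs b
        gcongr
    _ = _ := by ring

theorem PolyBdd.eBdd_diag {v : ℝ → ℝ → ℝ} (hv : PolyBdd v) {s : ℝ → ℝ} (hs : ∀ b, 0 ≤ s b)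
    {f : ℝ → ℝ} (hf : ∀ᶠ b in 𝓝[>] (0 : ℝ), f b ≤ s b * |v (√b) (√b)|) :
    EBdd s (fun b => ENNReal.ofReal (f b)) := by
  obtain ⟨C, hC, N, H⟩ := hv
  refine ⟨C * 2 ^ N, by positivity, ?_⟩
  filter_upwards [hf, tendsto_sqrt_nhdsGT_zero.eventually H,
    tendsto_sqrt_nhdsGT_zero.eventually eventually_pos_lt_one] with b h1 h2 hb
  refine ENNReal.ofReal_le_ofReal (h1.trans ?_)
  calc s b * |v (√b) (√b)| ≤ s b * (C * (1 + √b) ^ N) :=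
        mul_le_mul_of_nonneg_left (h2 _ le_rfl) (hs b)
    _ ≤ s b * (C * 2 ^ N) := by
        have := hs b
        have := hb.1
        gcongr
        linarith [hb.2]
    _ = _ := by ring

theorem PolyBdd.integral_bound {v : ℝ → ℝ → ℝ} (hv : PolyBdd v) : ∃ C : ℝ, 0 ≤ C ∧
    ∀ᶠ b in 𝓝[>] (0 : ℝ), |∫ z, v (√b) z / z ^ 2 ∂(wMeasure b)| ≤ C := by
  obtain ⟨C, hC, N, H⟩ := hv
  have hint := (memLp_envelope N 0).integrable_sq
  refine ⟨C * ∫ z, envelope N 0 z ^ 2 ∂(wMeasure 0),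
    mul_nonneg hC (integral_nonneg fun z => sq_nonneg _), ?_⟩
  filter_upwards [tendsto_sqrt_nhdsGT_zero.eventually H, self_mem_nhdsWithin] with b h hb
  have hb' : 0 < √b := Real.sqrt_pos.2 hb
  have h1 : |∫ z, v (√b) z / z ^ 2 ∂(wMeasure b)| ≤
      ∫ z, C * envelope N 0 z ^ 2 ∂(wMeasure b) := by
    rw [← Real.norm_eq_abs]
    refine norm_integral_le_of_norm_le ((hint.mono_measure (wMeasure_le_zero b)).const_mul C) ?_
    filter_upwards [ae_wMeasure b] with z hz
    have hz0 : 0 < z := hb'.trans hz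
    rw [Real.norm_eq_abs, abs_div, abs_of_pos (by positivity : 0 < z ^ 2), envelope, div_pow,
      zero_mul, Real.exp_zero, mul_one, mul_div_assoc']
    gcongr
    refine (h z hz.le).trans ?_
    have h2 : (1 + z) ^ N ≤ ((1 + z) ^ N) ^ 2 :=
      le_self_pow₀ (one_le_pow₀ (by linarith)) (by norm_num)
    gcongr
  refine h1.trans ?_
  rw [integral_const_mul]
  refine mul_le_mul_of_nonneg_left ?_ hC
  exact integral_mono_measure (wMeasure_le_zero b) (Eventually.of_forall fun z => sq_nonneg _) hint

theorem wNormH1_le (b : ℝ) (f : ℝ → ℝ) :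
    wNormH1 b f ≤ wNorm b (RadialStefan.dz b f) + wNorm b f := by
  set A := wNorm b (RadialStefan.dz b f)
  set B := wNorm b f
  have h : A ^ 2 + B ^ 2 ≤ (A + B) ^ 2 := by
    rw [add_sq]
    exact add_le_add (le_add_right le_rfl) le_rfl
  calc wNormH1 b f = (A ^ 2 + B ^ 2) ^ (1 / 2 : ℝ) := rfl
    _ ≤ ((A + B) ^ 2) ^ (1 / 2 : ℝ) := ENNReal.rpow_le_rpow h (by norm_num)
    _ = A + B := by
        rw [← ENNReal.rpow_natCast, ← ENNReal.rpow_mul]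
        norm_num

/-! ### The radial operators on functions `v / z` -/

section div

variable {b : ℝ} {f v v₁ v₂ : ℝ → ℝ}

theorem dz_eq_of_eqOn {g : ℝ → ℝ} (hf : ∀ z, √b ≤ z → f z = g z) {g' z : ℝ}
    (hz : √b ≤ z) (hg : HasDerivAt g g' z) : RadialStefan.dz b f z = g' := by
  have h : EqOn f g (Ici (√b)) := fun y hy => hf y hy
  rw [RadialStefan.dz, derivWithin_congr h (hf z hz)]
  exact hg.hasDerivWithinAt.derivWithin (uniqueDiffOn_Ici _ z hz)

theorem dz_div (hb : 0 < b) (hf : ∀ z, √b ≤ z → f z = v z / z)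
    (hv : ∀ z, HasDerivAt v (v₁ z) z) {z : ℝ} (hz : √b ≤ z) :
    RadialStefan.dz b f z = v₁ z / z - v z / z ^ 2 := by
  have hz0 : z ≠ 0 := ((Real.sqrt_pos.2 hb).trans_le hz).ne'
  refine dz_eq_of_eqOn hf hz (((hv z).div (hasDerivAt_id z) hz0).congr_deriv ?_)
  simp only [id]
  field_simp

theorem lap_div (hb : 0 < b) (hf : ∀ z, √b ≤ z → f z = v z / z)
    (hv : ∀ z, HasDerivAt v (v₁ z) z) (hv₁ : ∀ z, HasDerivAt v₁ (v₂ z) z) {z : ℝ} (hz : √b ≤ z) :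
    lap b f z = v₂ z / z := by
  have hz0 : z ≠ 0 := ((Real.sqrt_pos.2 hb).trans_le hz).ne'
  have h1 : RadialStefan.dz b (RadialStefan.dz b f) z =
      v₂ z / z - 2 * v₁ z / z ^ 2 + 2 * v z / z ^ 3 := by
    refine dz_eq_of_eqOn (fun y hy => dz_div hb hf hv hy) hz ?_
    refine (((hv₁ z).div (hasDerivAt_id z) hz0).sub
      ((hv z).div (hasDerivAt_pow 2 z) (pow_ne_zero 2 hz0))).congr_deriv ?_
    simp only [id]
    field_simp
    push_cast
    ring
  rw [lap, h1, dz_div hb hf hv hz]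
  field_simp
  ring

theorem Lam_div (hb : 0 < b) (hf : ∀ z, √b ≤ z → f z = v z / z)
    (hv : ∀ z, HasDerivAt v (v₁ z) z) {z : ℝ} (hz : √b ≤ z) :
    Lam b f z = (z * v₁ z - v z) / z := by
  have hz0 : z ≠ 0 := ((Real.sqrt_pos.2 hb).trans_le hz).ne'
  rw [Lam, dz_div hb hf hv hz]
  field_simp

theorem Hop_div (hb : 0 < b) (hf : ∀ z, √b ≤ z → f z = v z / z)
    (hv : ∀ z, HasDerivAt v (v₁ z) z) (hv₁ : ∀ z, HasDerivAt v₁ (v₂ z) z) {z : ℝ} (hz : √b ≤ z) :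
    Hop b f z = (-v₂ z + z * v₁ z - v z) / z := by
  rw [Hop, lap_div hb hf hv hv₁ hz, Lam_div hb hf hv hz]
  ring

end div

/-! ### The branch of eigenvalues -/

/-- The branch of zeros of `oddHerm k` through the origin. -/
noncomputable def root (k : ℕ) : ℝ → ℝ := (exists_root k).choose

theorem root_bounds (k : ℕ) : ∃ C : ℝ, 0 ≤ C ∧ ∀ᶠ a in 𝓝[>] (0 : ℝ), DifferentiableAt ℝ (root k) a ∧
    |root k a| ≤ C * a ∧ |deriv (root k) a| ≤ C ∧ |root k a - coefC k ^ 2 * a| ≤ C * a ^ 2 ∧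
    |root k a - a * deriv (root k) a| ≤ C * a ^ 2 := by
  obtain ⟨h0, hd, hC, -⟩ := (exists_root k).choose_spec
  obtain ⟨C, hC0, H⟩ := hC.exists_bounds_of_zero h0
  refine ⟨2 * C, by positivity, ?_⟩
  filter_upwards [nhdsWithin_le_nhds H, eventually_pos_lt_one] with a ⟨h1, h2, h3, h4, h5⟩ ha
  rw [abs_of_pos ha.1] at h2 h4
  have h6 : |root k a - a * deriv (root k) a| ≤ C * a ^ 2 + a * (C * a) := by
    have e : root k a - a * deriv (root k) a =
        (root k a - deriv (root k) 0 * a) - a * (deriv (root k) a - deriv (root k) 0) := by ring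
    rw [e]
    refine (abs_sub _ _).trans (add_le_add h5 ?_)
    rw [abs_mul, abs_of_pos ha.1]
    exact mul_le_mul_of_nonneg_left h4 ha.1.le
  have hd' : deriv (root k) 0 = coefC k ^ 2 := hd
  change |root k a - deriv (root k) 0 * a| ≤ C * a ^ 2 at h5
  rw [hd'] at h5
  have h7 : 0 ≤ C * a := mul_nonneg hC0 ha.1.le
  have h8 : 0 ≤ C * a ^ 2 := by positivity
  exact ⟨h1, by simpa [root] using h2.trans (by linarith), h3.trans (by linarith),
    h5.trans (by linarith), h6.trans (by linarith)⟩

theorem root_lt (k : ℕ) : ∀ᶠ a in 𝓝[>] (0 : ℝ), |root k a| < 1 / 2 := by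
  obtain ⟨h0, hd, hC, -⟩ := (exists_root k).choose_spec
  have h1 : Tendsto (fun a => |root k a|) (𝓝 0) (𝓝 |root k 0|) := hC.continuousAt.abs
  have h2 : |root k 0| < 1 / 2 := by
    rw [root, h0]
    norm_num
  exact nhdsWithin_le_nhds (h1.eventually (gt_mem_nhds h2))

theorem oddHerm_root (k : ℕ) : ∀ᶠ a in 𝓝[>] (0 : ℝ), oddHerm k a (root k a) = 0 :=
  nhdsWithin_le_nhds (exists_root k).choose_spec.2.2.2

theorem differentiableAt_root (k : ℕ) : ∀ᶠ a in 𝓝[>] (0 : ℝ), DifferentiableAt ℝ (root k) a := by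
  obtain ⟨C, -, H⟩ := root_bounds k
  exact H.mono fun a ha => ha.1

/-! ### The class restricted to the branch e = `root k a` -/

namespace HClass

variable {g : ℝ → ℝ → ℝ}

theorem polyBdd (hg : HClass g) (k : ℕ) : PolyBdd (fun a z => g z (root k a)) := by
  obtain ⟨C, hC, N, H⟩ := hg.exists_bound
  refine ⟨C, hC, N, ?_⟩
  filter_upwards [root_lt k, eventually_pos_lt_one] with a h1 ha z hz
  exact H z _ (ha.1.le.trans hz) h1

theorem polyBdd_sub (hg : HClass g) (k : ℕ) :
    PolyBdd (fun a z => (g z (root k a) - g z 0) / a) := by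
  obtain ⟨C, hC, N, H⟩ := hg.exists_sub_bound
  obtain ⟨C', hC', H'⟩ := root_bounds k
  refine ⟨C * C', by positivity, N, ?_⟩
  filter_upwards [root_lt k, eventually_pos_lt_one, H'] with a h1 ha h2 z hz
  have hz0 : 0 ≤ z := ha.1.le.trans hz
  rw [abs_div, abs_of_pos ha.1, div_le_iff₀ ha.1]
  refine (H z _ hz0 h1).trans ?_
  calc C * |root k a| * (1 + z) ^ N ≤ C * (C' * a) * (1 + z) ^ N := by
        gcongr
        exact h2.2.1
    _ = _ := by ring

theorem polyBdd_deriv_root (k : ℕ) : PolyBdd (fun a _ => deriv (root k) a) := by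
  obtain ⟨C', hC', H'⟩ := root_bounds k
  exact PolyBdd.of_eventually_le (H'.mono fun a ha => ha.2.2.1)

/-- The numerator splits into a Taylor remainder in e, which is O(e²) = O(a²), and (root - a root')
∂_e g, where root - a root' = O(a²) because the branch is C². -/
theorem polyBdd_taylor (hg : HClass g) (k : ℕ) : PolyBdd (fun a z =>
    (g z (root k a) - g z 0 - a * deriv (root k) a * De g z (root k a)) / a ^ 2) := by
  obtain ⟨C, hC, N, H⟩ := hg.exists_taylor_bound
  obtain ⟨C', hC', H'⟩ := root_bounds k
  have h1 : PolyBdd (fun a z => (g z (root k a) - g z 0 - root k a * De g z (root k a)) / a ^ 2) := by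
    refine ⟨C * C' ^ 2, by positivity, N, ?_⟩
    filter_upwards [root_lt k, eventually_pos_lt_one, H'] with a h1 ha h2 z hz
    have hz0 : 0 ≤ z := ha.1.le.trans hz
    have ha2 : 0 < a ^ 2 := pow_pos ha.1 2
    rw [abs_div, abs_of_pos ha2, div_le_iff₀ ha2]
    refine (H z _ hz0 h1).trans ?_
    calc C * |root k a| ^ 2 * (1 + z) ^ N ≤ C * (C' * a) ^ 2 * (1 + z) ^ N := by
          gcongr
          exact h2.2.1
      _ = _ := by ring
  have h2 : PolyBdd (fun a _ => (root k a - a * deriv (root k) a) / a ^ 2) := by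
    refine PolyBdd.of_eventually_le (C := C') ?_
    filter_upwards [eventually_pos_lt_one, H'] with a ha h2
    have ha2 : 0 < a ^ 2 := pow_pos ha.1 2
    rw [abs_div, abs_of_pos ha2, div_le_iff₀ ha2]
    exact h2.2.2.2.2
  exact (h1.add (h2.mul (hg.de.polyBdd k))).congr
    (Eventually.of_forall fun a z _ => by ring)

end HClass

/-! ### Eigenvalues and eigenfunctions -/

/-- The eigenvalues. -/
noncomputable def eigVal (k : ℕ) (b : ℝ) : ℝ := 2 * k + root k (√b)

/-- `z` times the eigenfunction, without the factor `-1/√b`, as a function of `a = √b`. -/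
noncomputable def eigProfile (k : ℕ) (a z : ℝ) : ℝ := modeCoef k * oddHerm k z (root k a)

/-- The eigenfunctions. -/
noncomputable def eigFun (k : ℕ) (b z : ℝ) : ℝ := -(1 / √b) * eigProfile k (√b) z / z

/-- The slope of the coefficient `μ_{b,jk}` as a function of `√b`. -/
noncomputable def muSlope (j k : ℕ) : ℝ := wInner 0 (Q k) (P j) / (2 * ((j : ℝ) - (k : ℝ)))

/-- The coefficients `μ_{b,jk}`. -/
noncomputable def muCoef (j k : ℕ) (b : ℝ) : ℝ := muSlope j k * √b

/-- The remainder in the expansion of the eigenfunctions. -/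
noncomputable def eigRem (k : ℕ) (b z : ℝ) : ℝ := eigFun k b z - Tprofile muCoef k b z

/-- The first order correction in `T_{b,k}`. -/
noncomputable def corrPoly (k : ℕ) : Polynomial ℝ :=
  ∑ j ∈ Finset.range k, Polynomial.C (muSlope j k) * polyP j

/-- `z` times the remainder, as a function of `a = √b`. -/
noncomputable def remProfile (k : ℕ) (a z : ℝ) : ℝ :=
  -(modeCoef k * ((oddHerm k z (root k a) - oddHerm k z 0) / a)) - (polyP k).eval z
    + (z - a) * (corrPoly k).eval z

theorem mul_eval_polyP_eq_oddHerm (k : ℕ) (z : ℝ) :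
    z * (polyP k).eval z = modeCoef k * oddHerm k z 0 := by
  rw [mul_eval_polyP, oddHerm_zero_right, eval_hermR]

theorem Tprofile_muCoef (k : ℕ) (b z : ℝ) : Tprofile muCoef k b z =
    ((polyP k).eval z + √b * (corrPoly k).eval z) * (1 / z - 1 / √b) := by
  have h : ∀ j, P j z = (polyP j).eval z := fun j => by rw [P_eq_eval]
  simp only [Tprofile, h, corrPoly, Polynomial.eval_finsetSum, Polynomial.eval_C_mul, muCoef,
    add_mul, Finset.mul_sum, Finset.sum_mul]
  congr 1
  exact Finset.sum_congr rfl fun j _ => by ring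

theorem eigRem_eq {b z : ℝ} (hb : 0 < b) (hz : z ≠ 0) (k : ℕ) :
    eigRem k b z = remProfile k (√b) z / z := by
  have hb' : √b ≠ 0 := (Real.sqrt_pos.2 hb).ne'
  have h := mul_eval_polyP_eq_oddHerm k z
  rw [eigRem, Tprofile_muCoef, eigFun, eigProfile, remProfile]
  field_simp
  linear_combination h

theorem hasDerivAt_eigProfile {k : ℕ} {a : ℝ} (h : |root k a| < 1 / 2) (z : ℝ) :
    HasDerivAt (eigProfile k a) (modeCoef k * Dz (oddHerm k) z (root k a)) z :=
  ((hClass_oddHerm k).hasDerivAt_dz z h).const_mul _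

/-- The derivative of `remProfile` in `z`. -/
noncomputable def remProfile₁ (k : ℕ) (a z : ℝ) : ℝ :=
  -(modeCoef k * ((Dz (oddHerm k) z (root k a) - Dz (oddHerm k) z 0) / a))
    - (Polynomial.derivative (polyP k)).eval z
    + ((corrPoly k).eval z + (z - a) * (Polynomial.derivative (corrPoly k)).eval z)

/-- The second derivative of `remProfile` in `z`. -/
noncomputable def remProfile₂ (k : ℕ) (a z : ℝ) : ℝ :=
  -(modeCoef k * ((Dz (Dz (oddHerm k)) z (root k a) - Dz (Dz (oddHerm k)) z 0) / a))
    - (Polynomial.derivative (Polynomial.derivative (polyP k))).eval z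
    + ((Polynomial.derivative (corrPoly k)).eval z + ((Polynomial.derivative (corrPoly k)).eval z
      + (z - a) * (Polynomial.derivative (Polynomial.derivative (corrPoly k))).eval z))

theorem hasDerivAt_remProfile {k : ℕ} {a : ℝ} (h : |root k a| < 1 / 2) (z : ℝ) :
    HasDerivAt (remProfile k a) (remProfile₁ k a z) z := by
  have h0 : |(0 : ℝ)| < 1 / 2 := by norm_num
  have hG := hClass_oddHerm k
  refine (((((((hG.hasDerivAt_dz z h).sub (hG.hasDerivAt_dz z h0)).div_const a).const_mul
    (modeCoef k)).neg).sub ((polyP k).hasDerivAt z)).add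
    (((hasDerivAt_id z).sub_const a).mul ((corrPoly k).hasDerivAt z))).congr_deriv ?_
  simp [remProfile₁]

theorem hasDerivAt_remProfile₁ {k : ℕ} {a : ℝ} (h : |root k a| < 1 / 2) (z : ℝ) :
    HasDerivAt (remProfile₁ k a) (remProfile₂ k a z) z := by
  have h0 : |(0 : ℝ)| < 1 / 2 := by norm_num
  have hG := (hClass_oddHerm k).dz
  refine (((((((hG.hasDerivAt_dz z h).sub (hG.hasDerivAt_dz z h0)).div_const a).const_mul
    (modeCoef k)).neg).sub ((Polynomial.derivative (polyP k)).hasDerivAt z)).add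
    (((corrPoly k).hasDerivAt z).add (((hasDerivAt_id z).sub_const a).mul
      ((Polynomial.derivative (corrPoly k)).hasDerivAt z)))).congr_deriv ?_
  simp [remProfile₂]

theorem polyBdd_remProfile₁ (k : ℕ) : PolyBdd (remProfile₁ k) :=
  ((((hClass_oddHerm k).dz.polyBdd_sub k).const_mul _).neg.sub (.polynomial _)).add
    ((PolyBdd.polynomial _).add ((PolyBdd.snd.sub PolyBdd.fst).mul (.polynomial _)))

theorem polyBdd_remProfile₂ (k : ℕ) : PolyBdd (remProfile₂ k) :=
  ((((hClass_oddHerm k).dz.dz.polyBdd_sub k).const_mul _).neg.sub (.polynomial _)).add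
    ((PolyBdd.polynomial _).add ((PolyBdd.polynomial _).add
      ((PolyBdd.snd.sub PolyBdd.fst).mul (.polynomial _))))

/-- At z = a the eigenfunction and the factor 1/z - 1/a both vanish, hence so does the profile.
Dividing by z therefore loses nothing, which keeps ∂_z of the remainder bounded. -/
theorem polyBdd_remProfile_div (k : ℕ) : PolyBdd (fun a z => remProfile k a z / z) := by
  refine (polyBdd_remProfile₁ k).div_of_zero
    ((root_lt k).mono fun a h => hasDerivAt_remProfile h) ?_
  filter_upwards [oddHerm_root k, eventually_pos_lt_one] with a h ha
  have h2 := mul_eval_polyP_eq_oddHerm k a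
  have ha0 := ha.1.ne'
  rw [remProfile, h]
  field_simp
  linear_combination -h2

/-- The derivative of `remProfile` in `a`. -/
noncomputable def remProfileA (k : ℕ) (a z : ℝ) : ℝ :=
  modeCoef k * ((oddHerm k z (root k a) - oddHerm k z 0
    - a * deriv (root k) a * De (oddHerm k) z (root k a)) / a ^ 2) - (corrPoly k).eval z

/-- The mixed derivative of `remProfile`. -/
noncomputable def remProfileA₁ (k : ℕ) (a z : ℝ) : ℝ :=
  modeCoef k * ((Dz (oddHerm k) z (root k a) - Dz (oddHerm k) z 0
    - a * deriv (root k) a * Dz (De (oddHerm k)) z (root k a)) / a ^ 2)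
    - (Polynomial.derivative (corrPoly k)).eval z

theorem hasDerivAt_remProfile_left {k : ℕ} {a : ℝ} (ha : a ≠ 0) (h : |root k a| < 1 / 2)
    (hd : DifferentiableAt ℝ (root k) a) (z : ℝ) :
    HasDerivAt (fun a => remProfile k a z) (remProfileA k a z) a := by
  have hG := ((hClass_oddHerm k).hasDerivAt_de z h).comp a hd.hasDerivAt
  refine (((((hG.sub_const (oddHerm k z 0)).div (hasDerivAt_id a) ha).const_mul
    (modeCoef k)).neg.sub_const ((polyP k).eval z)).add
    (((hasDerivAt_id a).const_sub z).mul_const ((corrPoly k).eval z))).congr_deriv ?_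
  simp only [remProfileA, id, Function.comp_apply]
  ring

theorem hasDerivAt_remProfileA {k : ℕ} {a : ℝ} (h : |root k a| < 1 / 2) (z : ℝ) :
    HasDerivAt (remProfileA k a) (remProfileA₁ k a z) z := by
  have h0 : |(0 : ℝ)| < 1 / 2 := by norm_num
  have hG := hClass_oddHerm k
  exact (((((hG.hasDerivAt_dz z h).sub (hG.hasDerivAt_dz z h0)).sub
    ((hG.de.hasDerivAt_dz z h).const_mul (a * deriv (root k) a))).div_const (a ^ 2)).const_mul
    (modeCoef k)).sub ((corrPoly k).hasDerivAt z)

theorem polyBdd_remProfileA (k : ℕ) : PolyBdd (remProfileA k) :=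
  (((hClass_oddHerm k).polyBdd_taylor k).const_mul _).sub (.polynomial _)

/-- The permitted rate 1/b leaves a spare factor a here, so the first difference quotient suffices
in place of a second-order expansion. -/
theorem polyBdd_mul_remProfileA₁ (k : ℕ) : PolyBdd (fun a z => a * remProfileA₁ k a z) := by
  have hG := hClass_oddHerm k
  have h1 := (((hG.dz.polyBdd_sub k).sub ((HClass.polyBdd_deriv_root k).mul
    (hG.de.dz.polyBdd k))).const_mul (modeCoef k)).sub
    (PolyBdd.fst.mul (.polynomial (Polynomial.derivative (corrPoly k))))
  refine h1.congr ?_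
  filter_upwards [eventually_pos_lt_one] with a ha z _
  have := ha.1.ne'
  rw [remProfileA₁]
  field_simp

/-! ### Differentiation in b through a = √b -/

theorem hasDerivAt_sqrt_comp {F : ℝ → ℝ} {F' b : ℝ} (hb : 0 < b) (hF : HasDerivAt F F' (√b)) :
    HasDerivAt (fun b => F (√b)) (F' / (2 * √b)) b := by
  refine (hF.comp b (Real.hasDerivAt_sqrt hb.ne')).congr_deriv ?_
  ring

theorem dB_eq {f : ℝ → ℝ → ℝ} {f' b z : ℝ} (hb : 0 < b) (hz : √b ≤ z)
    (hf : HasDerivAt (fun b => f b z) f' b) :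
    DifferentiableWithinAt ℝ (fun b' => f b' z) (Ioc 0 (z ^ 2)) b ∧ dB f b z = f' := by
  have hz2 : b ≤ z ^ 2 := by
    rw [← Real.sq_sqrt hb.le]
    gcongr
  refine ⟨hf.differentiableAt.differentiableWithinAt, ?_⟩
  exact hf.hasDerivWithinAt.derivWithin (uniqueDiffOn_Ioc 0 (z ^ 2) b ⟨hb, hz2⟩)

theorem hasDerivAt_eigRem {k : ℕ} {b z : ℝ} (hb : 0 < b) (h : |root k (√b)| < 1 / 2)
    (hd : DifferentiableAt ℝ (root k) (√b)) (hz : z ≠ 0) :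
    HasDerivAt (fun b => eigRem k b z) (remProfileA k (√b) z / (2 * √b) / z) b := by
  have h1 := (hasDerivAt_sqrt_comp hb (hasDerivAt_remProfile_left
    (Real.sqrt_pos.2 hb).ne' h hd z)).div_const z
  -- The quotient formula holds for every z ≠ 0, also for parameters beyond z². The derivative in b
  -- is therefore two-sided even at z = √b, and restricts to the one-sided one.
  refine h1.congr_of_eventuallyEq ?_
  filter_upwards [lt_mem_nhds hb] with b' hb'
  exact eigRem_eq hb' hz k

theorem hasDerivAt_eigFun {k : ℕ} {b z : ℝ} (hb : 0 < b) (h : |root k (√b)| < 1 / 2)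
    (hd : DifferentiableAt ℝ (root k) (√b)) :
    HasDerivAt (fun b => eigFun k b z) ((eigProfile k (√b) z / b - modeCoef k * (deriv (root k) (√b) *
      De (oddHerm k) z (root k (√b))) / √b) / (2 * √b) / z) b := by
  have hb' : √b ≠ 0 := (Real.sqrt_pos.2 hb).ne'
  have hG := (((hClass_oddHerm k).hasDerivAt_de z h).comp (√b) hd.hasDerivAt).const_mul (modeCoef k)
  have h1 : HasDerivAt (fun a => -(1 / a) * eigProfile k a z) (eigProfile k (√b) z / √b ^ 2 -
      modeCoef k * (deriv (root k) (√b) * De (oddHerm k) z (root k (√b))) / √b) (√b) := by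
    refine ((((hasDerivAt_id (√b)).inv hb').neg.mul hG).congr_deriv ?_).congr_of_eventuallyEq
      (Eventually.of_forall fun a => ?_)
    · simp only [id, Function.comp_apply, eigProfile, Pi.neg_apply, Pi.inv_apply]
      field_simp
      ring
    · simp [eigProfile]
  rw [Real.sq_sqrt hb.le] at h1
  exact (hasDerivAt_sqrt_comp hb h1).div_const z

theorem eventually_sqrt {p : ℝ → Prop} (h : ∀ᶠ a in 𝓝[>] (0 : ℝ), p a) :
    ∀ᶠ b in 𝓝[>] (0 : ℝ), 0 < b ∧ 0 < √b ∧ √b < 1 ∧ p (√b) := by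
  filter_upwards [self_mem_nhdsWithin, tendsto_sqrt_nhdsGT_zero.eventually h,
    tendsto_sqrt_nhdsGT_zero.eventually eventually_pos_lt_one] with b hb h1 h2
  exact ⟨hb, h2.1, h2.2, h1⟩

theorem one_nonneg_fun (_ : ℝ) : (0 : ℝ) ≤ 1 := zero_le_one

theorem one_div_sqrt_nonneg (b : ℝ) : 0 ≤ 1 / √b := by positivity

theorem oddHerm_contDiff (k n : ℕ) {a : ℝ} (h : |root k a| < 1 / 2) :
    ContDiff ℝ n (eigProfile k a) :=
  contDiff_const.mul ((hClass_oddHerm k).contDiff_left n h)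

theorem ContDiff.div_id_contDiffOn {v : ℝ → ℝ} {n : ℕ} (hv : ContDiff ℝ n v) {a : ℝ} (ha : 0 < a) :
    ContDiffOn ℝ n (fun z => v z / z) (Ici a) :=
  hv.contDiffOn.div contDiffOn_id fun _ hz => (ha.trans_le hz).ne'

theorem polynomial_contDiff (p : Polynomial ℝ) (n : ℕ) : ContDiff ℝ n (fun z => p.eval z) := by
  simpa using p.contDiff_aeval (𝕜 := ℝ) n

theorem eigFun_eq (k : ℕ) (b z : ℝ) : eigFun k b z = -(1 / √b) * eigProfile k (√b) z / z := rfl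

/-- The reduced operator: `H_b (v / z) = (reducedOp v) / z`. -/
noncomputable def reducedOp (g : ℝ → ℝ → ℝ) (z e : ℝ) : ℝ :=
  -Dz (Dz g) z e + z * Dz g z e - g z e

theorem HClass.reducedOp {g : ℝ → ℝ → ℝ} (hg : HClass g) : HClass (reducedOp g) :=
  ((hg.dz.dz.smul (-1)).add (hg.dz.mulz.add (hg.smul (-1)))).congr fun z e _ => by
    rw [_root_.reducedOp]
    ring

theorem reducedOp_oddHerm (k : ℕ) (z : ℝ) {e : ℝ} (he : |e| < 1 / 2) :
    reducedOp (oddHerm k) z e = (2 * k + e) * oddHerm k z e := by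
  rw [reducedOp]
  linarith [oddHerm_ode k z he]

theorem Hop_const_mul_div {b c e : ℝ} {f : ℝ → ℝ} {g : ℝ → ℝ → ℝ} (hb : 0 < b) (hg : HClass g)
    (he : |e| < 1 / 2) (hf : ∀ z, √b ≤ z → f z = c * g z e / z) {z : ℝ} (hz : √b ≤ z) :
    Hop b f z = c * reducedOp g z e / z := by
  rw [Hop_div hb hf (fun z => (hg.hasDerivAt_dz z he).const_mul c)
    (fun z => (hg.dz.hasDerivAt_dz z he).const_mul c) hz, reducedOp]
  ring

theorem Hop_eigFun {k : ℕ} {b z : ℝ} (hb : 0 < b) (h : |root k (√b)| < 1 / 2) (hz : √b ≤ z) :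
    Hop b (eigFun k b) z = eigVal k b * eigFun k b z := by
  rw [Hop_const_mul_div (c := -(1 / √b) * modeCoef k) hb (hClass_oddHerm k) h (fun z _ => ?_) hz,
    reducedOp_oddHerm k z h, eigFun, eigProfile, eigVal]
  · ring
  · rw [eigFun, eigProfile]
    ring

theorem dz_eigFun {k : ℕ} {b z : ℝ} (hb : 0 < b) (h : |root k (√b)| < 1 / 2) (hz : √b ≤ z) :
    RadialStefan.dz b (eigFun k b) z = -(1 / √b) * (modeCoef k * Dz (oddHerm k) z (root k (√b))) / z
      - -(1 / √b) * eigProfile k (√b) z / z ^ 2 :=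
  dz_div hb (fun z _ => eigFun_eq k b z) (fun z => (hasDerivAt_eigProfile h z).const_mul _) hz

theorem polyBdd_eigProfile (k : ℕ) : PolyBdd (eigProfile k) :=
  ((hClass_oddHerm k).polyBdd k).const_mul _

theorem polyBdd_eigProfile₁ (k : ℕ) :
    PolyBdd (fun a z => modeCoef k * Dz (oddHerm k) z (root k a)) :=
  ((hClass_oddHerm k).dz.polyBdd k).const_mul _

theorem memLp_of_eBdd {s : ℝ → ℝ} {f : ℝ → ℝ → ℝ} (h : EBdd s (fun b => wNorm b (f b)))
    (hm : ∀ᶠ b in 𝓝[>] (0 : ℝ), AEStronglyMeasurable (f b) (wMeasure b)) :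
    ∀ᶠ b in 𝓝[>] (0 : ℝ), MemLp (f b) 2 (wMeasure b) := by
  obtain ⟨C, -, H⟩ := h
  filter_upwards [H, hm] with b h1 h2
  exact ⟨h2, h1.trans_lt ENNReal.ofReal_lt_top⟩

theorem eBdd_eigFun (k : ℕ) : EBdd (fun b => 1 / √b) (fun b => wNorm b (eigFun k b)) := by
  refine (polyBdd_eigProfile k).eBdd_wNorm one_div_sqrt_nonneg ?_
  filter_upwards [eventually_sqrt (root_lt k)] with b ⟨hb, hb', _, _⟩ z hz
  rw [eigFun, abs_div, abs_mul, abs_neg, abs_of_pos (by positivity : 0 < 1 / √b),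
    abs_of_pos (hb'.trans_le hz), mul_div_assoc]

/-- A crude rate: only finiteness is needed, for membership in H¹. -/
theorem eBdd_dz_eigFun (k : ℕ) :
    EBdd (fun b => 1 / b) (fun b => wNorm b (RadialStefan.dz b (eigFun k b))) := by
  have hp := (PolyBdd.fst.mul (polyBdd_eigProfile₁ k)).sub (polyBdd_eigProfile k).mul_div
  refine EBdd.mono (A := fun b => wNorm b (RadialStefan.dz b (eigFun k b))) ?_
    (Eventually.of_forall fun b => le_rfl)
  have h := hp.eBdd_wNorm (s := fun b => 1 / √b ^ 2) (fun b => by positivity)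
    (f := fun b => RadialStefan.dz b (eigFun k b)) ?_
  · obtain ⟨C, hC, H⟩ := h
    refine ⟨C, hC, ?_⟩
    filter_upwards [H, self_mem_nhdsWithin] with b h1 hb
    rwa [Real.sq_sqrt (le_of_lt hb)] at h1
  · filter_upwards [eventually_sqrt (root_lt k)] with b ⟨hb, hb', _, h⟩ z hz
    have hz0 : 0 < z := hb'.trans_le hz
    rw [dz_eigFun hb h hz]
    have e : -(1 / √b) * (modeCoef k * Dz (oddHerm k) z (root k (√b))) / z
        - -(1 / √b) * eigProfile k (√b) z / z ^ 2 =
        -(1 / √b ^ 2 * ((√b * (modeCoef k * Dz (oddHerm k) z (root k (√b)))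
          - √b * eigProfile k (√b) z / z) / z)) := by
      field_simp
      ring
    rw [e, abs_neg, abs_mul, abs_of_pos (by positivity : 0 < 1 / √b ^ 2), abs_div _ z,
      abs_of_pos hz0]

theorem aestronglyMeasurable_dz {b : ℝ} {f : ℝ → ℝ} (hf : ContDiffOn ℝ 3 f (Ici (√b))) :
    AEStronglyMeasurable (RadialStefan.dz b f) (wMeasure b) :=
  aestronglyMeasurable_wMeasure
    ((hf.continuousOn_derivWithin (uniqueDiffOn_Ici _) (by norm_num)).mono Ioi_subset_Ici_self)

theorem contDiffOn_eigFun {k : ℕ} {b : ℝ} (hb : 0 < b) (h : |root k (√b)| < 1 / 2) :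
    ContDiffOn ℝ 3 (eigFun k b) (Ici (√b)) :=
  (contDiff_const.mul (oddHerm_contDiff k 3 h)).div_id_contDiffOn (Real.sqrt_pos.2 hb)

theorem memLp_eigFun (k : ℕ) : ∀ᶠ b in 𝓝[>] (0 : ℝ), MemLp (eigFun k b) 2 (wMeasure b) := by
  refine memLp_of_eBdd (eBdd_eigFun k) ?_
  filter_upwards [eventually_sqrt (root_lt k)] with b ⟨hb, _, _, h⟩
  exact aestronglyMeasurable_wMeasure
    ((contDiffOn_eigFun hb h).continuousOn.mono Ioi_subset_Ici_self)

theorem memH1_eigFun (k : ℕ) : ∀ᶠ b in 𝓝[>] (0 : ℝ), MemH1 b (eigFun k b) := by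
  have h1 : ∀ᶠ b in 𝓝[>] (0 : ℝ), MemLp (RadialStefan.dz b (eigFun k b)) 2 (wMeasure b) := by
    refine memLp_of_eBdd (eBdd_dz_eigFun k) ?_
    filter_upwards [eventually_sqrt (root_lt k)] with b ⟨hb, _, _, h⟩
    exact aestronglyMeasurable_dz (contDiffOn_eigFun hb h)
  filter_upwards [eventually_sqrt (root_lt k), eventually_sqrt (oddHerm_root k), memLp_eigFun k, h1]
    with b ⟨hb, _, _, h⟩ ⟨_, _, _, h0⟩ m1 m2
  refine ⟨?_, fun R hR => ?_, m1, m2⟩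
  · rw [eigFun, eigProfile, h0]
    simp
  · refine ContDiffOn.absolutelyContinuousOnInterval ?_
    rw [uIcc_of_le hR]
    exact ((contDiffOn_eigFun hb h).of_le (by norm_num)).mono Icc_subset_Ici_self

theorem eigVal_estimates (k : ℕ) : Ultimately fun C b =>
    |eigVal k b - (2 * k + coefC k ^ 2 * √b)| ≤ C * b ∧ DifferentiableAt ℝ (eigVal k) b ∧
      |deriv (eigVal k) b| ≤ C / √b := by
  obtain ⟨C0, hC0, H⟩ := root_bounds k
  filter_upwards [eventually_ge_atTop C0] with C hC
  filter_upwards [eventually_sqrt H] with b ⟨hb, hb', _, h1, h2, h3, h4, h5⟩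
  have hd : HasDerivAt (eigVal k) (deriv (root k) (√b) / (2 * √b)) b :=
    (hasDerivAt_sqrt_comp hb h1.hasDerivAt).const_add _
  refine ⟨?_, hd.differentiableAt, ?_⟩
  · rw [eigVal, add_sub_add_left_eq_sub]
    rw [Real.sq_sqrt hb.le] at h4
    exact h4.trans (by gcongr)
  · rw [hd.deriv, abs_div, abs_of_pos (by positivity : 0 < 2 * √b)]
    gcongr
    · linarith
    · linarith
    · linarith

theorem muCoef_estimates (j k : ℕ) : Ultimately fun C b =>
    |muCoef j k b - wInner 0 (Q k) (P j) / (2 * ((j : ℝ) - (k : ℝ))) * √b| ≤ C * b ∧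
      DifferentiableAt ℝ (muCoef j k) b ∧ |deriv (muCoef j k) b| ≤ C / √b := by
  filter_upwards [eventually_ge_atTop |muSlope j k|] with C hC
  filter_upwards [self_mem_nhdsWithin] with b hb
  have hb : 0 < b := hb
  have hd : HasDerivAt (muCoef j k) (muSlope j k * (1 / (2 * √b))) b :=
    (Real.hasDerivAt_sqrt hb.ne').const_mul _
  have hC0 : 0 ≤ C := (abs_nonneg _).trans hC
  refine ⟨?_, hd.differentiableAt, ?_⟩
  · rw [muCoef, muSlope, sub_self, abs_zero]
    positivity
  · have hb' : 0 < √b := Real.sqrt_pos.2 hb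
    rw [hd.deriv, abs_mul, abs_of_pos (by positivity : 0 < 1 / (2 * √b)), mul_one_div]
    gcongr
    linarith

theorem contDiff_remProfile {k : ℕ} {a : ℝ} (h : |root k a| < 1 / 2) (n : ℕ) :
    ContDiff ℝ n (remProfile k a) := by
  have h1 := (hClass_oddHerm k).contDiff_left n h
  have h2 := (hClass_oddHerm k).contDiff_left n (e := 0) (by norm_num)
  have h3 := polynomial_contDiff (polyP k) n
  have h4 := polynomial_contDiff (corrPoly k) n
  unfold remProfile
  fun_prop

theorem contDiff_remProfileA {k : ℕ} {a : ℝ} (h : |root k a| < 1 / 2) (n : ℕ) :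
    ContDiff ℝ n (remProfileA k a) := by
  have h1 := (hClass_oddHerm k).contDiff_left n h
  have h2 := (hClass_oddHerm k).contDiff_left n (e := 0) (by norm_num)
  have h3 := (hClass_oddHerm k).de.contDiff_left n h
  have h4 := polynomial_contDiff (corrPoly k) n
  unfold remProfileA
  fun_prop

theorem polyBdd_remProfile (k : ℕ) : PolyBdd (remProfile k) := by
  refine (PolyBdd.snd.mul (polyBdd_remProfile_div k)).congr ?_
  filter_upwards [eventually_pos_lt_one] with a ha z hz
  rw [mul_div_cancel₀ _ (ha.1.trans_le hz).ne']

theorem eBdd_wNorm_one {v : ℝ → ℝ → ℝ} (hv : PolyBdd v) {f : ℝ → ℝ → ℝ}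
    (hf : ∀ᶠ b in 𝓝[>] (0 : ℝ), ∀ z, √b ≤ z → f b z = v (√b) z / z) :
    EBdd (fun _ => 1) (fun b => wNorm b (f b)) := by
  refine hv.eBdd_wNorm one_nonneg_fun ?_
  filter_upwards [hf, eventually_sqrt (eventually_pos_lt_one)] with b h1 ⟨_, hb', _, _⟩ z hz
  rw [h1 z hz, abs_div, abs_of_pos (hb'.trans_le hz), one_mul]

theorem eBdd_eigRem (k : ℕ) : EBdd (fun _ => 1) fun b =>
    wNormH1 b (eigRem k b) + wNorm b (lap b (eigRem k b)) + wNorm b (Lam b (eigRem k b))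
      + wNorm b (fun z => z * eigRem k b z) + wNorm b (fun z => z ^ 2 * eigRem k b z)
      + ENNReal.ofReal (√b * |RadialStefan.dz b (eigRem k b) (√b)|) := by
  have hev := eventually_sqrt (root_lt k)
  have hq : ∀ b, 0 < b → ∀ z, √b ≤ z → eigRem k b z = remProfile k (√b) z / z :=
    fun b hb z hz => eigRem_eq hb ((Real.sqrt_pos.2 hb).trans_le hz).ne' k
  have hX := polyBdd_remProfile k
  have hD := (polyBdd_remProfile₁ k).sub (polyBdd_remProfile_div k)
  have hdz : ∀ b, 0 < b → |root k (√b)| < 1 / 2 → ∀ z, √b ≤ z → RadialStefan.dz b (eigRem k b) z =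
      (remProfile₁ k (√b) z - remProfile k (√b) z / z) / z := fun b hb h z hz => by
    rw [dz_div hb (hq b hb) (hasDerivAt_remProfile h) hz, sub_div, div_div, sq]
  refine EBdd.add one_nonneg_fun (EBdd.add one_nonneg_fun (EBdd.add one_nonneg_fun
    (EBdd.add one_nonneg_fun (EBdd.add one_nonneg_fun ?_ ?_) ?_) ?_) ?_) ?_
  · refine (EBdd.add one_nonneg_fun (eBdd_wNorm_one hD
      (f := fun b => RadialStefan.dz b (eigRem k b)) ?_) (eBdd_wNorm_one hX
        (f := fun b => eigRem k b) ?_)).mono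
      (Eventually.of_forall fun b => wNormH1_le b _)
    · exact hev.mono fun b hb => hdz b hb.1 hb.2.2.2
    · exact hev.mono fun b hb => hq b hb.1
  · refine eBdd_wNorm_one (polyBdd_remProfile₂ k) (hev.mono fun b hb z hz => ?_)
    exact lap_div hb.1 (hq b hb.1) (hasDerivAt_remProfile hb.2.2.2)
      (hasDerivAt_remProfile₁ hb.2.2.2) hz
  · refine eBdd_wNorm_one ((PolyBdd.snd.mul (polyBdd_remProfile₁ k)).sub hX)
      (hev.mono fun b hb z hz => ?_)
    exact Lam_div hb.1 (hq b hb.1) (hasDerivAt_remProfile hb.2.2.2) hz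
  · refine eBdd_wNorm_one (PolyBdd.snd.mul hX) (hev.mono fun b hb z hz => ?_)
    rw [hq b hb.1 z hz, mul_div_assoc]
  · refine eBdd_wNorm_one ((PolyBdd.snd.mul PolyBdd.snd).mul hX) (hev.mono fun b hb z hz => ?_)
    rw [hq b hb.1 z hz]
    ring
  · refine hD.eBdd_diag one_nonneg_fun (hev.mono fun b hb => ?_)
    rw [hdz b hb.1 hb.2.2.2 _ le_rfl, abs_div, abs_of_pos hb.2.1, mul_div_cancel₀ _ hb.2.1.ne',
      one_mul]

theorem dB_eigRem {k : ℕ} {b : ℝ} (hb : 0 < b) (h : |root k (√b)| < 1 / 2)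
    (hd : DifferentiableAt ℝ (root k) (√b)) {z : ℝ} (hz : √b ≤ z) :
    DifferentiableWithinAt ℝ (fun b' => eigRem k b' z) (Ioc 0 (z ^ 2)) b ∧
      dB (eigRem k) b z = (1 / (2 * √b)) * remProfileA k (√b) z / z := by
  have h1 := dB_eq hb hz
    (hasDerivAt_eigRem hb h hd ((Real.sqrt_pos.2 hb).trans_le hz).ne')
  refine ⟨h1.1, h1.2.trans ?_⟩
  ring

theorem eBdd_dB_eigRem (k : ℕ) : EBdd (fun b => 1 / b) fun b =>
    wNorm b (RadialStefan.dz b (dB (eigRem k) b)) + wNorm b (dB (eigRem k) b)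
      + ENNReal.ofReal (√b * |RadialStefan.dz b (dB (eigRem k) b) (√b)|) := by
  have hev := (eventually_sqrt (root_lt k)).and (eventually_sqrt (differentiableAt_root k))
  have hY := polyBdd_remProfileA k
  have hD := (polyBdd_mul_remProfileA₁ k).sub hY.mul_div
  have hs : ∀ b : ℝ, 0 ≤ 1 / √b ^ 2 := fun b => by positivity
  have hdz : ∀ b, 0 < b → |root k (√b)| < 1 / 2 → DifferentiableAt ℝ (root k) (√b) → ∀ z, √b ≤ z →
      RadialStefan.dz b (dB (eigRem k) b) z = (1 / √b ^ 2) * ((1 / 2) *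
        ((√b * remProfileA₁ k (√b) z - √b * remProfileA k (√b) z / z) / z)) := fun b hb h hd z hz => by
    have hb' : √b ≠ 0 := (Real.sqrt_pos.2 hb).ne'
    have hz' : z ≠ 0 := ((Real.sqrt_pos.2 hb).trans_le hz).ne'
    rw [dz_div hb (fun z hz => (dB_eigRem hb h hd hz).2)
      (fun z => (hasDerivAt_remProfileA h z).const_mul _) hz]
    field_simp
  have key : EBdd (fun b => 1 / √b ^ 2) fun b =>
      wNorm b (RadialStefan.dz b (dB (eigRem k) b)) + wNorm b (dB (eigRem k) b)
      + ENNReal.ofReal (√b * |RadialStefan.dz b (dB (eigRem k) b) (√b)|) := by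
    refine EBdd.add hs (EBdd.add hs ?_ ?_) ?_
    · refine hD.eBdd_wNorm hs (hev.mono fun b ⟨hb, hd⟩ z hz => ?_)
      rw [hdz b hb.1 hb.2.2.2 hd.2.2.2 z hz, abs_mul, abs_mul, abs_div _ z,
        abs_of_pos (hb.2.1.trans_le hz), abs_of_nonneg (hs b), abs_of_pos (by norm_num : (0 : ℝ) < 1 / 2)]
      refine mul_le_mul_of_nonneg_left ?_ (hs b)
      have : 0 < z := hb.2.1.trans_le hz
      have h2 : 0 ≤ |√b * remProfileA₁ k (√b) z - √b * remProfileA k (√b) z / z| / z := by positivity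
      linarith
    · refine hY.eBdd_wNorm hs (hev.mono fun b ⟨hb, hd⟩ z hz => ?_)
      have hz0 : 0 < z := hb.2.1.trans_le hz
      have hb' := hb.2.1
      rw [(dB_eigRem hb.1 hb.2.2.2 hd.2.2.2 hz).2, abs_div, abs_mul, abs_of_pos hz0,
        abs_of_pos (by positivity : 0 < 1 / (2 * √b)), mul_div_assoc]
      gcongr
      nlinarith [hb.2.2.1]
    · refine hD.eBdd_diag hs (hev.mono fun b ⟨hb, hd⟩ => ?_)
      have hb' := hb.2.1
      rw [hdz b hb.1 hb.2.2.2 hd.2.2.2 _ le_rfl, abs_mul, abs_mul, abs_div _ (√b),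
        abs_of_pos hb', abs_of_nonneg (hs b), abs_of_pos (by norm_num : (0 : ℝ) < 1 / 2)]
      set A := |√b * remProfileA₁ k (√b) (√b) - √b * remProfileA k (√b) (√b) / √b|
      have hA : 0 ≤ A := abs_nonneg _
      have : √b * (1 / √b ^ 2 * (1 / 2 * (A / √b))) = 1 / √b ^ 2 * (1 / 2 * A) := by
        field_simp
      rw [this]
      exact mul_le_mul_of_nonneg_left (by linarith) (hs b)
  obtain ⟨C, hC, H⟩ := key
  refine ⟨C, hC, ?_⟩
  filter_upwards [H, self_mem_nhdsWithin] with b h1 hb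
  rwa [Real.sq_sqrt (le_of_lt hb)] at h1

theorem contDiffOn_eigRem {k : ℕ} {b : ℝ} (hb : 0 < b) (h : |root k (√b)| < 1 / 2) :
    ContDiffOn ℝ 3 (eigRem k b) (Ici (√b)) :=
  ((contDiff_remProfile h 3).div_id_contDiffOn (Real.sqrt_pos.2 hb)).congr fun _ hz =>
    eigRem_eq hb ((Real.sqrt_pos.2 hb).trans_le hz).ne' k

theorem contDiffOn_dB_eigRem {k : ℕ} {b : ℝ} (hb : 0 < b) (h : |root k (√b)| < 1 / 2)
    (hd : DifferentiableAt ℝ (root k) (√b)) : ContDiffOn ℝ 2 (dB (eigRem k) b) (Ici (√b)) :=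
  ((contDiff_const.mul (contDiff_remProfileA h 2)).div_id_contDiffOn (Real.sqrt_pos.2 hb)).congr
    fun _ hz => (dB_eigRem hb h hd hz).2

/-! ### Inner products -/

/-- The difference quotient of `eigProfile` in `a`. -/
noncomputable def profileDiff (k : ℕ) (a z : ℝ) : ℝ :=
  modeCoef k * ((oddHerm k z (root k a) - oddHerm k z 0) / a)

theorem polyBdd_profileDiff (k : ℕ) : PolyBdd (profileDiff k) :=
  ((hClass_oddHerm k).polyBdd_sub k).const_mul _

theorem eigProfile_eq (k : ℕ) {a : ℝ} (ha : a ≠ 0) (z : ℝ) :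
    eigProfile k a z = z * (polyP k).eval z + a * profileDiff k a z := by
  rw [mul_eval_polyP_eq_oddHerm, eigProfile, profileDiff]
  field_simp
  ring

/-- The defect from orthonormality is the integral over (0, √b] of a bounded function. -/
theorem integral_polyP_near (k i : ℕ) : ∃ C : ℝ, 0 ≤ C ∧ ∀ᶠ b in 𝓝[>] (0 : ℝ),
    |∫ z, (polyP k).eval z * (polyP i).eval z ∂(wMeasure b) - if k = i then 1 else 0| ≤ C * √b := by
  set h : ℝ → ℝ := fun z => (polyP k).eval z * (polyP i).eval z * (Real.exp (-z ^ 2 / 2) * z ^ 2)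
    with hh
  have hc : Continuous h := by
    have h1 := (polyP k).continuous
    have h2 := (polyP i).continuous
    simp only [hh]
    fun_prop
  obtain ⟨C, hC⟩ := (isCompact_Icc (a := (0 : ℝ)) (b := 1)).exists_bound_of_continuousOn
    hc.continuousOn
  have hC0 : 0 ≤ C := (norm_nonneg _).trans (hC 0 (by simp))
  refine ⟨C, hC0, ?_⟩
  have hint : IntegrableOn h (Ioi 0) := by
    have := (integrable_wMeasure_iff 0 _).1
      (integrable_mul_of_memLp (memLp_polynomial 0 (polyP k)) (memLp_polynomial 0 (polyP i)))
    rwa [Real.sqrt_zero] at this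
  filter_upwards [eventually_sqrt eventually_pos_lt_one] with b ⟨hb, hb', hb1, _⟩
  have hsplit : ∫ z in Ioi (0 : ℝ), h z = (∫ z in Ioc 0 (√b), h z) + ∫ z in Ioi (√b), h z := by
    rw [← setIntegral_union (Ioc_disjoint_Ioi le_rfl) measurableSet_Ioi
      (hint.mono_set Ioc_subset_Ioi_self) (hint.mono_set (Ioi_subset_Ioi hb'.le)),
      Ioc_union_Ioi_eq_Ioi hb'.le]
  rw [integral_wMeasure, ← integral_polyP_mul k i, hsplit, sub_add_cancel_right, abs_neg,
    ← intervalIntegral.integral_of_le hb'.le]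
  have := intervalIntegral.norm_integral_le_of_norm_le_const (f := h) (a := 0) (b := √b) (C := C)
    (fun z hz => by
      rw [uIoc_of_le hb'.le] at hz
      exact hC z ⟨hz.1.le, hz.2.trans hb1.le⟩)
  rwa [sub_zero, abs_of_pos hb'] at this

/-- The profile is z P_k + √b times a bounded difference quotient. The product of the leading parts
gives the Gram matrix of the modes over b, and all other terms carry a factor √b. -/
theorem wInner_eigFun_near (k i : ℕ) : ∃ C : ℝ, 0 ≤ C ∧ ∀ᶠ b in 𝓝[>] (0 : ℝ),
    |wInner b (eigFun k b) (eigFun i b) - 1 / b * (if i = k then 1 else 0)| ≤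
      1 / b * (C * √b) := by
  have hU : PolyBdd (fun a z => profileDiff k a z * eigProfile i a z
      + z * (polyP k).eval z * profileDiff i a z) :=
    ((polyBdd_profileDiff k).mul (polyBdd_eigProfile i)).add
      ((PolyBdd.snd.mul (.polynomial _)).mul (polyBdd_profileDiff i))
  obtain ⟨C, hC, H⟩ := hU.integral_bound
  obtain ⟨C', hC', H'⟩ := integral_polyP_near k i
  refine ⟨C + C', by positivity, ?_⟩
  filter_upwards [H, H', memLp_eigFun k, memLp_eigFun i, eventually_sqrt eventually_pos_lt_one]
    with b h1 h2 m1 m2 ⟨hb, hb', _, _⟩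
  have hsq : √b ^ 2 = b := Real.sq_sqrt hb.le
  have hpt : wInner b (eigFun k b) (eigFun i b) -
      1 / b * ∫ z, (polyP k).eval z * (polyP i).eval z ∂(wMeasure b) =
      1 / √b * ∫ z, (profileDiff k (√b) z * eigProfile i (√b) z
      + z * (polyP k).eval z * profileDiff i (√b) z) / z ^ 2 ∂(wMeasure b) := by
    rw [wInner, ← integral_const_mul, ← integral_const_mul, ← integral_sub
      (integrable_mul_of_memLp m1 m2) ((integrable_mul_of_memLp (memLp_polynomial b _)
        (memLp_polynomial b _)).const_mul _)]
    refine integral_congr_ae ?_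
    filter_upwards [ae_wMeasure b] with z hz
    have hz0 : z ≠ 0 := (hb'.trans hz).ne'
    rw [eigFun, eigFun, eigProfile_eq k hb'.ne', eigProfile_eq i hb'.ne']
    conv_lhs => rw [← hsq, Real.sqrt_sq hb'.le]
    field_simp
    ring
  set I := ∫ z, (polyP k).eval z * (polyP i).eval z ∂(wMeasure b)
  set U := ∫ z, (profileDiff k (√b) z * eigProfile i (√b) z
      + z * (polyP k).eval z * profileDiff i (√b) z) / z ^ 2 ∂(wMeasure b)
  have hδ : (if i = k then (1 : ℝ) else 0) = if k = i then 1 else 0 := by simp only [eq_comm]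
  rw [hδ]
  set δ : ℝ := if k = i then 1 else 0
  have e1 : wInner b (eigFun k b) (eigFun i b) - 1 / b * δ =
      1 / √b * U + 1 / b * (I - δ) := by linarith
  have e2 : 1 / √b = 1 / b * √b := by
    conv_rhs => rw [← hsq, Real.sqrt_sq hb'.le]
    field_simp
  rw [e1, e2]
  have hb0 : 0 < 1 / b := by positivity
  calc |1 / b * √b * U + 1 / b * (I - δ)| ≤ |1 / b * √b * U| + |1 / b * (I - δ)| := abs_add_le _ _
    _ = 1 / b * √b * |U| + 1 / b * |I - δ| := by
        rw [abs_mul, abs_mul (1 / b) (I - δ), abs_of_pos hb0, abs_of_pos (by positivity)]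
    _ ≤ 1 / b * √b * C + 1 / b * (C' * √b) := by gcongr
    _ = _ := by ring

/-- The derivative of `√b ψ_b` in `b`, suitably normalised. -/
theorem two_mul_dB_eigFun_add {k : ℕ} {b : ℝ} (hb : 0 < b) (h : |root k (√b)| < 1 / 2)
    (hd : DifferentiableAt ℝ (root k) (√b)) {z : ℝ} (hz : √b ≤ z) :
    2 * b * dB (eigFun k) b z + eigFun k b z =
      -(modeCoef k * deriv (root k) (√b)) * De (oddHerm k) z (root k (√b)) / z := by
  have hb' := Real.sqrt_pos.2 hb
  have hz' : z ≠ 0 := (hb'.trans_le hz).ne'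
  rw [(dB_eq hb hz (hasDerivAt_eigFun hb h hd)).2, eigFun]
  have hsq : √b ^ 2 = b := Real.sq_sqrt hb.le
  generalize √b = a at *
  subst hsq
  field_simp
  ring

theorem polyBdd_dB_profile (k : ℕ) {g : ℝ → ℝ → ℝ} (hg : HClass g) : PolyBdd (fun a z =>
    -(modeCoef k * deriv (root k) a) * g z (root k a)) :=
  (((HClass.polyBdd_deriv_root k).const_mul _).neg).mul (hg.polyBdd k)

theorem eBdd_two_mul_dB_eigFun_add (k : ℕ) : EBdd (fun _ => 1) fun b =>
    wNorm b (fun z => 2 * b * dB (eigFun k) b z + eigFun k b z)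
      + wNorm b (Hop b (fun z => 2 * b * dB (eigFun k) b z + eigFun k b z)) := by
  have hev := (eventually_sqrt (root_lt k)).and (eventually_sqrt (differentiableAt_root k))
  have hG := (hClass_oddHerm k).de
  refine EBdd.add one_nonneg_fun ?_ ?_
  · exact eBdd_wNorm_one (polyBdd_dB_profile k hG) (hev.mono fun b ⟨hb, hd⟩ z hz =>
      two_mul_dB_eigFun_add hb.1 hb.2.2.2 hd.2.2.2 hz)
  · exact eBdd_wNorm_one (polyBdd_dB_profile k hG.reducedOp) (hev.mono fun b ⟨hb, hd⟩ z hz =>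
      Hop_const_mul_div hb.1 hG hb.2.2.2
        (fun z hz => two_mul_dB_eigFun_add hb.1 hb.2.2.2 hd.2.2.2 hz) hz)

theorem memLp_two_mul_dB_eigFun_add (k : ℕ) : ∀ᶠ b in 𝓝[>] (0 : ℝ),
    MemLp (fun z => 2 * b * dB (eigFun k) b z + eigFun k b z) 2 (wMeasure b) := by
  have hev := (eventually_sqrt (root_lt k)).and (eventually_sqrt (differentiableAt_root k))
  have hG := (hClass_oddHerm k).de
  refine memLp_of_eBdd (eBdd_wNorm_one (polyBdd_dB_profile k hG) (hev.mono fun b ⟨hb, hd⟩ z hz =>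
    two_mul_dB_eigFun_add hb.1 hb.2.2.2 hd.2.2.2 hz)) ?_
  filter_upwards [hev] with b ⟨hb, hd⟩
  refine aestronglyMeasurable_wMeasure (ContinuousOn.congr ?_ fun z hz =>
    two_mul_dB_eigFun_add hb.1 hb.2.2.2 hd.2.2.2 (le_of_lt hz))
  have h1 : ContDiff ℝ 1 (fun z => De (oddHerm k) z (root k (√b))) :=
    hG.contDiff_left 1 hb.2.2.2
  exact ((contDiff_const.mul h1).div_id_contDiffOn (n := 1) hb.2.1).continuousOn.mono
    Ioi_subset_Ici_self

/-- Write b ∂_b ψ_k = (S - ψ_k)/2 with S = 2b ∂_b ψ_k + ψ_k. The second part gives -1/2 times the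
Gram matrix; S is O(1), so its pairing with ψ_i is O(1/√b), which is an error term. -/
theorem wInner_dB_eigFun_near (k i : ℕ) : ∃ C : ℝ, 0 ≤ C ∧ ∀ᶠ b in 𝓝[>] (0 : ℝ),
    |wInner b (fun z => b * dB (eigFun k) b z) (eigFun i b)
      - -(1 / (2 * b)) * (if i = k then 1 else 0)| ≤ 1 / (2 * b) * (C * √b) := by
  obtain ⟨C, hC, H⟩ := wInner_eigFun_near k i
  have hU := (polyBdd_dB_profile k (hClass_oddHerm k).de).mul (polyBdd_eigProfile i)
  obtain ⟨C', hC', H'⟩ := hU.integral_bound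
  refine ⟨C + C', by positivity, ?_⟩
  filter_upwards [H, H', memLp_eigFun k, memLp_eigFun i, memLp_two_mul_dB_eigFun_add k,
    eventually_sqrt (root_lt k), eventually_sqrt (differentiableAt_root k)]
    with b h1 h2 m1 m2 m3 ⟨hb, hb', _, h⟩ ⟨_, _, _, hd⟩
  have hsq : √b ^ 2 = b := Real.sq_sqrt hb.le
  set S : ℝ → ℝ := fun z => 2 * b * dB (eigFun k) b z + eigFun k b z with hS
  have e1 : wInner b (fun z => b * dB (eigFun k) b z) (eigFun i b) =
      1 / 2 * ∫ z, S z * eigFun i b z ∂(wMeasure b)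
        - 1 / 2 * wInner b (eigFun k b) (eigFun i b) := by
    rw [wInner, wInner, ← integral_const_mul, ← integral_const_mul, ← integral_sub
      ((integrable_mul_of_memLp m3 m2).const_mul _) ((integrable_mul_of_memLp m1 m2).const_mul _)]
    congr 1
    funext z
    simp only [hS]
    ring
  have e2 : ∫ z, S z * eigFun i b z ∂(wMeasure b) = -(1 / √b) *
      ∫ z, -(modeCoef k * deriv (root k) (√b)) * De (oddHerm k) z (root k (√b)) *
        eigProfile i (√b) z / z ^ 2 ∂(wMeasure b) := by
    rw [← integral_const_mul]
    refine integral_congr_ae ?_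
    filter_upwards [ae_wMeasure b] with z hz
    have hz0 : z ≠ 0 := (hb'.trans hz).ne'
    simp only [hS]
    rw [two_mul_dB_eigFun_add hb h hd hz.le, eigFun]
    field_simp
  set U := ∫ z, -(modeCoef k * deriv (root k) (√b)) * De (oddHerm k) z (root k (√b)) *
        eigProfile i (√b) z / z ^ 2 ∂(wMeasure b)
  set δ : ℝ := if i = k then 1 else 0
  have e3 : 1 / √b = 1 / b * √b := by
    conv_rhs => rw [← hsq, Real.sqrt_sq hb'.le]
    field_simp
  have hb0 : 0 < 1 / b := by positivity
  have e4 : wInner b (fun z => b * dB (eigFun k) b z) (eigFun i b) - -(1 / (2 * b)) * δ =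
      -(1 / 2 * (1 / b * √b * U)) - 1 / 2 * (wInner b (eigFun k b) (eigFun i b) - 1 / b * δ) := by
    rw [e1, e2, e3]
    field_simp
    ring
  rw [e4]
  calc |-(1 / 2 * (1 / b * √b * U)) - 1 / 2 * (wInner b (eigFun k b) (eigFun i b) - 1 / b * δ)|
      ≤ |-(1 / 2 * (1 / b * √b * U))|
        + |1 / 2 * (wInner b (eigFun k b) (eigFun i b) - 1 / b * δ)| := abs_sub _ _
    _ = 1 / 2 * (1 / b * √b * |U|)
        + 1 / 2 * |wInner b (eigFun k b) (eigFun i b) - 1 / b * δ| := by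
        rw [abs_neg, abs_mul, abs_mul (1 / b * √b), abs_mul (1 / 2),
          abs_of_pos (by norm_num : (0 : ℝ) < 1 / 2), abs_of_pos (by positivity : 0 < 1 / b * √b)]
    _ ≤ 1 / 2 * (1 / b * √b * C') + 1 / 2 * (1 / b * (C * √b)) := by gcongr
    _ = _ := by
        field_simp
        ring

theorem exists_eigFun_ne_zero (k : ℕ) :
    ∀ᶠ b in 𝓝[>] (0 : ℝ), ∃ z, √b < z ∧ eigFun k b z ≠ 0 := by
  obtain ⟨C, hC, H⟩ := wInner_eigFun_near k k
  have hlt : ∀ᶠ a in 𝓝[>] (0 : ℝ), C * a < 1 := by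
    have : Tendsto (fun a : ℝ => C * a) (𝓝 0) (𝓝 (C * 0)) := tendsto_id.const_mul C
    rw [mul_zero] at this
    exact nhdsWithin_le_nhds (this.eventually (gt_mem_nhds one_pos))
  filter_upwards [H, eventually_sqrt hlt] with b h1 ⟨hb, hb', _, h2⟩
  by_contra! hcon
  have h0 : wInner b (eigFun k b) (eigFun k b) = 0 := by
    rw [wInner, ← integral_zero ℝ ℝ (μ := wMeasure b)]
    refine integral_congr_ae ?_
    filter_upwards [ae_wMeasure b] with z hz
    rw [hcon z hz, mul_zero]
  have hb0 : 0 < 1 / b := by positivity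
  rw [h0, if_pos rfl, mul_one, zero_sub, abs_neg, abs_of_pos hb0] at h1
  nlinarith

/-! ### The spectral gap -/

theorem toReal_wNorm_sq {b : ℝ} {u : ℝ → ℝ} (hu : MemLp u 2 (wMeasure b)) :
    (wNorm b u).toReal ^ 2 = ∫ z, u z ^ 2 ∂(wMeasure b) := by
  rw [wNorm, hu.eLpNorm_eq_integral_rpow_norm (by norm_num) (by norm_num)]
  have h0 : 0 ≤ ∫ z, u z ^ 2 ∂(wMeasure b) := integral_nonneg fun z => sq_nonneg _
  simp only [ENNReal.toReal_ofNat, Real.rpow_two, Real.norm_eq_abs, sq_abs]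
  rw [ENNReal.toReal_ofReal (by positivity), ← Real.rpow_natCast, ← Real.rpow_mul h0]
  norm_num

theorem sq_integral_mul_le {μ : Measure ℝ} {f g : ℝ → ℝ} (hf : MemLp f 2 μ) (hg : MemLp g 2 μ) :
    (∫ z, f z * g z ∂μ) ^ 2 ≤ (∫ z, f z ^ 2 ∂μ) * ∫ z, g z ^ 2 ∂μ := by
  have hinner : ∀ (f g : ℝ → ℝ) (hf : MemLp f 2 μ) (hg : MemLp g 2 μ),
      inner ℝ (hf.toLp f) (hg.toLp g) = ∫ z, f z * g z ∂μ := by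
    intro f g hf hg
    rw [L2.inner_def]
    refine integral_congr_ae ?_
    filter_upwards [hf.coeFn_toLp, hg.coeFn_toLp] with z h1 h2
    rw [h1, h2]
    simp [mul_comm]
  have := real_inner_mul_inner_self_le (hf.toLp f) (hg.toLp g)
  rw [hinner, hinner, hinner] at this
  simpa only [sq] using this

/-- Orthogonality allows P_j to be replaced by f = P_j + √b ψ_j, in which the leading parts cancel:
f = -√b times a bounded profile over z. Cauchy–Schwarz then gives the factor b. -/
theorem integral_mul_polyP_le (j : ℕ) : ∃ C : ℝ, 0 ≤ C ∧ ∀ᶠ b in 𝓝[>] (0 : ℝ), ∀ u : ℝ → ℝ,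
    MemLp u 2 (wMeasure b) → wInner b u (eigFun j b) = 0 →
    (∫ z, u z * (polyP j).eval z ∂(wMeasure b)) ^ 2 ≤ C * b * ∫ z, u z ^ 2 ∂(wMeasure b) := by
  obtain ⟨C, hC, H⟩ := ((polyBdd_profileDiff j).mul (polyBdd_profileDiff j)).integral_bound
  refine ⟨C, hC, ?_⟩
  filter_upwards [H, memLp_eigFun j, eventually_sqrt eventually_pos_lt_one]
    with b h1 m1 ⟨hb, hb', _, _⟩ u hu hu0
  have hsq : √b ^ 2 = b := Real.sq_sqrt hb.le
  set f : ℝ → ℝ := fun z => (polyP j).eval z + √b * eigFun j b z with hf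
  have hfm : MemLp f 2 (wMeasure b) := (memLp_polynomial b _).add (m1.const_mul _)
  have hfz : ∀ᵐ z ∂(wMeasure b), f z ^ 2 =
      b * (profileDiff j (√b) z * profileDiff j (√b) z / z ^ 2) := by
    filter_upwards [ae_wMeasure b] with z hz
    have hz0 : z ≠ 0 := (hb'.trans hz).ne'
    simp only [hf]
    rw [eigFun, eigProfile_eq j hb'.ne']
    conv_rhs => rw [← hsq]
    field_simp
    rw [Real.sqrt_sq hb'.le]
    ring
  have e1 : ∫ z, u z * (polyP j).eval z ∂(wMeasure b) = ∫ z, u z * f z ∂(wMeasure b) := by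
    have : (fun z => u z * f z) = fun z => u z * (polyP j).eval z
        + √b * (u z * eigFun j b z) := by
      funext z
      simp only [hf]
      ring
    rw [this, integral_add (integrable_mul_of_memLp hu (memLp_polynomial b _))
      ((integrable_mul_of_memLp hu m1).const_mul _), integral_const_mul]
    rw [wInner] at hu0
    rw [hu0, mul_zero, add_zero]
  have e2 : ∫ z, f z ^ 2 ∂(wMeasure b) ≤ C * b := by
    rw [integral_congr_ae hfz, integral_const_mul, mul_comm]
    exact mul_le_mul_of_nonneg_right ((le_abs_self _).trans h1) hb.le
  rw [e1]
  refine (sq_integral_mul_le hu hfm).trans ?_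
  rw [mul_comm]
  exact mul_le_mul_of_nonneg_right e2 (integral_nonneg fun z => sq_nonneg _)

theorem spectral_gap (k : ℕ) : Ultimately fun C b => ∀ u : ℝ → ℝ, MemH1 b u →
    (∀ j, j ≤ k → wInner b u (eigFun j b) = 0) →
    (2 * k + 2 - C * √b) * (wNorm b u).toReal ^ 2 ≤
      (wNorm b (RadialStefan.dz b u)).toReal ^ 2 := by
  choose C hC H using integral_mul_polyP_le
  have hall : ∀ᶠ b in 𝓝[>] (0 : ℝ), ∀ j ∈ Finset.range (k + 1), ∀ u : ℝ → ℝ,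
      MemLp u 2 (wMeasure b) → wInner b u (eigFun j b) = 0 →
      (∫ z, u z * (polyP j).eval z ∂(wMeasure b)) ^ 2 ≤
        C j * b * ∫ z, u z ^ 2 ∂(wMeasure b) := by
    rw [Filter.eventually_all_finset]
    exact fun j _ => H j
  filter_upwards [eventually_ge_atTop ((2 * k + 2) * ∑ j ∈ Finset.range (k + 1), C j)] with C' hC'
  filter_upwards [hall, eventually_sqrt eventually_pos_lt_one] with b h1 ⟨hb, hb', hb1, _⟩ u hu hu0
  rw [toReal_wNorm_sq hu.memLp, toReal_wNorm_sq hu.memLp_deriv]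
  refine le_trans ?_ (spectral_gap_zero hu k)
  set I := ∫ z, u z ^ 2 ∂(wMeasure b)
  have hI : 0 ≤ I := integral_nonneg fun z => sq_nonneg _
  have h2 : ∑ j ∈ Finset.range (k + 1), (∫ z, u z * (polyP j).eval z ∂(wMeasure b)) ^ 2 ≤
      (∑ j ∈ Finset.range (k + 1), C j) * (b * I) := by
    rw [Finset.sum_mul]
    refine Finset.sum_le_sum fun j hj => (h1 j hj u hu.memLp
      (hu0 j (Nat.lt_succ_iff.1 (Finset.mem_range.1 hj)))).trans (le_of_eq (by ring))
  have hS : 0 ≤ ∑ j ∈ Finset.range (k + 1), C j := Finset.sum_nonneg fun j _ => hC j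
  -- The argument gives a loss of order b, weakened here to the stated √b.
  have hbs : b ≤ √b := by
    nlinarith [Real.sq_sqrt hb.le]
  have hk : (0 : ℝ) ≤ 2 * k + 2 := by positivity
  set S := ∑ j ∈ Finset.range (k + 1), C j
  have hC'0 : 0 ≤ C' := (mul_nonneg hk hS).trans hC'
  have h3 : (2 * k + 2) * (S * (b * I)) ≤ C' * √b * I := by
    calc (2 * k + 2) * (S * (b * I)) = ((2 * k + 2) * S) * (b * I) := by ring
      _ ≤ C' * (√b * I) := by gcongr
      _ = _ := by ring
  nlinarith [mul_le_mul_of_nonneg_left h2 hk]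

/-! ### The commutator with `Λ` and the remaining estimates -/

theorem eBdd_Lam_eigFun (k : ℕ) :
    EBdd (fun b => 1 / √b) (fun b => wNorm b (Lam b (eigFun k b))) := by
  refine ((PolyBdd.snd.mul (polyBdd_eigProfile₁ k)).sub
    (polyBdd_eigProfile k)).eBdd_wNorm one_div_sqrt_nonneg ?_
  filter_upwards [eventually_sqrt (root_lt k)] with b ⟨hb, hb', _, h⟩ z hz
  have hz0 : 0 < z := hb'.trans_le hz
  rw [Lam_div hb (fun z _ => eigFun_eq k b z) (fun z => (hasDerivAt_eigProfile h z).const_mul _) hz]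
  have e : z * (-(1 / √b) * (modeCoef k * Dz (oddHerm k) z (root k (√b)))) -
      -(1 / √b) * eigProfile k (√b) z = -(1 / √b *
        (z * (modeCoef k * Dz (oddHerm k) z (root k (√b))) - eigProfile k (√b) z)) := by ring
  rw [e, abs_div, abs_neg, abs_mul, abs_of_pos (by positivity : 0 < 1 / √b), abs_of_pos hz0,
    mul_div_assoc]

theorem eBdd_pow_mul_eigFun (k n : ℕ) :
    EBdd (fun b => 1 / √b) (fun b => wNorm b (fun z => z ^ n * eigFun k b z)) := by
  have hv : PolyBdd (fun a z => z ^ n * eigProfile k a z) := by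
    have := PolyBdd.polynomial (Polynomial.X ^ n)
    simp only [Polynomial.eval_pow, Polynomial.eval_X] at this
    exact this.mul (polyBdd_eigProfile k)
  refine hv.eBdd_wNorm one_div_sqrt_nonneg ?_
  filter_upwards [eventually_sqrt (root_lt k)] with b ⟨hb, hb', _, h⟩ z hz
  have hz0 : 0 < z := hb'.trans_le hz
  have e : z ^ n * eigFun k b z = -(1 / √b * (z ^ n * eigProfile k (√b) z / z)) := by
    rw [eigFun]
    ring
  rw [e, abs_neg, abs_mul, abs_div _ z, abs_of_pos (by positivity : 0 < 1 / √b), abs_of_pos hz0]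

/-- The coefficient of `ψ_{k-1}` in `LamRem`. -/
noncomputable def lamCoef (k : ℕ) : ℝ :=
  2 * k * ((2 * k + 1) / (2 * k) * (coefA (k - 1) / coefA k))

/-- The part of `LamRem` coming from `ψ_k`. -/
noncomputable def lamProfile (k : ℕ) (z e : ℝ) : ℝ :=
  modeCoef k * (z * Dz (oddHerm k) z e - (2 * k + 1) * oddHerm k z e)

theorem hClass_lamProfile (k : ℕ) : HClass (lamProfile k) :=
  (((hClass_oddHerm k).dz.mulz.add ((hClass_oddHerm k).smul (-(2 * k + 1)))).smul
    (modeCoef k)).congr fun z e _ => by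
      rw [lamProfile]
      ring

theorem Dz_oddHerm_zero_right (k : ℕ) (z : ℝ) :
    Dz (oddHerm k) z 0 = (2 * k + 1) * (hermR (2 * k)).eval z := by
  have h : (fun z => oddHerm k z 0) = fun z => (hermR (2 * k + 1)).eval z := by
    funext z
    rw [oddHerm_zero_right, eval_hermR]
  rw [Dz, h, Polynomial.deriv, derivative_hermR_succ, Polynomial.eval_C_mul]
  push_cast
  ring

/-- The ladder relation for the Laguerre modes. -/
theorem lamProfile_add_zero (k : ℕ) (z : ℝ) :
    lamProfile k z 0 + lamCoef k * modeCoef (k - 1) * oddHerm (k - 1) z 0 = 0 := by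
  rw [lamProfile, Dz_oddHerm_zero_right, oddHerm_zero_right, oddHerm_zero_right, ← eval_hermR,
    ← eval_hermR]
  -- For k = 0 the index k - 1 truncates to 0, harmlessly, since `lamCoef 0` = 0. For k+1 the
  -- identity is the three-term recurrence of the Hermite polynomials.
  rcases k with _ | k
  · simp [lamCoef, hermR_succ, hermR_zero]
  · have h1 := congrArg (Polynomial.eval z) (X_mul_hermR_succ (2 * k + 1))
    simp only [Polynomial.eval_mul, Polynomial.eval_X, Polynomial.eval_add, Polynomial.eval_C] at h1
    have hA := (coefA_pos (k + 1)).ne'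
    have hA' := (coefA_pos k).ne'
    have hk : (k : ℝ) + 1 ≠ 0 := by positivity
    have hf : (k.factorial : ℝ) ≠ 0 := by positivity
    have h2 : lamCoef (k + 1) * modeCoef k = -(modeCoef (k + 1) * ((2 * k + 3) * (2 * k + 2))) := by
      rw [lamCoef, modeCoef, modeCoef, Nat.add_sub_cancel, Nat.factorial_succ]
      push_cast
      field_simp
      ring
    rw [Nat.add_sub_cancel, h2, show 2 * (k + 1) + 1 = 2 * k + 1 + 2 by ring,
      show 2 * (k + 1) = 2 * k + 1 + 1 by ring]
    push_cast at h1 ⊢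
    linear_combination modeCoef (k + 1) * (2 * k + 3) * h1

theorem LamRem_eq {k : ℕ} {b z : ℝ} (hb : 0 < b) (h : |root k (√b)| < 1 / 2) (hz : √b ≤ z) :
    LamRem eigFun k b z = -(1 / √b) * (lamProfile k z (root k (√b))
      + lamCoef k * modeCoef (k - 1) * oddHerm (k - 1) z (root (k - 1) (√b))) / z := by
  rw [LamRem, Lam_div hb (fun z _ => eigFun_eq k b z)
    (fun z => (hasDerivAt_eigProfile h z).const_mul _) hz, eigFun, eigFun, lamProfile, lamCoef,
    eigProfile, eigProfile]
  have hz' : z ≠ 0 := ((Real.sqrt_pos.2 hb).trans_le hz).ne'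
  generalize (2 * (k : ℝ) + 1) / (2 * k) * (coefA (k - 1) / coefA k) = c
  have hb' := (Real.sqrt_pos.2 hb).ne'
  field_simp
  ring

/-- Two branches enter with different roots, but both roots are O(a). Cancellation at e = 0 turns
the combination into a sum of difference quotients, which pays for the prefactor 1/a. -/
theorem polyBdd_pair {g h : ℝ → ℝ → ℝ} (hg : HClass g) (hh : HClass h) (k l : ℕ) (c : ℝ)
    (h0 : ∀ z, g z 0 + c * h z 0 = 0) :
    PolyBdd (fun a z => -(1 / a) * (g z (root k a) + c * h z (root l a))) := by
  refine ((hg.polyBdd_sub k).add ((hh.polyBdd_sub l).const_mul c)).neg.congr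
    (Eventually.of_forall fun a z _ => ?_)
  linear_combination (-(1 / a)) * h0 z

theorem Hop_LamRem {k : ℕ} {b z : ℝ} (hb : 0 < b) (h : |root k (√b)| < 1 / 2)
    (h' : |root (k - 1) (√b)| < 1 / 2) (hz : √b ≤ z) :
    Hop b (LamRem eigFun k b) z = -(1 / √b) * (reducedOp (lamProfile k) z (root k (√b))
      + lamCoef k * modeCoef (k - 1) * reducedOp (oddHerm (k - 1)) z (root (k - 1) (√b))) / z := by
  have hg := hClass_lamProfile k
  have hh := hClass_oddHerm (k - 1)
  rw [Hop_div hb (fun z hz => LamRem_eq hb h hz)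
    (fun z => ((hg.hasDerivAt_dz z h).add ((hh.hasDerivAt_dz z h').const_mul _)).const_mul _)
    (fun z => ((hg.dz.hasDerivAt_dz z h).add ((hh.dz.hasDerivAt_dz z h').const_mul _)).const_mul _)
    hz, reducedOp, reducedOp]
  ring

/-- The ladder relation holds identically in z, so it can be differentiated twice. This carries the
cancellation over to H_b of the remainder. -/
theorem reducedOp_pair_zero (k : ℕ) (z : ℝ) : reducedOp (lamProfile k) z 0
    + lamCoef k * modeCoef (k - 1) * reducedOp (oddHerm (k - 1)) z 0 = 0 := by
  have h0 : |(0 : ℝ)| < 1 / 2 := by norm_num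
  have hg := hClass_lamProfile k
  have hh := hClass_oddHerm (k - 1)
  set c := lamCoef k * modeCoef (k - 1)
  have d0 : (fun z => lamProfile k z 0 + c * oddHerm (k - 1) z 0) = fun _ => 0 :=
    funext fun z => lamProfile_add_zero k z
  have d1 : (fun z => Dz (lamProfile k) z 0 + c * Dz (oddHerm (k - 1)) z 0) = fun _ => 0 := by
    funext z
    have := (hg.hasDerivAt_dz z h0).add ((hh.hasDerivAt_dz z h0).const_mul c)
    refine this.unique ?_
    have e : ((fun z => lamProfile k z 0) + fun z => c * oddHerm (k - 1) z 0) = fun _ => 0 := d0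
    rw [e]
    exact hasDerivAt_const _ _
  have d2 : Dz (Dz (lamProfile k)) z 0 + c * Dz (Dz (oddHerm (k - 1))) z 0 = 0 := by
    have := (hg.dz.hasDerivAt_dz z h0).add ((hh.dz.hasDerivAt_dz z h0).const_mul c)
    refine this.unique ?_
    have e : ((fun z => Dz (lamProfile k) z 0) + fun z => c * Dz (oddHerm (k - 1)) z 0) =
      fun _ => 0 := d1
    rw [e]
    exact hasDerivAt_const _ _
  have e0 := congrFun d0 z
  have e1 := congrFun d1 z
  rw [reducedOp, reducedOp]
  linear_combination -d2 + z * e1 - e0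

theorem eBdd_LamRem (k : ℕ) : EBdd (fun _ => 1) fun b =>
    wNorm b (LamRem eigFun k b) + wNorm b (Hop b (LamRem eigFun k b)) := by
  have hev := (eventually_sqrt (root_lt k)).and (eventually_sqrt (root_lt (k - 1)))
  have hg := hClass_lamProfile k
  have hh := hClass_oddHerm (k - 1)
  refine EBdd.add one_nonneg_fun ?_ ?_
  · exact eBdd_wNorm_one (polyBdd_pair hg hh k (k - 1) _ (lamProfile_add_zero k))
      (hev.mono fun b ⟨hb, _⟩ z hz => LamRem_eq hb.1 hb.2.2.2 hz)
  · exact eBdd_wNorm_one (polyBdd_pair hg.reducedOp hh.reducedOp k (k - 1) _ (reducedOp_pair_zero k))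
      (hev.mono fun b ⟨hb, hb'⟩ z hz => Hop_LamRem hb.1 hb.2.2.2 hb'.2.2.2 hz)

theorem LamRem_zero (b : ℝ) : LamRem eigFun 0 b = Lam b (eigFun 0 b) := by
  funext z
  simp [LamRem]

/-! ### The diagonalisation -/

/-- Since every large C is admissible, finitely many estimates can share one constant. The threshold
b* is extracted only after that constant is fixed. -/
theorem Ultimately.forall_finset {ι : Type*} (s : Finset ι) {p : ι → ℝ → ℝ → Prop}
    (h : ∀ i ∈ s, Ultimately (p i)) : Ultimately fun C b => ∀ i ∈ s, p i C b := by
  have h' : ∀ᶠ C in atTop, ∀ i ∈ s, ∀ᶠ b in 𝓝[>] (0 : ℝ), p i C b :=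
    (Filter.eventually_all_finset s).2 h
  filter_upwards [h'] with C hC
  exact (Filter.eventually_all_finset s).2 hC

theorem Ultimately.forall_le (K : ℕ) {p : ℕ → ℝ → ℝ → Prop} (h : ∀ i, Ultimately (p i)) :
    Ultimately fun C b => ∀ i, i ≤ K → p i C b :=
  (Ultimately.forall_finset (Finset.range (K + 1)) fun i _ => h i).mono fun _ _ _ hp i hi =>
    hp i (Finset.mem_range.2 (Nat.lt_succ_of_le hi))

theorem Ultimately.exists_pos {p : ℝ → ℝ → Prop} (h : Ultimately p) :
    ∃ bstar : ℝ, 0 < bstar ∧ ∃ C : ℝ, 0 < C ∧ ∀ b, 0 < b → b < bstar → p C b := by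
  obtain ⟨C, hC, hC0⟩ := (Filter.Eventually.and h (eventually_gt_atTop 0)).exists
  obtain ⟨bstar, hb, hsub⟩ := mem_nhdsGT_iff_exists_Ioo_subset.1 hC
  exact ⟨bstar, hb, C, hC0, fun b h1 h2 => hsub ⟨h1, h2⟩⟩

theorem ultimately_abs_le_mul_sqrt {A s : ℝ → ℝ} (hs : ∀ b, 0 < b → 0 ≤ s b)
    (h : ∃ C ≥ 0, ∀ᶠ b in 𝓝[>] (0 : ℝ), |A b| ≤ s b * (C * √b)) :
    Ultimately fun C b => |A b| ≤ s b * (C * √b) := by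
  obtain ⟨C, _, hC⟩ := h
  filter_upwards [eventually_ge_atTop C] with C' hC'
  filter_upwards [hC, self_mem_nhdsWithin] with b h1 hb
  have := hs b hb
  exact h1.trans (by gcongr)

theorem EBdd.ultimately_const {A : ℝ → ENNReal} (h : EBdd (fun _ => 1) A) :
    Ultimately fun C b => A b ≤ ENNReal.ofReal C :=
  (h.ultimately one_nonneg_fun).mono fun C b _ hp => by simpa only [mul_one] using hp

theorem EBdd.ultimately_div {s : ℝ → ℝ} (hs : ∀ b, 0 ≤ 1 / s b) {A : ℝ → ENNReal}
    (h : EBdd (fun b => 1 / s b) A) : Ultimately fun C b => A b ≤ ENNReal.ofReal (C / s b) :=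
  (h.ultimately hs).mono fun C b _ hp => by simpa only [mul_one_div] using hp

theorem EBdd.ultimately_div_self {A : ℝ → ENNReal} (h : EBdd (fun b => 1 / b) A) :
    Ultimately fun C b => A b ≤ ENNReal.ofReal (C / b) := by
  obtain ⟨C, _, hC⟩ := h
  filter_upwards [eventually_ge_atTop C] with C' hC'
  filter_upwards [hC, self_mem_nhdsWithin] with b h1 hb
  have hb' : (0 : ℝ) < b := hb
  refine h1.trans (ENNReal.ofReal_le_ofReal ?_)
  rw [mul_one_div]
  gcongr

theorem ultimately_eigFun (k : ℕ) : Ultimately fun C b =>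
    (MemH1 b (eigFun k b) ∧ ContDiffOn ℝ 3 (eigFun k b) (Ici (√b)) ∧ (∃ z, √b < z ∧ eigFun k b z ≠ 0) ∧
      ∀ z, √b ≤ z → Hop b (eigFun k b) z = eigVal k b * eigFun k b z) ∧
    (|eigVal k b - (2 * k + coefC k ^ 2 * √b)| ≤ C * b ∧
      DifferentiableAt ℝ (eigVal k) b ∧ |deriv (eigVal k) b| ≤ C / √b) ∧
    (∀ z, √b ≤ z → eigFun k b z = Tprofile muCoef k b z + eigRem k b z) ∧
    (∀ j, j < k →
      |muCoef j k b - wInner 0 (Q k) (P j) / (2 * ((j : ℝ) - (k : ℝ))) * √b| ≤ C * b ∧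
      DifferentiableAt ℝ (muCoef j k) b ∧ |deriv (muCoef j k) b| ≤ C / √b) ∧
    (ContDiffOn ℝ 3 (eigRem k b) (Ici (√b)) ∧
      wNormH1 b (eigRem k b) + wNorm b (lap b (eigRem k b)) + wNorm b (Lam b (eigRem k b))
        + wNorm b (fun z => z * eigRem k b z) + wNorm b (fun z => z ^ 2 * eigRem k b z)
        + ENNReal.ofReal (√b * |RadialStefan.dz b (eigRem k b) (√b)|) ≤ ENNReal.ofReal C) ∧
    ((∀ z, √b ≤ z →
        DifferentiableWithinAt ℝ (fun b' => eigRem k b' z) (Ioc 0 (z ^ 2)) b) ∧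
      ContDiffOn ℝ 2 (dB (eigRem k) b) (Ici (√b)) ∧
      wNorm b (RadialStefan.dz b (dB (eigRem k) b)) + wNorm b (dB (eigRem k) b)
        + ENNReal.ofReal (√b * |RadialStefan.dz b (dB (eigRem k) b) (√b)|) ≤ ENNReal.ofReal (C / b)) ∧
    (∀ u : ℝ → ℝ, MemH1 b u → (∀ j, j ≤ k → wInner b u (eigFun j b) = 0) →
      (2 * k + 2 - C * √b) * (wNorm b u).toReal ^ 2 ≤ (wNorm b (RadialStefan.dz b u)).toReal ^ 2) ∧
    (∀ i, i ≤ k →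
      |wInner b (eigFun k b) (eigFun i b) - 1 / b * (if i = k then 1 else 0)| ≤ 1 / b * (C * √b) ∧
      |wInner b (fun z => b * dB (eigFun k) b z) (eigFun i b)
          - -(1 / (2 * b)) * (if i = k then 1 else 0)| ≤ 1 / (2 * b) * (C * √b)) ∧
    (wNorm b (fun z => 2 * b * dB (eigFun k) b z + eigFun k b z)
        + wNorm b (Hop b (fun z => 2 * b * dB (eigFun k) b z + eigFun k b z)) ≤ ENNReal.ofReal C) ∧
    (k = 0 → wNorm b (Lam b (eigFun k b)) ≤ ENNReal.ofReal C) ∧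
    (1 ≤ k → wNorm b (Lam b (eigFun k b)) ≤ ENNReal.ofReal (C / √b)) ∧
    (wNorm b (fun z => z * eigFun k b z) ≤ ENNReal.ofReal (C / √b) ∧
      wNorm b (fun z => z ^ 2 * eigFun k b z) ≤ ENNReal.ofReal (C / √b)) ∧
    (wNorm b (LamRem eigFun k b) + wNorm b (Hop b (LamRem eigFun k b)) ≤ ENNReal.ofReal C) := by
  have hroot : ∀ᶠ b in 𝓝[>] (0 : ℝ), 0 < b ∧ 0 < √b ∧ √b < 1 ∧
      |root k (√b)| < 1 / 2 ∧ DifferentiableAt ℝ (root k) (√b) :=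
    eventually_sqrt ((root_lt k).and (differentiableAt_root k))
  have hinner : Ultimately fun C b => ∀ i, i ≤ k →
      |wInner b (eigFun k b) (eigFun i b) - 1 / b * (if i = k then 1 else 0)|
        ≤ 1 / b * (C * √b) ∧
      |wInner b (fun z => b * dB (eigFun k) b z) (eigFun i b)
          - -(1 / (2 * b)) * (if i = k then 1 else 0)| ≤ 1 / (2 * b) * (C * √b) :=
    Ultimately.forall_le k fun i =>
      (ultimately_abs_le_mul_sqrt (fun b hb => by positivity) (wInner_eigFun_near k i)).and
        (ultimately_abs_le_mul_sqrt (fun b hb => by positivity) (wInner_dB_eigFun_near k i))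
  have hmu : Ultimately fun C b => ∀ j, j < k →
      |muCoef j k b - wInner 0 (Q k) (P j) / (2 * ((j : ℝ) - (k : ℝ))) * √b| ≤ C * b ∧
      DifferentiableAt ℝ (muCoef j k) b ∧ |deriv (muCoef j k) b| ≤ C / √b :=
    (Ultimately.forall_le k fun j => muCoef_estimates j k).mono fun _ _ _ h j hj => h j hj.le
  have hz1 : EBdd (fun b => 1 / √b) fun b => wNorm b (fun z => z * eigFun k b z) := by
    simpa only [pow_one] using eBdd_pow_mul_eigFun k 1
  -- Since R_{b,0} = Λψ_{b,0}, the stronger bound at k = 0 is the remainder estimate itself.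
  have h0 : Ultimately fun C b => k = 0 → wNorm b (Lam b (eigFun k b)) ≤ ENNReal.ofReal C := by
    refine ((eBdd_LamRem 0).ultimately_const).mono fun C b _ h hk => ?_
    subst hk
    rw [← LamRem_zero]
    exact le_self_add.trans h
  have hsq : ∀ b, 0 ≤ 1 / √b := one_div_sqrt_nonneg
  refine ((((Ultimately.of_eventually ((memH1_eigFun k).and
    ((exists_eigFun_ne_zero k).and hroot))).and (eigVal_estimates k)).and (hmu.and
    ((eBdd_eigRem k).ultimately_const.and (eBdd_dB_eigRem k).ultimately_div_self))).and
    (((spectral_gap k).and hinner).and (((eBdd_two_mul_dB_eigFun_add k).ultimately_const.and h0).and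
    (((eBdd_Lam_eigFun k).ultimately_div hsq).and ((hz1.ultimately_div hsq).and
    (((eBdd_pow_mul_eigFun k 2).ultimately_div hsq).and
      (eBdd_LamRem k).ultimately_const)))))).mono ?_
  rintro C b hb ⟨⟨⟨⟨hmem, hne, -, hb', -, hr, hd⟩, hlam⟩, hmu, hrem, hdrem⟩, ⟨hgap, hin⟩,
    ⟨hdB, hL0⟩, hL, hz, hz2, hR⟩
  exact ⟨⟨hmem, contDiffOn_eigFun hb hr, hne, fun z hz => Hop_eigFun hb hr hz⟩, hlam,
    fun z _ => (add_sub_cancel _ _).symm, hmu, ⟨contDiffOn_eigRem hb hr, hrem⟩,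
    ⟨fun z hz => (dB_eigRem hb hr hd hz).1, contDiffOn_dB_eigRem hb hr hd, hdrem⟩, hgap, hin, hdB,
    hL0, fun _ => hL, ⟨hz, hz2⟩, hR⟩

end

theorem mainTheorem2 (K : ℕ) :
    ∃ bstar : ℝ, 0 < bstar ∧ ∃ C : ℝ, 0 < C ∧
    ∃ (lam : ℕ → ℝ → ℝ) (mu : ℕ → ℕ → ℝ → ℝ) (psi psit : ℕ → ℝ → ℝ → ℝ),
    ∀ b : ℝ, 0 < b → b < bstar → ∀ k : ℕ, k ≤ K →
      -- eigenfunctions and eigenvalues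
      (MemH1 b (psi k b) ∧ ContDiffOn ℝ 3 (psi k b) (Ici (√b)) ∧ (∃ z, √b < z ∧ psi k b z ≠ 0) ∧
        ∀ z, √b ≤ z → Hop b (psi k b) z = lam k b * psi k b z) ∧
      -- expansion of the eigenvalues
      (|lam k b - (2 * k + coefC k ^ 2 * √b)| ≤ C * b ∧
        DifferentiableAt ℝ (lam k) b ∧ |deriv (lam k) b| ≤ C / √b) ∧
      -- expansion of the eigenfunctions
      (∀ z, √b ≤ z → psi k b z = Tprofile mu k b z + psit k b z) ∧
      (∀ j, j < k →
        |mu j k b - wInner 0 (Q k) (P j) / (2 * ((j : ℝ) - (k : ℝ))) * √b| ≤ C * b ∧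
        DifferentiableAt ℝ (mu j k) b ∧ |deriv (mu j k) b| ≤ C / √b) ∧
      (ContDiffOn ℝ 3 (psit k b) (Ici (√b)) ∧
        wNormH1 b (psit k b) + wNorm b (lap b (psit k b)) + wNorm b (Lam b (psit k b))
          + wNorm b (fun z => z * psit k b z) + wNorm b (fun z => z ^ 2 * psit k b z)
          + ENNReal.ofReal (√b * |dz b (psit k b) (√b)|) ≤ ENNReal.ofReal C) ∧
      ((∀ z, √b ≤ z →
          DifferentiableWithinAt ℝ (fun b' => psit k b' z) (Ioc 0 (z ^ 2)) b) ∧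
        ContDiffOn ℝ 2 (dB (psit k) b) (Ici (√b)) ∧
        wNorm b (dz b (dB (psit k) b)) + wNorm b (dB (psit k) b)
          + ENNReal.ofReal (√b * |dz b (dB (psit k) b) (√b)|) ≤ ENNReal.ofReal (C / b)) ∧
      -- spectral gap
      (∀ u : ℝ → ℝ, MemH1 b u → (∀ j, j ≤ k → wInner b u (psi j b) = 0) →
        (2 * k + 2 - C * √b) * (wNorm b u).toReal ^ 2 ≤ (wNorm b (dz b u)).toReal ^ 2) ∧
      -- inner products
      (∀ i, i ≤ k →
        |wInner b (psi k b) (psi i b) - 1 / b * (if i = k then 1 else 0)| ≤ 1 / b * (C * √b) ∧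
        |wInner b (fun z => b * dB (psi k) b z) (psi i b)
            - -(1 / (2 * b)) * (if i = k then 1 else 0)| ≤ 1 / (2 * b) * (C * √b)) ∧
      -- further estimates
      (wNorm b (fun z => 2 * b * dB (psi k) b z + psi k b z)
          + wNorm b (Hop b (fun z => 2 * b * dB (psi k) b z + psi k b z)) ≤ ENNReal.ofReal C) ∧
      (k = 0 → wNorm b (Lam b (psi k b)) ≤ ENNReal.ofReal C) ∧
      (1 ≤ k → wNorm b (Lam b (psi k b)) ≤ ENNReal.ofReal (C / √b)) ∧
      (wNorm b (fun z => z * psi k b z) ≤ ENNReal.ofReal (C / √b) ∧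
        wNorm b (fun z => z ^ 2 * psi k b z) ≤ ENNReal.ofReal (C / √b)) ∧
      (wNorm b (LamRem psi k b) + wNorm b (Hop b (LamRem psi k b)) ≤ ENNReal.ofReal C) := by
  obtain ⟨bstar, hb, C, hC, h⟩ := (Ultimately.forall_le K ultimately_eigFun).exists_pos
  exact ⟨bstar, hb, C, hC, eigVal, muCoef, eigFun, eigRem, h⟩
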